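/- Let $n\in\mathbb{N}$, let $R \ge 1$ and let $Q \subset \mathbb{R}^n$ be a unit cube parallel to the axes, i.e. a product of $n$ intervals of length one (each with or without its endpoints). Let $\mu$ be a Borel probability measure on $Q$ with a density $f : Q \to [0,\infty)$ with respect to Lebesgue measure, and assume: (i) $f$ is log-concave: $f(\lambda x + (1-\lambda) y) \ge f(x)^{\lambda} f(y)^{1-\lambda}$ for all $x,y\in Q$ and $0<\lambda<1$; (ii) $f(\lambda x + (1-\lambda) y) \le R\,[\lambda f(x) + (1-\lambda) f(y)]$ for all $0<\lambda<1$ and all $x,y\in Q$ for which $x-y$ has at most one nonzero coordinate. Let $\nu$ be a probability measure on $Q$ that is absolutely continuous with respect to $\mu$. Then $$ W_2^2(\mu,\nu) \le \frac{40}{9}\, R^2\, D(\nu\,\|\,\mu). $$ Here $W_2^2(\mu,\nu) = \inf_\gamma \int |x-y|^2\, d\gamma(x,y)$, where $|\cdot|$ is the Euclidean norm and the infimum runs over all Borel probability measures $\gamma$ on $\mathbb{R}^n\times\mathbb{R}^n$ with first marginal $\mu$ and second marginal $\nu$, and $D(\nu\,\|\,\mu) = \int g\log g\, d\mu \in [0,\infty]$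 with $g = d\nu/d\mu$ is the relative entropy. -/

import Mathlib

open MeasureTheory Set

open scoped ENNReal

/-- A unit cube in `ℝⁿ` parallel to the axes: a product of `n` intervals of length one,
each of which may or may not contain its endpoints. -/
def IsAxisUnitCube {n : ℕ} (Q : Set (EuclideanSpace ℝ (Fin n))) : Prop :=
  ∃ (a : Fin n → ℝ) (I : Fin n → Set ℝ),
    (∀ i, Ioo (a i) (a i + 1) ⊆ I i ∧ I i ⊆ Icc (a i) (a i + 1)) ∧ Q = {x | ∀ i, x i ∈ I i}

/-- `f` is nonnegative and log-concave on `Q` (zero values are allowed). -/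
def IsLogConcaveOn {n : ℕ} (Q : Set (EuclideanSpace ℝ (Fin n)))
    (f : EuclideanSpace ℝ (Fin n) → ℝ) : Prop :=
  (∀ x ∈ Q, 0 ≤ f x) ∧
    ∀ x ∈ Q, ∀ y ∈ Q, ∀ t : ℝ, 0 < t → t < 1 →
      f x ^ t * f y ^ (1 - t) ≤ f (t • x + (1 - t) • y)

/-- `f` is `R`-approximately convex on `Q` along coordinate directions: the inequality is required
for those `x, y ∈ Q` for which `x - y` has at most one nonzero entry. -/
def IsCoordApproxConvexOn {n : ℕ} (R : ℝ) (Q : Set (EuclideanSpace ℝ (Fin n)))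
    (f : EuclideanSpace ℝ (Fin n) → ℝ) : Prop :=
  ∀ x ∈ Q, ∀ y ∈ Q, {i | (x - y) i ≠ 0}.Subsingleton → ∀ t : ℝ, 0 < t → t < 1 →
    f (t • x + (1 - t) • y) ≤ R * (t * f x + (1 - t) * f y)

/-- The squared quadratic transportation cost `W₂²(μ, ν)`: the infimum of `∫ |x - y|² dγ(x, y)`
over all couplings `γ` of `μ` and `ν`. -/
noncomputable def transportCostSq {n : ℕ} (μ ν : Measure (EuclideanSpace ℝ (Fin n))) : ℝ≥0∞ :=
  ⨅ γ : {γ : Measure (EuclideanSpace ℝ (Fin n) × EuclideanSpace ℝ (Fin n)) //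
      IsProbabilityMeasure γ ∧ γ.map Prod.fst = μ ∧ γ.map Prod.snd = ν},
    ∫⁻ p, ENNReal.ofReal (‖p.1 - p.2‖ ^ 2) ∂γ.1

/-!
The inequality is proved by estimating the cost of a Knothe map, without Kantorovich duality.

*The Knothe map.* Let `p` and `g` be densities on the open unit cube, bounded above and below. The
Knothe map from `p` to `g` moves the first coordinate `s` by the monotone transport `S` of the first
marginals, and moves the other coordinates by the Knothe map from the section of `p` at `s` to the
section of `g` at `S s`. First marginals and sections inherit approximate convexity in the coordinate
directions. Log-concavity is passed on in the form of an interpolation inequality, as in the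
inductive proof of the Prékopa–Leindler inequality: the source `f₀` comes with functions `f₁` and
`fₜ` such that `f₀ x ^ (1 - t) * f₁ y ^ t ≤ fₜ ((1 - t) • x + t • y)`, and sections of such triples,
with `f₀` normalized, are again such triples (`KnotheData.section`). Induction on the dimension
(`exists_knothe_map`) shows that the Knothe map `T` from `f₀` to `g` satisfies
`9 / (40 * R ^ 2) * cost T ≤ Ent (g | f₁) + t⁻¹ * log (∫ fₜ) + O(t)`. For `f₀ = f₁ = fₜ = p` the
logarithm vanishes, and `t → 0` yields the transport inequality (`exists_map_cubeCost_le`).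

*Dimension one.* Let `S` transport `F` to `G`. The inequality `log y ≤ y - 1` and the change of
variables `s ↦ (1 - t) * s + t * S s` (`integral_comp_mul_deriv_le`) reduce the claim to the bound
`∫ (S - s)² F ≤ 40 / 9 * R ^ 2 * ∫ (S' - 1 - log S') F`. This is a weighted Hardy inequality
(`integral_sq_unitTransport_sub_le`): `u = S - s` vanishes at both endpoints, so that
`∫ u² F = -2 ∫ u u' H` for every antiderivative `H` of `F`; approximate convexity provides one with
`|H| ≤ R / 2 * F` (`exists_abs_primitiveFn_sub_le`), and `R |u u'|` is at most
`u² / 2 + 20 / 9 * R ^ 2 * (u' - log (1 + u'))` because `|u| ≤ 1` (`mul_abs_le_sq_add_sub_log`).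

*Approximation.* A log-concave density `f` on the cube is bounded and almost everywhere continuous,
and is the limit of its log-Lipschitz majorants `logLipschitzHull N f`, which are log-concave and
approximately convex with the same constant. The target density is truncated
(`exists_hasBoundedRatio_approx`). Since the cost of a pair of points of the cube is at most `n`, a
coupling of the approximations can be corrected to a coupling of the given measures at a price
proportional to the total variation errors (`exists_coupling_of_common_mass`).
-/

open Filter Topology

/-! ### An elementary inequality -/

theorem log_three_le : Real.log 3 ≤ 11 / 10 := by
  have h1 : Real.log 3 = Real.log 2 + Real.log (3 / 2) := by
    rw [← Real.log_mul (by norm_num) (by norm_num)]; norm_num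
  have h2 := Real.log_two_lt_d9
  have h3 : Real.log (3 / 2) ≤ 0.4068 := by
    rw [Real.log_le_iff_le_exp (by norm_num)]
    have := Real.sum_le_exp_of_nonneg (x := 0.4068) (by norm_num) 6
    refine le_trans ?_ this
    norm_num [Finset.sum_range_succ, Nat.factorial]
  linarith

/-- The constant `9 / 40` is dictated by `τ = 2`, where `2 - log 3` exceeds `9 / 10` slightly. -/
theorem sq_le_sub_log {τ : ℝ} (h0 : -1 < τ) (h2 : τ ≤ 2) :
    9 / 40 * τ ^ 2 ≤ τ - Real.log (1 + τ) := by
  set k : ℝ → ℝ := fun x => x - Real.log (1 + x) - 9 / 40 * x ^ 2 with hk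
  have hder : ∀ x, -1 < x → HasDerivAt k (x * (11 - 9 * x) / (20 * (1 + x))) x := by
    intro x hx
    have h1 : HasDerivAt (fun x : ℝ => 1 + x) 1 x := by simpa using (hasDerivAt_id x).const_add 1
    have h := ((hasDerivAt_id x).sub (h1.log (by linarith))).sub
      (((hasDerivAt_id x).pow 2).const_mul (9 / 40))
    refine (h.congr_deriv ?_)
    have : (1 + x) ≠ 0 := by linarith
    simp only [id]
    field_simp
    ring
  have hcont : ContinuousOn k (Ioi (-1)) := fun x hx => (hder x hx).continuousAt.continuousWithinAt
  have hk0 : k 0 = 0 := by simp [hk]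
  suffices 0 ≤ k τ by simp only [hk] at this; linarith
  rcases le_total τ 0 with h | h
  · have : AntitoneOn k (Ioc (-1) 0) := by
      apply antitoneOn_of_deriv_nonpos (convex_Ioc _ _)
      · exact hcont.mono fun x hx => hx.1
      · intro x hx
        rw [interior_Ioc] at hx
        exact (hder x hx.1).differentiableAt.differentiableWithinAt
      · intro x hx
        rw [interior_Ioc] at hx
        rw [(hder x hx.1).deriv]
        have h1 := hx.1
        have h2 := hx.2
        apply div_nonpos_of_nonpos_of_nonneg
        · exact mul_nonpos_of_nonpos_of_nonneg h2.le (by linarith)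
        · linarith
    have := this ⟨h0, h⟩ ⟨by norm_num, le_rfl⟩ h
    linarith
  rcases le_total τ (11 / 9) with h' | h'
  · have : MonotoneOn k (Icc 0 (11 / 9)) := by
      apply monotoneOn_of_deriv_nonneg (convex_Icc _ _)
      · exact hcont.mono fun x hx => by simp only [mem_Ioi]; linarith [hx.1]
      · intro x hx
        rw [interior_Icc] at hx
        exact (hder x (by linarith [hx.1])).differentiableAt.differentiableWithinAt
      · intro x hx
        rw [interior_Icc] at hx
        rw [(hder x (by linarith [hx.1])).deriv]
        have h1 := hx.1
        have h2 := hx.2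
        apply div_nonneg
        · exact mul_nonneg h1.le (by linarith)
        · linarith
    have := this ⟨le_rfl, by norm_num⟩ ⟨h, h'⟩ h
    linarith
  · have : AntitoneOn k (Icc (11 / 9) 2) := by
      apply antitoneOn_of_deriv_nonpos (convex_Icc _ _)
      · exact hcont.mono fun x hx => by simp only [mem_Ioi]; linarith [hx.1]
      · intro x hx
        rw [interior_Icc] at hx
        exact (hder x (by linarith [hx.1])).differentiableAt.differentiableWithinAt
      · intro x hx
        rw [interior_Icc] at hx
        rw [(hder x (by linarith [hx.1])).deriv]
        have h1 := hx.1
        have h2 := hx.2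
        apply div_nonpos_of_nonpos_of_nonneg
        · exact mul_nonpos_of_nonneg_of_nonpos (by linarith) (by linarith)
        · linarith
    have := this ⟨h', h2⟩ ⟨by norm_num, le_rfl⟩ h2
    have h3 : 0 ≤ k 2 := by
      simp only [hk]
      norm_num
      linarith [log_three_le]
    linarith

theorem linear_le_sub_log {τ : ℝ} (h2 : 2 ≤ τ) : 9 / 20 * τ ≤ τ - Real.log (1 + τ) := by
  have h1 : Real.log (1 + τ) = Real.log 3 + Real.log ((1 + τ) / 3) := by
    rw [← Real.log_mul (by norm_num) (by positivity)]; congr 1; ring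
  have h3 := Real.log_le_sub_one_of_pos (x := (1 + τ) / 3) (by positivity)
  linarith [log_three_le]

/-- The estimate of the cross term in the Hardy inequality. For `τ ≤ 2` it is Young's inequality; for
`τ ≥ 2`, where `τ - log (1 + τ)` grows only linearly, it relies on `|u| ≤ 1` and `R ≤ R ^ 2`. -/
theorem mul_abs_le_sq_add_sub_log {R u τ : ℝ} (hR : 1 ≤ R) (hu : |u| ≤ 1) (hτ : -1 < τ) :
    R * (|u| * |τ|) ≤ 1 / 2 * u ^ 2 + 20 / 9 * R ^ 2 * (τ - Real.log (1 + τ)) := by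
  rcases le_total τ 2 with h | h
  · have h1 := sq_le_sub_log hτ h
    have h2 : 20 / 9 * R ^ 2 * (9 / 40 * τ ^ 2) ≤ 20 / 9 * R ^ 2 * (τ - Real.log (1 + τ)) := by
      gcongr
    have h3 : R * (|u| * |τ|) ≤ 1 / 2 * |u| ^ 2 + 1 / 2 * (R * |τ|) ^ 2 := by
      nlinarith [sq_nonneg (|u| - R * |τ|)]
    rw [mul_pow, sq_abs, sq_abs] at h3
    linarith
  · have h1 := linear_le_sub_log h
    have h2 : 20 / 9 * R ^ 2 * (9 / 20 * τ) ≤ 20 / 9 * R ^ 2 * (τ - Real.log (1 + τ)) := by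
      gcongr
    have h3 : |τ| = τ := abs_of_nonneg (by linarith)
    have h4 : R * (|u| * |τ|) ≤ R ^ 2 * τ := by
      rw [h3]
      calc R * (|u| * τ) ≤ R * (1 * τ) := by gcongr
        _ ≤ R * (R * τ) := by gcongr
        _ = R ^ 2 * τ := by ring
    nlinarith [sq_nonneg u]

theorem sub_two_mul_sq_le_log_one_add {x : ℝ} (hx : |x| ≤ 1 / 2) :
    x - 2 * x ^ 2 ≤ Real.log (1 + x) := by
  have h3 := Real.abs_log_sub_add_sum_range_le (x := -x) (by rw [abs_neg]; linarith) 1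
  simp only [Finset.sum_range_one, zero_add, pow_one, Nat.cast_zero, div_one, sub_neg_eq_add,
    abs_neg] at h3
  have h4 := (abs_le.1 h3).1
  have h5 : |x| ^ (1 + 1) / (1 - |x|) ≤ 2 * x ^ 2 := by
    rw [div_le_iff₀ (by linarith)]
    norm_num
    nlinarith [sq_nonneg x]
  linarith

/-! ### Densities on the unit interval and their monotone transport -/

/-- Lebesgue measure on the open unit interval. -/
noncomputable abbrev unitMeasure : Measure ℝ := volume.restrict (Ioo 0 1)

instance : IsProbabilityMeasure unitMeasure := ⟨by simp [unitMeasure]⟩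

/-- A positive function all of whose values are comparable up to the factor `β`. The condition is
invariant under scaling, hence inherited by sections and marginals. -/
def HasBoundedRatio {α : Type*} (β : ℝ) (f : α → ℝ) : Prop :=
  (∀ x, 0 < f x) ∧ ∀ x y, f x ≤ β * f y

namespace HasBoundedRatio

variable {α : Type*} {β : ℝ} {f : α → ℝ}

theorem one_le [Nonempty α] (h : HasBoundedRatio β f) : 1 ≤ β := by
  obtain ⟨x⟩ := ‹Nonempty α›
  have h1 := h.1 x
  have h2 := h.2 x x
  nlinarith

theorem integrable [MeasurableSpace α] [Nonempty α] {μ : Measure α} [IsFiniteMeasure μ]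
    (h : HasBoundedRatio β f) (hm : Measurable f) : Integrable f μ := by
  obtain ⟨x⟩ := ‹Nonempty α›
  refine Integrable.of_bound hm.aestronglyMeasurable (β * f x) (.of_forall fun y => ?_)
  rw [Real.norm_of_nonneg (h.1 y).le]
  exact h.2 y x

theorem le_mul_integral [MeasurableSpace α] {μ : Measure α} [IsProbabilityMeasure μ]
    (h : HasBoundedRatio β f) (hm : Measurable f) (x : α) : f x ≤ β * ∫ y, f y ∂μ := by
  have : Nonempty α := ⟨x⟩
  have h1 : ∫ _y, f x ∂μ ≤ ∫ y, β * f y ∂μ :=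
    integral_mono (integrable_const _) ((h.integrable hm).const_mul _) fun y => h.2 x y
  simpa [integral_const_mul] using h1

theorem integral_le_mul [MeasurableSpace α] {μ : Measure α} [IsProbabilityMeasure μ]
    (h : HasBoundedRatio β f) (hm : Measurable f) (x : α) : ∫ y, f y ∂μ ≤ β * f x := by
  have : Nonempty α := ⟨x⟩
  have h1 : ∫ y, f y ∂μ ≤ ∫ _y, β * f x ∂μ :=
    integral_mono (h.integrable hm) (integrable_const _) fun y => h.2 y x
  simpa using h1

theorem integral_pos [MeasurableSpace α] {μ : Measure α} [IsProbabilityMeasure μ]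
    (h : HasBoundedRatio β f) (hm : Measurable f) : 0 < ∫ y, f y ∂μ := by
  have : Nonempty α := nonempty_of_isProbabilityMeasure μ
  obtain ⟨x⟩ := this
  have : Nonempty α := ⟨x⟩
  have h1 := h.le_mul_integral (μ := μ) hm x
  have h2 := h.1 x
  have h3 := h.one_le
  by_contra! h4
  nlinarith

theorem comp {γ : Type*} (h : HasBoundedRatio β f) (g : γ → α) :
    HasBoundedRatio β fun x => f (g x) :=
  ⟨fun _ => h.1 _, fun _ _ => h.2 _ _⟩

theorem mul_const (h : HasBoundedRatio β f) {c : ℝ} (hc : 0 < c) :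
    HasBoundedRatio β fun x => f x * c := by
  refine ⟨fun x => mul_pos (h.1 x) hc, fun x y => ?_⟩
  rw [← mul_assoc]
  exact mul_le_mul_of_nonneg_right (h.2 x y) hc.le

theorem div_const (h : HasBoundedRatio β f) {c : ℝ} (hc : 0 < c) :
    HasBoundedRatio β fun x => f x / c := by
  simpa only [div_eq_mul_inv] using h.mul_const (inv_pos.2 hc)

theorem integral_right {γ : Type*} [MeasurableSpace γ] [Nonempty γ] {μ : Measure γ}
    [IsProbabilityMeasure μ] [MeasurableSpace α] {f : α × γ → ℝ}
    (h : HasBoundedRatio β f) (hm : Measurable f) :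
    HasBoundedRatio β fun x => ∫ y, f (x, y) ∂μ := by
  have hm' : ∀ x, Measurable fun y => f (x, y) := fun x => hm.comp measurable_prodMk_left
  refine ⟨fun x => (h.comp fun y => (x, y)).integral_pos (hm' x), fun x y => ?_⟩
  rw [← integral_const_mul]
  exact integral_mono ((h.comp fun y => (x, y)).integrable (hm' x))
    (((h.comp fun z => (y, z)).integrable (hm' y)).const_mul _) fun z => h.2 _ _

/-- The logarithm of a function of bounded ratio is bounded. -/
theorem exists_abs_log_le [Nonempty α] (h : HasBoundedRatio β f) :
    ∃ C, ∀ x, |Real.log (f x)| ≤ C := by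
  obtain ⟨x₀⟩ := ‹Nonempty α›
  have : Nonempty α := ⟨x₀⟩
  have hβ := h.one_le
  refine ⟨Real.log β + |Real.log (f x₀)|, fun x => ?_⟩
  have h1 : Real.log (f x) ≤ Real.log β + Real.log (f x₀) := by
    rw [← Real.log_mul (by positivity) (h.1 _).ne']
    exact Real.log_le_log (h.1 _) (h.2 _ _)
  have h2 : Real.log (f x₀) ≤ Real.log β + Real.log (f x) := by
    rw [← Real.log_mul (by positivity) (h.1 _).ne']
    exact Real.log_le_log (h.1 _) (h.2 _ _)
  rw [abs_le]
  constructor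
  · linarith [neg_abs_le (Real.log (f x₀))]
  · linarith [le_abs_self (Real.log (f x₀))]

end HasBoundedRatio

/-- A probability density on `(0, 1)` of bounded ratio. It is a function on the whole line, so
that its primitive is a homeomorphism of the line. -/
structure IsUnitDensity (β : ℝ) (F : ℝ → ℝ) : Prop where
  measurable : Measurable F
  ratio : HasBoundedRatio β F
  integral_eq_one : ∫ s, F s ∂unitMeasure = 1

/-- The primitive of `F` that vanishes at `0`; on the unit interval, the distribution function of
the density `F`. -/
noncomputable def primitiveFn (F : ℝ → ℝ) (s : ℝ) : ℝ := ∫ r in (0)..s, F r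

namespace IsUnitDensity

variable {β : ℝ} {F G : ℝ → ℝ}

theorem le (h : IsUnitDensity β F) (s : ℝ) : F s ≤ β := by
  simpa [h.integral_eq_one] using h.ratio.le_mul_integral (μ := unitMeasure) h.measurable s

theorem one_le_mul (h : IsUnitDensity β F) (s : ℝ) : 1 ≤ β * F s := by
  simpa [h.integral_eq_one] using h.ratio.integral_le_mul (μ := unitMeasure) h.measurable s

theorem one_le (h : IsUnitDensity β F) : 1 ≤ β := h.ratio.one_le

theorem pos (h : IsUnitDensity β F) (s : ℝ) : 0 < F s := h.ratio.1 s

theorem locallyIntegrable (h : IsUnitDensity β F) : LocallyIntegrable F volume := by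
  refine (locallyIntegrable_const β).mono h.measurable.aestronglyMeasurable (.of_forall fun s => ?_)
  rw [Real.norm_of_nonneg (h.pos s).le, Real.norm_of_nonneg (by linarith [h.one_le])]
  exact h.le s

theorem intervalIntegrable (h : IsUnitDensity β F) (a b : ℝ) : IntervalIntegrable F volume a b :=
  h.locallyIntegrable.integrableOn_isCompact isCompact_uIcc |>.mono_set uIoc_subset_uIcc
    |> intervalIntegrable_iff.mpr

theorem integral_eq_primitiveFn_sub (h : IsUnitDensity β F) (a b : ℝ) :
    ∫ r in a..b, F r = primitiveFn F b - primitiveFn F a := by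
  unfold primitiveFn
  rw [intervalIntegral.integral_interval_sub_left (h.intervalIntegrable _ _)
    (h.intervalIntegrable _ _)]

theorem primitiveFn_sub_le (h : IsUnitDensity β F) {a b : ℝ} (hab : a ≤ b) :
    primitiveFn F b - primitiveFn F a ≤ β * (b - a) := by
  rw [← h.integral_eq_primitiveFn_sub]
  have := intervalIntegral.integral_mono_on hab (h.intervalIntegrable a b)
    (intervalIntegrable_const (c := β)) fun x _ => h.le x
  simpa [mul_comm] using this

theorem le_primitiveFn_sub (h : IsUnitDensity β F) {a b : ℝ} (hab : a ≤ b) :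
    b - a ≤ β * (primitiveFn F b - primitiveFn F a) := by
  rw [← h.integral_eq_primitiveFn_sub, ← intervalIntegral.integral_const_mul]
  have := intervalIntegral.integral_mono_on hab (intervalIntegrable_const (c := (1 : ℝ)))
    ((h.intervalIntegrable a b).const_mul β) fun x _ => h.one_le_mul x
  simpa using this

theorem primitiveFn_strictMono (h : IsUnitDensity β F) : StrictMono (primitiveFn F) := by
  intro a b hab
  have := h.le_primitiveFn_sub hab.le
  have hβ := h.one_le
  by_contra! h4
  nlinarith

theorem primitiveFn_zero : primitiveFn F 0 = 0 := by simp [primitiveFn]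

theorem primitiveFn_one (h : IsUnitDensity β F) : primitiveFn F 1 = 1 := by
  rw [primitiveFn, intervalIntegral.integral_of_le zero_le_one, integral_Ioc_eq_integral_Ioo]
  exact h.integral_eq_one

theorem continuous_primitiveFn (h : IsUnitDensity β F) : Continuous (primitiveFn F) :=
  intervalIntegral.continuous_primitive h.intervalIntegrable 0

theorem ae_hasDerivAt_primitiveFn (h : IsUnitDensity β F) :
    ∀ᵐ s, HasDerivAt (primitiveFn F) (F s) s := by
  filter_upwards [LocallyIntegrable.ae_hasDerivAt_integral h.locallyIntegrable] with s hs
  exact hs 0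

theorem withDensity_Iic (h : IsUnitDensity β F) {s : ℝ} (hs : s ∈ Icc (0 : ℝ) 1) :
    unitMeasure.withDensity (fun r => ENNReal.ofReal (F r)) (Iic s) =
      ENNReal.ofReal (primitiveFn F s) := by
  rw [withDensity_apply _ measurableSet_Iic, ← setLIntegral_congr Iio_ae_eq_Iic,
    Measure.restrict_restrict measurableSet_Iio]
  have : Iio s ∩ Ioo 0 1 = Ioo 0 s := by
    ext r; simp only [mem_inter_iff, mem_Iio, mem_Ioo]
    constructor
    · tauto
    · intro h; exact ⟨h.2, h.1, by linarith [hs.2, h.2]⟩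
  rw [this, primitiveFn, intervalIntegral.integral_of_le hs.1, integral_Ioc_eq_integral_Ioo,
    ofReal_integral_eq_lintegral_ofReal]
  · exact (intervalIntegrable_iff_integrableOn_Ioo_of_le hs.1).1 (h.intervalIntegrable 0 s)
  · exact .of_forall fun r => (h.pos r).le

end IsUnitDensity

/-- The monotone transport from the density `F` to the density `G` on the unit interval, i.e. the
`r` at which the distribution function of `G` reaches the value of that of `F` at `s`. Writing it
as a length makes its joint measurability in `s` and in parameters evident. -/
noncomputable def unitTransport (F G : ℝ → ℝ) (s : ℝ) : ℝ :=
  unitMeasure.real {r | primitiveFn G r < primitiveFn F s}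

namespace IsUnitDensity

variable {β : ℝ} {F G : ℝ → ℝ}

theorem unitTransport_spec (hF : IsUnitDensity β F) (hG : IsUnitDensity β G) {s : ℝ}
    (hs : s ∈ Icc (0 : ℝ) 1) :
    unitTransport F G s ∈ Icc (0 : ℝ) 1 ∧ primitiveFn G (unitTransport F G s) = primitiveFn F s := by
  have h1 : primitiveFn F s ∈ Icc (primitiveFn G 0) (primitiveFn G 1) := by
    rw [primitiveFn_zero, hG.primitiveFn_one, ← hF.primitiveFn_one, ← primitiveFn_zero (F := F)]
    exact ⟨hF.primitiveFn_strictMono.monotone hs.1, hF.primitiveFn_strictMono.monotone hs.2⟩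
  obtain ⟨q, hq, hqs⟩ := intermediate_value_Icc zero_le_one hG.continuous_primitiveFn.continuousOn h1
  have : unitTransport F G s = q := by
    have h2 : {r | primitiveFn G r < primitiveFn F s} = Iio q := by
      ext r
      rw [mem_ofPred_eq, ← hqs, hG.primitiveFn_strictMono.lt_iff_lt, mem_Iio]
    have h3 : Iio q ∩ Ioo 0 1 = Ioo 0 q := by
      ext r; simp only [mem_inter_iff, mem_Iio, mem_Ioo]
      constructor
      · tauto
      · intro h; exact ⟨h.2, h.1, by linarith [hq.2, h.2]⟩
    rw [unitTransport, h2, measureReal_restrict_apply measurableSet_Iio, h3]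
    simp [hq.1]
  rw [this]
  exact ⟨hq, hqs⟩

theorem unitTransport_zero (hF : IsUnitDensity β F) (hG : IsUnitDensity β G) :
    unitTransport F G 0 = 0 := by
  apply hG.primitiveFn_strictMono.injective
  rw [(hF.unitTransport_spec hG (by simp)).2, primitiveFn_zero, primitiveFn_zero]

theorem unitTransport_one (hF : IsUnitDensity β F) (hG : IsUnitDensity β G) :
    unitTransport F G 1 = 1 := by
  apply hG.primitiveFn_strictMono.injective
  rw [(hF.unitTransport_spec hG (by simp)).2, hF.primitiveFn_one, hG.primitiveFn_one]

theorem unitTransport_strictMonoOn (hF : IsUnitDensity β F) (hG : IsUnitDensity β G) :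
    StrictMonoOn (unitTransport F G) (Icc 0 1) := by
  intro a ha b hb hab
  rw [← hG.primitiveFn_strictMono.lt_iff_lt, (hF.unitTransport_spec hG ha).2,
    (hF.unitTransport_spec hG hb).2]
  exact hF.primitiveFn_strictMono hab

theorem unitTransport_mem_Ioo (hF : IsUnitDensity β F) (hG : IsUnitDensity β G) {s : ℝ}
    (hs : s ∈ Ioo (0 : ℝ) 1) : unitTransport F G s ∈ Ioo (0 : ℝ) 1 := by
  have h := hF.unitTransport_strictMonoOn hG
  constructor
  · rw [← hF.unitTransport_zero hG]
    exact h (by simp) ⟨hs.1.le, hs.2.le⟩ hs.1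
  · conv_rhs => rw [← hF.unitTransport_one hG]
    exact h ⟨hs.1.le, hs.2.le⟩ (by simp) hs.2

theorem unitTransport_lipschitzOn (hF : IsUnitDensity β F) (hG : IsUnitDensity β G) :
    LipschitzOnWith (Real.toNNReal (β ^ 2)) (unitTransport F G) (Icc 0 1) := by
  have key : ∀ a ∈ Icc (0 : ℝ) 1, ∀ b ∈ Icc (0 : ℝ) 1, a ≤ b →
      dist (unitTransport F G a) (unitTransport F G b) ≤ β ^ 2 * dist a b := by
    intro a ha b hb hab
    have h1 := (hF.unitTransport_strictMonoOn hG).monotoneOn ha hb hab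
    rw [dist_comm, dist_comm a b, Real.dist_eq, Real.dist_eq, abs_of_nonneg (by linarith),
      abs_of_nonneg (by linarith)]
    have h2 := hG.le_primitiveFn_sub h1
    rw [(hF.unitTransport_spec hG ha).2, (hF.unitTransport_spec hG hb).2] at h2
    have h3 := hF.primitiveFn_sub_le hab
    have hβ := hF.one_le
    calc _ ≤ _ := h2
      _ ≤ β * (β * (b - a)) := by gcongr
      _ = _ := by ring
  apply LipschitzOnWith.of_dist_le_mul
  intro a ha b hb
  rw [Real.coe_toNNReal _ (sq_nonneg β)]
  rcases le_total a b with h | h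
  · exact key a ha b hb h
  · rw [dist_comm, dist_comm a b]
    exact key b hb a ha h

theorem measurable_unitTransport (hF : IsUnitDensity β F) (hG : IsUnitDensity β G) :
    Measurable (unitTransport F G) := by
  have : MeasurableSet {p : ℝ × ℝ | primitiveFn G p.2 < primitiveFn F p.1} :=
    measurableSet_lt (hG.continuous_primitiveFn.measurable.comp measurable_snd)
      (hF.continuous_primitiveFn.measurable.comp measurable_fst)
  exact (measurable_measure_prodMk_left this).ennreal_toReal

/-- The monotone transport pushes `F` forward to `G`. -/
theorem map_unitTransport (hF : IsUnitDensity β F) (hG : IsUnitDensity β G) :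
    (unitMeasure.withDensity fun s => ENNReal.ofReal (F s)).map (unitTransport F G) =
      unitMeasure.withDensity fun s => ENNReal.ofReal (G s) := by
  have hm := hF.measurable_unitTransport hG
  have : IsFiniteMeasure (unitMeasure.withDensity fun s => ENNReal.ofReal (F s)) :=
    isFiniteMeasure_withDensity_ofReal (hF.ratio.integrable hF.measurable).2
  have : IsFiniteMeasure (unitMeasure.withDensity fun s => ENNReal.ofReal (G s)) :=
    isFiniteMeasure_withDensity_ofReal (hG.ratio.integrable hG.measurable).2
  have hac : ∀ H : ℝ → ℝ, ∀ᵐ s ∂unitMeasure.withDensity (fun s => ENNReal.ofReal (H s)),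
      s ∈ Ioo (0 : ℝ) 1 := fun H =>
    (withDensity_absolutelyContinuous _ _).ae_le (ae_restrict_mem measurableSet_Ioo)
  refine Measure.ext_of_Iic _ _ fun r => ?_
  set c : ℝ := max 0 (min r 1) with hc
  have hc01 : c ∈ Icc (0 : ℝ) 1 := ⟨le_max_left _ _, by simp [hc]⟩
  have hrc : ∀ y ∈ Ioo (0 : ℝ) 1, (y ≤ r ↔ y ≤ c) := by
    intro y hy
    simp only [hc, le_max_iff, le_min_iff]
    constructor
    · intro h; exact Or.inr ⟨h, hy.2.le⟩
    · rintro (h | h)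
      · exact absurd hy.1 (not_lt.2 h)
      · exact h.1
  obtain ⟨hq, hqc⟩ := hG.unitTransport_spec hF hc01
  set q := unitTransport G F c
  rw [Measure.map_apply hm measurableSet_Iic]
  have h1 : unitTransport F G ⁻¹' Iic r =ᵐ[unitMeasure.withDensity fun s => ENNReal.ofReal (F s)]
      Iic q := by
    filter_upwards [hac F] with s hs
    refine propext ?_
    change unitTransport F G s ≤ r ↔ s ≤ q
    rw [hrc _ (hF.unitTransport_mem_Ioo hG hs), ← hG.primitiveFn_strictMono.le_iff_le,
      (hF.unitTransport_spec hG ⟨hs.1.le, hs.2.le⟩).2, ← hqc,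
      hF.primitiveFn_strictMono.le_iff_le]
  have h2 : Iic r =ᵐ[unitMeasure.withDensity fun s => ENNReal.ofReal (G s)] Iic c := by
    filter_upwards [hac G] with s hs
    exact propext (hrc s hs)
  rw [measure_congr h1, measure_congr h2, hF.withDensity_Iic hq, hG.withDensity_Iic hc01, hqc]

/-- The derivative of the monotone transport, from `primitiveFn G ∘ S = primitiveFn F`. -/
theorem ae_hasDerivAt_unitTransport (hF : IsUnitDensity β F) (hG : IsUnitDensity β G) :
    ∀ᵐ s ∂unitMeasure,
      HasDerivAt (unitTransport F G) (F s / G (unitTransport F G s)) s := by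
  have hm := hF.measurable_unitTransport hG
  have hG' : ∀ᵐ r ∂unitMeasure.withDensity (fun s => ENNReal.ofReal (G s)),
      HasDerivAt (primitiveFn G) (G r) r :=
    (withDensity_absolutelyContinuous _ _).ae_le (ae_restrict_of_ae hG.ae_hasDerivAt_primitiveFn)
  rw [← hF.map_unitTransport hG] at hG'
  have h1 := ae_of_ae_map hm.aemeasurable hG'
  rw [ae_withDensity_iff hF.measurable.ennreal_ofReal] at h1
  have h2 := (hF.unitTransport_lipschitzOn hG)
  rw [← uIcc_of_le (zero_le_one' ℝ)] at h2
  have h3 := h2.absolutelyContinuousOnInterval.ae_differentiableAt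
  filter_upwards [h1, ae_restrict_of_ae h3, ae_restrict_of_ae hF.ae_hasDerivAt_primitiveFn,
    ae_restrict_mem measurableSet_Ioo] with s hs1 hs2 hs3 hs4
  have hs1 := hs1 (by simp [hF.pos s])
  have hs5 : s ∈ uIcc (0 : ℝ) 1 := by
    rw [uIcc_of_le zero_le_one]; exact ⟨hs4.1.le, hs4.2.le⟩
  have hd := (hs2 hs5).hasDerivAt
  have h4 : HasDerivAt (primitiveFn F) (G (unitTransport F G s) * deriv (unitTransport F G) s) s := by
    refine (hs1.comp s hd).congr_of_eventuallyEq ?_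
    filter_upwards [Ioo_mem_nhds hs4.1 hs4.2] with y hy
    exact (hF.unitTransport_spec hG ⟨hy.1.le, hy.2.le⟩).2.symm
  have h5 := h4.unique hs3
  rw [← h5, mul_div_cancel_left₀ _ (hG.pos _).ne']
  exact hd

end IsUnitDensity

/-- Change of variables between densities, for real integrands. -/
theorem integral_mul_comp_of_map_withDensity {α γ : Type*} [MeasurableSpace α] [MeasurableSpace γ]
    {μ : Measure α} {ν : Measure γ} {f : α → ℝ} {g : γ → ℝ} {T : α → γ}
    (hf : Measurable f) (hg : Measurable g) (hf0 : ∀ x, 0 ≤ f x) (hg0 : ∀ x, 0 ≤ g x)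
    (hT : Measurable T)
    (hmap : (μ.withDensity fun x => ENNReal.ofReal (f x)).map T =
      ν.withDensity fun y => ENNReal.ofReal (g y))
    {φ : γ → ℝ} (hφ : Measurable φ) :
    ∫ x, f x * φ (T x) ∂μ = ∫ y, g y * φ y ∂ν := by
  have h := integral_map (μ := μ.withDensity fun x => ENNReal.ofReal (f x)) hT.aemeasurable
    (f := φ) hφ.aestronglyMeasurable
  rw [hmap, integral_withDensity_eq_integral_toReal_smul hg.ennreal_ofReal (by simp),
    integral_withDensity_eq_integral_toReal_smul hf.ennreal_ofReal (by simp)] at h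
  simp only [ENNReal.toReal_ofReal (hf0 _), ENNReal.toReal_ofReal (hg0 _), smul_eq_mul] at h
  exact h.symm

/-! ### The weighted Hardy inequality on the unit interval -/

/-- `F` is convex on `(0, 1)` up to the factor `R`. -/
def IsApproxConvexUnit (R : ℝ) (F : ℝ → ℝ) : Prop :=
  ∀ x ∈ Ioo (0 : ℝ) 1, ∀ y ∈ Ioo (0 : ℝ) 1, ∀ t : ℝ, 0 < t → t < 1 →
    F (t * x + (1 - t) * y) ≤ R * (t * F x + (1 - t) * F y)

namespace IsUnitDensity

variable {β R : ℝ} {F G Φ : ℝ → ℝ}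

/-- The trapezoidal bound: `F` is integrated along the segment from `a` to `b`. -/
theorem primitiveFn_sub_le_of_approxConvex (hF : IsUnitDensity β F) (hc : IsApproxConvexUnit R F)
    (hR : 0 ≤ R) {a b : ℝ} (ha : a ∈ Ioo (0 : ℝ) 1) (hb : b ∈ Ioo (0 : ℝ) 1) (hab : a ≤ b) :
    primitiveFn F b - primitiveFn F a ≤ R / 2 * (F a + F b) := by
  have h1 : primitiveFn F b - primitiveFn F a = (b - a) * ∫ θ in (0)..1, F (a + (b - a) * θ) := by
    rw [← hF.integral_eq_primitiveFn_sub, ← smul_eq_mul,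
      intervalIntegral.smul_integral_comp_add_mul]
    simp
  have h2 : ∫ θ in (0)..1, F (a + (b - a) * θ) ≤
      ∫ θ in (0 : ℝ)..1, R * (θ * F b + (1 - θ) * F a) := by
    apply intervalIntegral.integral_mono_on_of_le_Ioo zero_le_one
    · apply IntervalIntegrable.mono_fun (g := fun θ => F (a + (b - a) * θ))
        (f := fun _ => β) intervalIntegrable_const
      · exact (hF.measurable.comp (by fun_prop)).aestronglyMeasurable
      · refine .of_forall fun θ => ?_
        simp only
        rw [Real.norm_of_nonneg (hF.pos _).le, Real.norm_of_nonneg (by linarith [hF.one_le])]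
        exact hF.le _
    · exact Continuous.intervalIntegrable (by fun_prop) _ _
    · intro θ hθ
      have := hc b hb a ha θ hθ.1 hθ.2
      have h3 : a + (b - a) * θ = θ * b + (1 - θ) * a := by ring
      rwa [h3]
  have h3 : ∫ θ in (0 : ℝ)..1, R * (θ * F b + (1 - θ) * F a) = R / 2 * (F a + F b) := by
    have : ∀ θ : ℝ, R * (θ * F b + (1 - θ) * F a) = R * F a + (R * (F b - F a)) * θ := by
      intro θ; ring
    rw [intervalIntegral.integral_congr fun θ _ => this θ,
      intervalIntegral.integral_add intervalIntegrable_const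
      (Continuous.intervalIntegrable (by fun_prop) _ _), intervalIntegral.integral_const,
      intervalIntegral.integral_const_mul, integral_id, smul_eq_mul]
    ring
  have h4 : 0 ≤ R / 2 * (F a + F b) := by
    have := (hF.pos a).le
    have := (hF.pos b).le
    positivity
  rw [h1]
  calc (b - a) * ∫ θ in (0)..1, F (a + (b - a) * θ) ≤ (b - a) * (R / 2 * (F a + F b)) := by
        rw [← h3]; exact mul_le_mul_of_nonneg_left h2 (by linarith)
    _ ≤ 1 * (R / 2 * (F a + F b)) := by
        apply mul_le_mul_of_nonneg_right _ h4
        linarith [hb.2, ha.1]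
    _ = _ := one_mul _

/-- Approximate convexity makes a suitable antiderivative of `F` dominated by `F` itself. The
constant exists because the intervals `[primitive - R F / 2, primitive + R F / 2]` meet pairwise. -/
theorem exists_abs_primitiveFn_sub_le (hF : IsUnitDensity β F) (hc : IsApproxConvexUnit R F)
    (hR : 0 ≤ R) : ∃ c, ∀ s ∈ Ioo (0 : ℝ) 1, |primitiveFn F s - c| ≤ R / 2 * F s := by
  have key : ∀ s ∈ Ioo (0 : ℝ) 1, ∀ r ∈ Ioo (0 : ℝ) 1,
      primitiveFn F s - R / 2 * F s ≤ primitiveFn F r + R / 2 * F r := by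
    intro s hs r hr
    have h1 : 0 ≤ R / 2 * F s := mul_nonneg (by linarith) (hF.pos s).le
    have h2 : 0 ≤ R / 2 * F r := mul_nonneg (by linarith) (hF.pos r).le
    rcases le_total r s with h | h
    · have := hF.primitiveFn_sub_le_of_approxConvex hc hR hr hs h
      linarith
    · have := hF.primitiveFn_strictMono.monotone h
      linarith
  have hne : (Ioo (0 : ℝ) 1).Nonempty := nonempty_Ioo.2 zero_lt_one
  obtain ⟨r₀, hr₀⟩ := hne
  refine ⟨sSup ((fun s => primitiveFn F s - R / 2 * F s) '' Ioo 0 1), fun s hs => ?_⟩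
  have h1 : primitiveFn F s - R / 2 * F s ≤
      sSup ((fun s => primitiveFn F s - R / 2 * F s) '' Ioo 0 1) := by
    refine le_csSup ⟨primitiveFn F r₀ + R / 2 * F r₀, ?_⟩ ⟨s, hs, rfl⟩
    rintro _ ⟨s', hs', rfl⟩
    exact key s' hs' r₀ hr₀
  have h2 : sSup ((fun s => primitiveFn F s - R / 2 * F s) '' Ioo 0 1) ≤
      primitiveFn F s + R / 2 * F s := by
    refine csSup_le ⟨_, r₀, hr₀, rfl⟩ ?_
    rintro _ ⟨s', hs', rfl⟩
    exact key s' hs' s hs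
  rw [abs_le]
  constructor <;> linarith

/-- The function in question is the a.e. derivative of the monotone transport. -/
theorem hasBoundedRatio_transportDeriv (hF : IsUnitDensity β F) (hG : IsUnitDensity β G) :
    HasBoundedRatio (β ^ 2) fun s => F s / G (unitTransport F G s) := by
  have hβ := hF.one_le
  refine ⟨fun s => div_pos (hF.pos s) (hG.pos _), fun x y => ?_⟩
  have h1 := hF.ratio.2 x y
  have h2 := hG.ratio.2 (unitTransport F G y) (unitTransport F G x)
  rw [← mul_div_assoc, div_le_div_iff₀ (hG.pos _) (hG.pos _)]
  calc F x * G (unitTransport F G y) ≤ (β * F y) * (β * G (unitTransport F G x)) := by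
        apply mul_le_mul h1 h2 (hG.pos _).le
        exact mul_nonneg (by linarith) (hF.pos y).le
    _ = _ := by ring

theorem measurable_transportDeriv (hF : IsUnitDensity β F) (hG : IsUnitDensity β G) :
    Measurable fun s => F s / G (unitTransport F G s) :=
  hF.measurable.div (hG.measurable.comp (hF.measurable_unitTransport hG))

theorem transportDeriv_le (hF : IsUnitDensity β F) (hG : IsUnitDensity β G) (s : ℝ) :
    F s / G (unitTransport F G s) ≤ β ^ 2 := by
  have hβ := hF.one_le
  rw [div_le_iff₀ (hG.pos _)]
  have h1 := hF.le s
  have h2 := hG.one_le_mul (unitTransport F G s)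
  nlinarith

theorem integrable_mul (hF : IsUnitDensity β F) {k : ℝ → ℝ} (hk : Measurable k) {C : ℝ}
    (hC : ∀ᵐ s ∂unitMeasure, |k s| ≤ C) : Integrable (fun s => F s * k s) unitMeasure := by
  refine (hF.ratio.integrable hF.measurable).mul_bdd (c := C) hk.aestronglyMeasurable ?_
  simpa using hC

theorem integrable_mul_log (hF : IsUnitDensity β F) {k : ℝ → ℝ} (hk : Measurable k) {γ : ℝ}
    (hk' : HasBoundedRatio γ k) : Integrable (fun s => F s * Real.log (k s)) unitMeasure := by
  obtain ⟨C, hC⟩ := hk'.exists_abs_log_le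
  exact hF.integrable_mul hk.log (.of_forall hC)

theorem integrable_sq_unitTransport_sub (hF : IsUnitDensity β F) (hG : IsUnitDensity β G) :
    Integrable (fun s => F s * (unitTransport F G s - s) ^ 2) unitMeasure := by
  refine hF.integrable_mul (C := 1)
    (((hF.measurable_unitTransport hG).sub measurable_id).pow_const 2) ?_
  filter_upwards [ae_restrict_mem measurableSet_Ioo] with s hs
  have := hF.unitTransport_mem_Ioo hG hs
  rw [abs_of_nonneg (sq_nonneg _), sq_le_one_iff_abs_le_one, abs_le]
  constructor <;> linarith [this.1, this.2, hs.1, hs.2]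

/-- The Hardy-type inequality: the displacement `u = S - s` of the monotone transport vanishes at
both endpoints, so `∫ u² F = -2 ∫ u u' H` for every antiderivative `H` of `F`. -/
theorem integral_sq_unitTransport_sub_le (hF : IsUnitDensity β F) (hG : IsUnitDensity β G)
    (hc : IsApproxConvexUnit R F) (hR : 1 ≤ R) :
    ∫ s, F s * (unitTransport F G s - s) ^ 2 ∂unitMeasure ≤
      40 / 9 * R ^ 2 * ∫ s, F s * (F s / G (unitTransport F G s) - 1 -
        Real.log (F s / G (unitTransport F G s))) ∂unitMeasure := by
  set S := unitTransport F G with hS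
  set a : ℝ → ℝ := fun s => F s / G (S s) with ha
  have ham : Measurable a := hF.measurable_transportDeriv hG
  have har : HasBoundedRatio (β ^ 2) a := hF.hasBoundedRatio_transportDeriv hG
  obtain ⟨c, hcc⟩ := hF.exists_abs_primitiveFn_sub_le hc (by linarith)
  have h01 : uIcc (0 : ℝ) 1 = Icc 0 1 := uIcc_of_le zero_le_one
  have hSac : AbsolutelyContinuousOnInterval S 0 1 := by
    apply LipschitzOnWith.absolutelyContinuousOnInterval
    rw [h01]; exact hF.unitTransport_lipschitzOn hG
  have hidac : AbsolutelyContinuousOnInterval (fun s : ℝ => s) 0 1 :=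
    (LipschitzWith.id.lipschitzOnWith (s := uIcc (0 : ℝ) 1)).absolutelyContinuousOnInterval
  have huac : AbsolutelyContinuousOnInterval (fun s => (S s - s) * (S s - s)) 0 1 :=
    (hSac.sub hidac).mul (hSac.sub hidac)
  have hPac : AbsolutelyContinuousOnInterval (fun s => primitiveFn F s - c) 0 1 := by
    refine AbsolutelyContinuousOnInterval.sub (f := primitiveFn F) (g := fun _ => c) ?_ ?_
    · exact (hF.intervalIntegrable 0 1).absolutelyContinuousOnInterval_intervalIntegral (by simp)
    · exact ((LipschitzWith.const c).lipschitzOnWith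
        (s := uIcc (0 : ℝ) 1)).absolutelyContinuousOnInterval
  have hparts := huac.integral_deriv_mul_eq_sub hPac
  have hS0 : S 0 = 0 := hF.unitTransport_zero hG
  have hS1 : S 1 = 1 := hF.unitTransport_one hG
  simp only [hS0, hS1, sub_self, mul_zero, zero_mul] at hparts
  rw [intervalIntegral.integral_of_le zero_le_one, integral_Ioc_eq_integral_Ioo] at hparts
  have hint1 := hF.integrable_sq_unitTransport_sub hG
  rw [← hS] at hint1
  have hint2 : Integrable (fun s => F s * (a s - 1 - Real.log (a s))) unitMeasure := by
    have h1 : Integrable (fun s => F s * a s) unitMeasure := by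
      refine hF.integrable_mul ham (C := β ^ 2) (.of_forall fun s => ?_)
      rw [abs_of_pos (har.1 s)]; exact hF.transportDeriv_le hG s
    have h2 := hF.integrable_mul_log ham har
    refine ((h1.sub (hF.ratio.integrable hF.measurable)).sub h2).congr (.of_forall fun s => ?_)
    simp only [Pi.sub_apply]; ring
  have hderiv : ∀ᵐ s ∂unitMeasure,
      deriv (fun s => (S s - s) * (S s - s)) s * (primitiveFn F s - c) +
        (S s - s) * (S s - s) * deriv (fun s => primitiveFn F s - c) s =
      2 * (S s - s) * (a s - 1) * (primitiveFn F s - c) + F s * (S s - s) ^ 2 := by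
    filter_upwards [hF.ae_hasDerivAt_unitTransport hG,
      ae_restrict_of_ae hF.ae_hasDerivAt_primitiveFn] with s hs1 hs2
    have h1 : HasDerivAt (fun s => S s - s) (a s - 1) s := hs1.sub (hasDerivAt_id s)
    rw [(h1.fun_mul h1).deriv, (hs2.sub_const c).deriv]
    ring
  have hbound : ∀ᵐ s ∂unitMeasure, -(2 * (S s - s) * (a s - 1) * (primitiveFn F s - c)) ≤
      1 / 2 * (F s * (S s - s) ^ 2) + 20 / 9 * R ^ 2 * (F s * (a s - 1 - Real.log (a s))) := by
    filter_upwards [ae_restrict_mem measurableSet_Ioo] with s hs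
    have hSs := hF.unitTransport_mem_Ioo hG hs
    have h1 : |S s - s| ≤ 1 := by
      rw [abs_le]; constructor <;> linarith [hSs.1, hSs.2, hs.1, hs.2]
    have h2 := mul_abs_le_sq_add_sub_log hR h1 (τ := a s - 1) (by linarith [har.1 s])
    rw [add_sub_cancel] at h2
    have h3 := hcc s hs
    have hFs := hF.pos s
    calc -(2 * (S s - s) * (a s - 1) * (primitiveFn F s - c))
        ≤ |2 * (S s - s) * (a s - 1) * (primitiveFn F s - c)| := neg_le_abs _
      _ = 2 * (|S s - s| * |a s - 1|) * |primitiveFn F s - c| := by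
          rw [abs_mul, abs_mul, abs_mul, abs_of_pos (zero_lt_two' ℝ)]; ring
      _ ≤ 2 * (|S s - s| * |a s - 1|) * (R / 2 * F s) := by gcongr
      _ = F s * (R * (|S s - s| * |a s - 1|)) := by ring
      _ ≤ F s * (1 / 2 * (S s - s) ^ 2 +
            20 / 9 * R ^ 2 * (a s - 1 - Real.log (a s))) := by gcongr
      _ = _ := by ring
  have hfin : ∫ s, F s * (S s - s) ^ 2 ∂unitMeasure ≤
      ∫ s, (1 / 2 * (F s * (S s - s) ^ 2) +
        20 / 9 * R ^ 2 * (F s * (a s - 1 - Real.log (a s)))) ∂unitMeasure := by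
    have hint3 : Integrable (fun s => deriv (fun s => (S s - s) * (S s - s)) s *
        (primitiveFn F s - c) + (S s - s) * (S s - s) * deriv (fun s => primitiveFn F s - c) s)
        unitMeasure := by
      have h := (huac.intervalIntegrable_deriv.mul_continuousOn hPac.continuousOn).add
        (hPac.intervalIntegrable_deriv.continuousOn_mul huac.continuousOn)
      exact (intervalIntegrable_iff_integrableOn_Ioo_of_le zero_le_one).1 h
    have hsum : ∫ s, F s * (S s - s) ^ 2 ∂unitMeasure =
        ∫ s, (F s * (S s - s) ^ 2 - (deriv (fun s => (S s - s) * (S s - s)) s *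
          (primitiveFn F s - c) + (S s - s) * (S s - s) *
            deriv (fun s => primitiveFn F s - c) s)) ∂unitMeasure := by
      rw [integral_sub hint1 hint3, hparts, sub_zero]
    rw [hsum]
    refine integral_mono_ae (hint1.sub hint3)
      ((hint1.const_mul _).add (hint2.const_mul _)) ?_
    filter_upwards [hderiv, hbound] with s h1 h2
    rw [h1]
    linarith
  rw [integral_add (hint1.const_mul _) (hint2.const_mul _), integral_const_mul,
    integral_const_mul] at hfin
  linarith

/-! ### The transport inequality on the unit interval -/

/-- The change of variables `s ↦ (1 - t) * s + t * S s`, where `S` is the monotone transport, whose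
a.e. derivative is `F / G ∘ S`. -/
theorem integral_comp_mul_deriv_le (hF : IsUnitDensity β F) (hG : IsUnitDensity β G)
    {γ : ℝ} (hΦ : Measurable Φ) (hΦr : HasBoundedRatio γ Φ) {t : ℝ} (ht0 : 0 < t) (ht1 : t < 1) :
    ∫ s, Φ ((1 - t) * s + t * unitTransport F G s) *
        (1 - t + t * (F s / G (unitTransport F G s))) ∂unitMeasure ≤
      ∫ s, Φ s ∂unitMeasure := by
  set S := unitTransport F G with hS
  set a : ℝ → ℝ := fun s => F s / G (S s) with ha
  have hSm : Measurable S := hF.measurable_unitTransport hG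
  have ham : Measurable a := hF.measurable_transportDeriv hG
  have har : HasBoundedRatio (β ^ 2) a := hF.hasBoundedRatio_transportDeriv hG
  have hpos : ∀ s, 0 < 1 - t + t * a s := fun s => by
    have := mul_pos ht0 (har.1 s); linarith
  set z : ℝ → ℝ := fun s => (1 - t) * s + t * S s with hz
  have hzm : Measurable z := by fun_prop
  set D := {s | HasDerivAt S (a s) s}
  set N := toMeasurable unitMeasure Dᶜ with hN
  have hN0 : unitMeasure N = 0 := by
    rw [hN, measure_toMeasurable]
    exact hF.ae_hasDerivAt_unitTransport hG
  have hNm : MeasurableSet N := measurableSet_toMeasurable _ _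
  set A := Ioo (0 : ℝ) 1 \ N with hA
  have hAm : MeasurableSet A := measurableSet_Ioo.diff hNm
  have hAeq : volume.restrict A = unitMeasure := by
    rw [hA, sdiff_eq, inter_comm, ← Measure.restrict_restrict hNm.compl]
    exact Measure.restrict_eq_self_of_ae_mem (compl_mem_ae_iff.2 hN0)
  have hder : ∀ s ∈ A, HasDerivWithinAt z (1 - t + t * a s) A s := by
    intro s hs
    have hs' : HasDerivAt S (a s) s := by
      by_contra h
      exact hs.2 (subset_toMeasurable _ _ h)
    have h := ((hasDerivAt_id s).const_mul (1 - t)).add (hs'.const_mul t)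
    rw [mul_one] at h
    exact h.hasDerivWithinAt
  have hmono : MonotoneOn z A := by
    intro x hx y hy hxy
    have h1 := (hF.unitTransport_strictMonoOn hG).monotoneOn ⟨hx.1.1.le, hx.1.2.le⟩
      ⟨hy.1.1.le, hy.1.2.le⟩ hxy
    exact add_le_add (mul_le_mul_of_nonneg_left hxy (by linarith))
      (mul_le_mul_of_nonneg_left h1 ht0.le)
  have himage : z '' A ⊆ Ioo 0 1 := by
    rintro _ ⟨s, hs, rfl⟩
    have h1 := hF.unitTransport_mem_Ioo hG hs.1
    have h := convex_Ioo (0 : ℝ) 1 hs.1 h1 (a := 1 - t) (b := t) (by linarith) ht0.le (by ring)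
    simpa using h
  have hchange := lintegral_image_eq_lintegral_deriv_mul_of_monotoneOn hAm hder hmono
    fun s => ENNReal.ofReal (Φ s)
  rw [hAeq] at hchange
  rw [integral_eq_lintegral_of_nonneg_ae
      (.of_forall fun s => mul_nonneg (hΦr.1 _).le (hpos s).le)
      ((hΦ.comp hzm).mul (by fun_prop)).aestronglyMeasurable,
    integral_eq_lintegral_of_nonneg_ae (.of_forall fun s => (hΦr.1 _).le) hΦ.aestronglyMeasurable]
  refine ENNReal.toReal_mono (hΦr.integrable hΦ).lintegral_lt_top.ne ?_
  calc ∫⁻ s, ENNReal.ofReal (Φ (z s) * (1 - t + t * a s)) ∂unitMeasure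
      = ∫⁻ s in z '' A, ENNReal.ofReal (Φ s) := by
        rw [hchange]
        refine lintegral_congr fun s => ?_
        rw [mul_comm, ENNReal.ofReal_mul (hpos s).le]
    _ ≤ _ := lintegral_mono_set himage

/-- The one-dimensional step of the induction. Here `Φ` is arbitrary; the marginals of `fₜ` will be
substituted for it. -/
theorem transport_inequality_unit (hF : IsUnitDensity β F) (hG : IsUnitDensity β G)
    (hc : IsApproxConvexUnit R F) (hR : 1 ≤ R)
    {γ : ℝ} (hΦ : Measurable Φ) (hΦr : HasBoundedRatio γ Φ) {t : ℝ} (ht0 : 0 < t)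
    (ht : t * β ^ 2 ≤ 1 / 2) :
    ∫ s, F s * Real.log (Φ ((1 - t) * s + t * unitTransport F G s)) ∂unitMeasure
      - (1 - t) * ∫ s, F s * Real.log (F s) ∂unitMeasure
      - t * ∫ s, G s * Real.log (G s) ∂unitMeasure ≤
    Real.log (∫ s, Φ s ∂unitMeasure)
      - t * (9 / (40 * R ^ 2)) * ∫ s, F s * (unitTransport F G s - s) ^ 2 ∂unitMeasure
      + 2 * t ^ 2 * β ^ 4 := by
  have hβ := hF.one_le
  have ht1 : t < 1 := by nlinarith
  have hardy := hF.integral_sq_unitTransport_sub_le hG hc hR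
  have hjac := hF.integral_comp_mul_deriv_le hG hΦ hΦr ht0 ht1
  have hGlog := integral_mul_comp_of_map_withDensity hF.measurable hG.measurable
    (fun s => (hF.pos s).le) (fun s => (hG.pos s).le) (hF.measurable_unitTransport hG)
    (hF.map_unitTransport hG) hG.measurable.log
  have hint0 := hF.integrable_sq_unitTransport_sub hG
  set S := unitTransport F G with hS
  set a : ℝ → ℝ := fun s => F s / G (S s) with ha
  have hSm : Measurable S := hF.measurable_unitTransport hG
  have ham : Measurable a := hF.measurable_transportDeriv hG
  have har : HasBoundedRatio (β ^ 2) a := hF.hasBoundedRatio_transportDeriv hG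
  have hale : ∀ s, a s ≤ β ^ 2 := hF.transportDeriv_le hG
  set z : ℝ → ℝ := fun s => (1 - t) * s + t * S s with hz
  have hzm : Measurable z := by fun_prop
  set I := ∫ s, Φ s ∂unitMeasure with hI
  have hIpos : 0 < I := hΦr.integral_pos hΦ
  have hFint := hF.ratio.integrable (μ := unitMeasure) hF.measurable
  have hi1 : Integrable (fun s => F s * Real.log (Φ (z s))) unitMeasure :=
    hF.integrable_mul_log (hΦ.comp hzm) (hΦr.comp z)
  have hi2 : Integrable (fun s => F s * Real.log (F s)) unitMeasure :=
    hF.integrable_mul_log hF.measurable hF.ratio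
  have hi3 : Integrable (fun s => F s * Real.log (a s)) unitMeasure :=
    hF.integrable_mul_log ham har
  have hi4 : Integrable (fun s => F s * a s) unitMeasure :=
    hF.integrable_mul ham (C := β ^ 2) (.of_forall fun s => by
      rw [abs_of_pos (har.1 s)]; exact hale s)
  have hi5 : Integrable (fun s => Φ (z s) * (1 - t + t * a s)) unitMeasure := by
    refine ((hΦr.comp z).integrable (hΦ.comp hzm)).mul_bdd (c := 1 + β ^ 2)
      (by fun_prop) (.of_forall fun s => ?_)
    have h1 := har.1 s
    have h2 := hale s
    have h3 := mul_pos ht0 h1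
    rw [Real.norm_of_nonneg (by linarith)]
    nlinarith
  -- `log y ≤ y - 1` for the ratio of the pulled back density `Φ ∘ z * z' / I` to `F`, followed by a
  -- second order expansion of `log z' = log (1 + t * (a - 1))`
  have hpt : ∀ s, F s * Real.log (Φ (z s)) ≤ I⁻¹ * (Φ (z s) * (1 - t + t * a s))
      + ((-1 + Real.log I + t + 2 * t ^ 2 * β ^ 4) * F s + F s * Real.log (F s)
        - t * (F s * a s)) := by
    intro s
    have hFs := hF.pos s
    have hΦs := hΦr.1 (z s)
    have hz' : 0 < 1 - t + t * a s := by
      have := mul_pos ht0 (har.1 s); linarith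
    have h1 : Real.log (Φ (z s) * (1 - t + t * a s) / (F s * I)) ≤
        Φ (z s) * (1 - t + t * a s) / (F s * I) - 1 :=
      Real.log_le_sub_one_of_pos (by positivity)
    rw [Real.log_div (by positivity) (by positivity), Real.log_mul hΦs.ne' hz'.ne',
      Real.log_mul hFs.ne' hIpos.ne'] at h1
    have h2 : |t * (a s - 1)| ≤ t * β ^ 2 := by
      rw [abs_mul, abs_of_pos ht0]
      gcongr
      rw [abs_le]
      constructor
      · nlinarith [har.1 s]
      · linarith [hale s]
    have h3 := sub_two_mul_sq_le_log_one_add (h2.trans ht)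
    have h4 : (t * (a s - 1)) ^ 2 ≤ (t * β ^ 2) ^ 2 := by
      rw [← sq_abs]; gcongr
    have h5 : (1 : ℝ) + t * (a s - 1) = 1 - t + t * a s := by ring
    rw [h5] at h3
    have h6 : Real.log (Φ (z s)) ≤ Φ (z s) * (1 - t + t * a s) / (F s * I) - 1
        + Real.log (F s) + Real.log I - t * (a s - 1) + 2 * (t * β ^ 2) ^ 2 := by linarith
    calc F s * Real.log (Φ (z s)) ≤ F s * (Φ (z s) * (1 - t + t * a s) / (F s * I) - 1
        + Real.log (F s) + Real.log I - t * (a s - 1) + 2 * (t * β ^ 2) ^ 2) := by gcongr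
      _ = _ := by field_simp; ring
  have hmono := integral_mono hi1 ((hi5.const_mul I⁻¹).add (((hFint.const_mul _).add hi2).sub
    (hi4.const_mul t))) hpt
  have e1 : ∫ s, (I⁻¹ * (Φ (z s) * (1 - t + t * a s))
      + ((-1 + Real.log I + t + 2 * t ^ 2 * β ^ 4) * F s + F s * Real.log (F s)
        - t * (F s * a s))) ∂unitMeasure =
      I⁻¹ * ∫ s, Φ (z s) * (1 - t + t * a s) ∂unitMeasure
      + ((-1 + Real.log I + t + 2 * t ^ 2 * β ^ 4) + ∫ s, F s * Real.log (F s) ∂unitMeasure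
        - t * ∫ s, F s * a s ∂unitMeasure) := by
    have hY : Integrable (fun s => (-1 + Real.log I + t + 2 * t ^ 2 * β ^ 4) * F s +
        F s * Real.log (F s)) unitMeasure := (hFint.const_mul _).add hi2
    have hX : Integrable (fun s => (-1 + Real.log I + t + 2 * t ^ 2 * β ^ 4) * F s +
        F s * Real.log (F s) - t * (F s * a s)) unitMeasure := hY.sub (hi4.const_mul t)
    rw [integral_add (hi5.const_mul I⁻¹) hX, integral_sub hY (hi4.const_mul t),
      integral_add (hFint.const_mul _) hi2, integral_const_mul, integral_const_mul,
      integral_const_mul, hF.integral_eq_one, mul_one]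
  simp only [Pi.add_apply, Pi.sub_apply] at hmono
  rw [e1] at hmono
  have h7 : I⁻¹ * ∫ s, Φ (z s) * (1 - t + t * a s) ∂unitMeasure ≤ 1 := by
    rw [inv_mul_le_iff₀ hIpos, mul_one]; exact hjac
  have e2 : ∫ s, F s * Real.log (G (S s)) ∂unitMeasure =
      ∫ s, F s * Real.log (F s) ∂unitMeasure - ∫ s, F s * Real.log (a s) ∂unitMeasure := by
    rw [← integral_sub hi2 hi3]
    congr 1; ext s
    rw [ha, Real.log_div (hF.pos s).ne' (hG.pos _).ne']; ring
  have e3 : ∫ s, F s * (a s - 1 - Real.log (a s)) ∂unitMeasure =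
      ∫ s, F s * a s ∂unitMeasure - 1 - ∫ s, F s * Real.log (a s) ∂unitMeasure := by
    have hX : Integrable (fun s => F s * a s - F s) unitMeasure := hi4.sub hFint
    rw [show (1 : ℝ) = ∫ s, F s ∂unitMeasure from hF.integral_eq_one.symm,
      ← integral_sub hi4 hFint, ← integral_sub hX hi3, hF.integral_eq_one]
    congr 1; ext s; ring
  rw [e3] at hardy
  rw [← hGlog, e2]
  have h8 : 9 / (40 * R ^ 2) * ∫ s, F s * (S s - s) ^ 2 ∂unitMeasure ≤
      ∫ s, F s * a s ∂unitMeasure - 1 - ∫ s, F s * Real.log (a s) ∂unitMeasure := by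
    have hR2 : 0 < R ^ 2 := by positivity
    rw [div_mul_eq_mul_div, div_le_iff₀ (by positivity)]
    linarith
  have h9 := mul_le_mul_of_nonneg_left h8 ht0.le
  linarith

end IsUnitDensity

/-! ### Functions on the open unit cube -/

/-- The open unit cube. -/
def openCube (n : ℕ) : Set (Fin n → ℝ) := univ.pi fun _ => Ioo 0 1

/-- Lebesgue measure on the open unit cube. -/
noncomputable abbrev cubeMeasure (n : ℕ) : Measure (Fin n → ℝ) := Measure.pi fun _ => unitMeasure

theorem cubeMeasure_eq_restrict (n : ℕ) : cubeMeasure n = volume.restrict (openCube n) := by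
  rw [openCube, volume_pi, Measure.restrict_pi_pi]

theorem ae_mem_openCube (n : ℕ) : ∀ᵐ x ∂cubeMeasure n, x ∈ openCube n := by
  rw [cubeMeasure_eq_restrict]
  exact ae_restrict_mem (MeasurableSet.univ_pi fun _ => measurableSet_Ioo)

theorem convex_openCube (n : ℕ) : Convex ℝ (openCube n) :=
  convex_pi fun _ _ => convex_Ioo _ _

theorem vecCons_mem_openCube {n : ℕ} {s : ℝ} {x : Fin n → ℝ} (hs : s ∈ Ioo (0 : ℝ) 1)
    (hx : x ∈ openCube n) : Matrix.vecCons s x ∈ openCube (n + 1) := by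
  intro i _
  refine Fin.cases ?_ (fun j => ?_) i
  · exact hs
  · exact hx j (mem_univ _)

theorem measurable_vecCons (n : ℕ) :
    Measurable fun p : ℝ × (Fin n → ℝ) => Matrix.vecCons p.1 p.2 := by
  refine measurable_pi_lambda _ fun i => ?_
  refine Fin.cases ?_ (fun j => ?_) i
  · exact measurable_fst
  · exact (measurable_pi_apply j).comp measurable_snd

theorem measurePreserving_vecCons (n : ℕ) :
    MeasurePreserving (fun p : ℝ × (Fin n → ℝ) => Matrix.vecCons p.1 p.2)
      (unitMeasure.prod (cubeMeasure n)) (cubeMeasure (n + 1)) := by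
  have h := (measurePreserving_piFinSuccAbove (fun _ : Fin (n + 1) => unitMeasure) 0).symm
  convert h using 1
  ext p i
  refine Fin.cases ?_ (fun j => ?_) i <;> simp [MeasurableEquiv.piFinSuccAbove]

theorem lintegral_cubeMeasure_succ {n : ℕ} {φ : (Fin (n + 1) → ℝ) → ℝ≥0∞} (hφ : Measurable φ) :
    ∫⁻ x, φ x ∂cubeMeasure (n + 1) =
      ∫⁻ s, ∫⁻ x, φ (Matrix.vecCons s x) ∂cubeMeasure n ∂unitMeasure := by
  rw [← (measurePreserving_vecCons n).lintegral_comp hφ,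
    lintegral_prod (fun p => φ (Matrix.vecCons p.1 p.2))
      (hφ.comp (measurable_vecCons n)).aemeasurable]

theorem integral_cubeMeasure_succ {n : ℕ} {φ : (Fin (n + 1) → ℝ) → ℝ} (hm : Measurable φ)
    (hφ : Integrable φ (cubeMeasure (n + 1))) :
    ∫ x, φ x ∂cubeMeasure (n + 1) =
      ∫ s, ∫ x, φ (Matrix.vecCons s x) ∂cubeMeasure n ∂unitMeasure := by
  have hmp := measurePreserving_vecCons n
  rw [← hmp.map_eq, integral_map hmp.measurable.aemeasurable hm.aestronglyMeasurable]
  rw [← hmp.map_eq] at hφ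
  exact integral_prod _ (hφ.comp_measurable hmp.measurable)

/-- Approximate convexity along the coordinate directions, on the open unit cube. -/
def IsCoordApproxConvexUnit {n : ℕ} (R : ℝ) (f : (Fin n → ℝ) → ℝ) : Prop :=
  ∀ i, ∀ x ∈ openCube n, ∀ y ∈ openCube n, (∀ j, j ≠ i → x j = y j) → ∀ t : ℝ, 0 < t → t < 1 →
    f (t • x + (1 - t) • y) ≤ R * (t * f x + (1 - t) * f y)

/-! ### The Knothe map -/

/-- The hypotheses under which the transport inequality propagates from sections to the whole cube:
`f₀` is the source density, `g` the target density, and `f₀`, `f₁`, `fₜ` are related as in the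
Prékopa–Leindler inequality. -/
structure KnotheData {n : ℕ} (R β t : ℝ) (f₀ f₁ g fₜ : (Fin n → ℝ) → ℝ) : Prop where
  ratio₀ : HasBoundedRatio β f₀
  ratio₁ : HasBoundedRatio β f₁
  ratio_g : HasBoundedRatio β g
  ratio_t : HasBoundedRatio β fₜ
  integral_f₀ : ∫ x, f₀ x ∂cubeMeasure n = 1
  integral_g : ∫ x, g x ∂cubeMeasure n = 1
  approxConvex : IsCoordApproxConvexUnit R f₀
  interpolation : ∀ x ∈ openCube n, ∀ y ∈ openCube n,
    f₀ x ^ (1 - t) * f₁ y ^ t ≤ fₜ ((1 - t) • x + t • y)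

section Marginals

variable {Ω : Type*} [MeasurableSpace Ω] {n : ℕ}

/-- The first marginal of a function on the cube. -/
noncomputable def firstMarginal (f : (Fin (n + 1) → ℝ) → ℝ) (s : ℝ) : ℝ :=
  ∫ x, f (Matrix.vecCons s x) ∂cubeMeasure n

theorem measurable_firstMarginal {f : Ω → (Fin (n + 1) → ℝ) → ℝ}
    (hf : Measurable (Function.uncurry f)) :
    Measurable fun p : Ω × ℝ => firstMarginal (f p.1) p.2 := by
  have h : Measurable fun q : (Ω × ℝ) × (Fin n → ℝ) => f q.1.1 (Matrix.vecCons q.1.2 q.2) :=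
    hf.comp ((measurable_fst.comp measurable_fst).prodMk
      ((measurable_vecCons n).comp ((measurable_snd.comp measurable_fst).prodMk measurable_snd)))
  exact h.stronglyMeasurable.integral_prod_right'.measurable

theorem measurable_primitiveFn {F : Ω → ℝ → ℝ} (hF : Measurable (Function.uncurry F)) :
    Measurable fun p : Ω × ℝ => primitiveFn (F p.1) p.2 := by
  have key : ∀ A : Set (ℝ × ℝ), MeasurableSet A →
      Measurable fun p : Ω × ℝ => ∫ u in {u | (p.2, u) ∈ A}, F p.1 u := by
    intro A hA
    have h : Measurable fun q : (Ω × ℝ) × ℝ =>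
        indicator {q : (Ω × ℝ) × ℝ | (q.1.2, q.2) ∈ A} (fun q => F q.1.1 q.2) q := by
      refine Measurable.indicator ?_ ?_
      · exact hF.comp ((measurable_fst.comp measurable_fst).prodMk measurable_snd)
      · exact hA.preimage ((measurable_snd.comp measurable_fst).prodMk measurable_snd)
    have h2 := h.stronglyMeasurable.integral_prod_right' (ν := volume)
    convert h2.measurable using 2 with p
    exact (integral_indicator (f := F p.1)
      (hA.preimage (measurable_prodMk_left (x := p.2)))).symm
  have h1 := key {q | 0 < q.2 ∧ q.2 ≤ q.1} (by measurability)
  have h2 := key {q | q.1 < q.2 ∧ q.2 ≤ 0} (by measurability)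
  exact h1.sub h2

theorem measurable_unitTransport_param {F G : Ω → ℝ → ℝ} (hF : Measurable (Function.uncurry F))
    (hG : Measurable (Function.uncurry G)) :
    Measurable fun p : Ω × ℝ => unitTransport (F p.1) (G p.1) p.2 := by
  have h : MeasurableSet {q : (Ω × ℝ) × ℝ |
      primitiveFn (G q.1.1) q.2 < primitiveFn (F q.1.1) q.1.2} :=
    measurableSet_lt
      ((measurable_primitiveFn hG).comp ((measurable_fst.comp measurable_fst).prodMk measurable_snd))
      ((measurable_primitiveFn hF).comp measurable_fst)
  exact (measurable_measure_prodMk_left h).ennreal_toReal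

theorem unitTransport_mem_Icc (F G : ℝ → ℝ) (s : ℝ) : unitTransport F G s ∈ Icc (0 : ℝ) 1 :=
  ⟨measureReal_nonneg, measureReal_le_one⟩

variable {β R t : ℝ} {f f₀ f₁ g fₜ : (Fin (n + 1) → ℝ) → ℝ}

theorem HasBoundedRatio.firstMarginal (h : HasBoundedRatio β f) (hm : Measurable f) :
    HasBoundedRatio β (firstMarginal f) :=
  (h.comp fun p : ℝ × (Fin n → ℝ) => Matrix.vecCons p.1 p.2).integral_right
    (hm.comp (measurable_vecCons n))

theorem integral_firstMarginal (h : HasBoundedRatio β f) (hm : Measurable f) :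
    ∫ s, firstMarginal f s ∂unitMeasure = ∫ x, f x ∂cubeMeasure (n + 1) :=
  (integral_cubeMeasure_succ hm (h.integrable hm)).symm

theorem measurable_section (hm : Measurable f) (s : ℝ) :
    Measurable fun x : Fin n → ℝ => f (Matrix.vecCons s x) :=
  hm.comp ((measurable_vecCons n).comp measurable_prodMk_left)

theorem measurable_firstMarginal_const (hm : Measurable f) : Measurable (firstMarginal f) :=
  (measurable_firstMarginal (Ω := Unit) (f := fun _ => f)
    (hm.comp measurable_snd)).comp (measurable_prodMk_left (x := ()))

theorem isUnitDensity_firstMarginal (h : HasBoundedRatio β f) (hm : Measurable f)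
    (h1 : ∫ x, f x ∂cubeMeasure (n + 1) = 1) : IsUnitDensity β (firstMarginal f) where
  measurable := measurable_firstMarginal_const hm
  ratio := h.firstMarginal hm
  integral_eq_one := by rw [integral_firstMarginal h hm, h1]

theorem IsCoordApproxConvexUnit.firstMarginal (hc : IsCoordApproxConvexUnit R f)
    (h : HasBoundedRatio β f) (hm : Measurable f) : IsApproxConvexUnit R (firstMarginal f) := by
  intro x hx y hy t ht0 ht1
  have hi : ∀ s, Integrable (fun z : Fin n → ℝ => f (Matrix.vecCons s z)) (cubeMeasure n) :=
    fun s => (h.comp fun z => Matrix.vecCons s z).integrable (measurable_section hm s)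
  unfold _root_.firstMarginal
  rw [← integral_const_mul, ← integral_const_mul, ← integral_add ((hi x).const_mul t)
    ((hi y).const_mul _), ← integral_const_mul]
  refine integral_mono_ae (hi _) ((((hi x).const_mul t).add ((hi y).const_mul _)).const_mul R) ?_
  filter_upwards [ae_mem_openCube n] with z hz
  have := hc 0 _ (vecCons_mem_openCube hx hz) _ (vecCons_mem_openCube hy hz) ?_ t ht0 ht1
  · simp only [Matrix.smul_cons, Matrix.cons_add_cons, smul_eq_mul, ← add_smul,
      add_sub_cancel, one_smul] at this
    exact this
  · intro j hj
    obtain ⟨k, rfl⟩ := Fin.exists_succ_eq.2 hj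
    simp

theorem IsCoordApproxConvexUnit.section (hc : IsCoordApproxConvexUnit R f) {s : ℝ}
    (hs : s ∈ Ioo (0 : ℝ) 1) {c : ℝ} (hcpos : 0 < c) :
    IsCoordApproxConvexUnit R fun x : Fin n → ℝ => f (Matrix.vecCons s x) / c := by
  intro i x hx y hy hxy t ht0 ht1
  have := hc i.succ _ (vecCons_mem_openCube hs hx) _ (vecCons_mem_openCube hs hy) ?_ t ht0 ht1
  · simp only [Matrix.smul_cons, Matrix.cons_add_cons, smul_eq_mul, ← add_mul,
      add_sub_cancel, one_mul] at this
    calc _ ≤ R * (t * f (Matrix.vecCons s x) + (1 - t) * f (Matrix.vecCons s y)) / c :=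
          div_le_div_of_nonneg_right this hcpos.le
      _ = _ := by ring
  · intro j
    refine Fin.cases ?_ (fun k hk => ?_) j
    · simp
    · simpa using hxy k fun h => hk (by rw [h])

/-- Conditioning on the first coordinate, at `s` for the source and at `S s` for the target,
preserves the hypotheses. The power of the marginal density of the source is what normalizing
`f₀` costs in the interpolation inequality. -/
theorem KnotheData.section (h : KnotheData R β t f₀ f₁ g fₜ) (hm₀ : Measurable f₀)
    (hmg : Measurable g) {s r : ℝ} (hs : s ∈ Ioo (0 : ℝ) 1)
    (hr : r ∈ Ioo (0 : ℝ) 1) :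
    KnotheData R β t (fun x => f₀ (Matrix.vecCons s x) / firstMarginal f₀ s)
      (fun x => f₁ (Matrix.vecCons r x))
      (fun x => g (Matrix.vecCons r x) / firstMarginal g r)
      (fun x => fₜ (Matrix.vecCons ((1 - t) * s + t * r) x) *
        firstMarginal f₀ s ^ (-(1 - t))) where
  ratio₀ := (h.ratio₀.comp _).div_const ((h.ratio₀.firstMarginal hm₀).1 s)
  ratio₁ := h.ratio₁.comp _
  ratio_g := (h.ratio_g.comp _).div_const ((h.ratio_g.firstMarginal hmg).1 r)
  ratio_t := (h.ratio_t.comp _).mul_const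
    (Real.rpow_pos_of_pos ((h.ratio₀.firstMarginal hm₀).1 s) _)
  integral_f₀ := by
    rw [integral_div]; exact div_self ((h.ratio₀.firstMarginal hm₀).1 s).ne'
  integral_g := by
    rw [integral_div]; exact div_self ((h.ratio_g.firstMarginal hmg).1 r).ne'
  approxConvex := h.approxConvex.section hs ((h.ratio₀.firstMarginal hm₀).1 s)
  interpolation := by
    intro x hx y hy
    have hF := (h.ratio₀.firstMarginal hm₀).1 s
    have := h.interpolation _ (vecCons_mem_openCube hs hx) _ (vecCons_mem_openCube hr hy)
    simp only [Matrix.smul_cons, Matrix.cons_add_cons, smul_eq_mul] at this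
    rw [Real.div_rpow (h.ratio₀.1 _).le hF.le, Real.rpow_neg hF.le, div_mul_eq_mul_div,
      div_eq_mul_inv]
    gcongr

end Marginals

theorem lintegral_withDensity_ofReal {α : Type*} [MeasurableSpace α] {μ : Measure α} {f : α → ℝ}
    (hf : Measurable f) {ψ : α → ℝ≥0∞} (hψ : Measurable ψ) :
    ∫⁻ x, ψ x ∂μ.withDensity (fun x => ENNReal.ofReal (f x)) =
      ∫⁻ x, ENNReal.ofReal (f x) * ψ x ∂μ :=
  lintegral_withDensity_eq_lintegral_mul _ hf.ennreal_ofReal hψ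

/-- Change of variables between densities, for nonnegative integrands. -/
theorem lintegral_mul_comp_of_map_withDensity {α γ : Type*} [MeasurableSpace α]
    [MeasurableSpace γ] {μ : Measure α} {ν : Measure γ} {f : α → ℝ} {g : γ → ℝ} {T : α → γ}
    (hf : Measurable f) (hg : Measurable g) (hT : Measurable T)
    (hmap : (μ.withDensity fun x => ENNReal.ofReal (f x)).map T =
      ν.withDensity fun y => ENNReal.ofReal (g y))
    {ψ : γ → ℝ≥0∞} (hψ : Measurable ψ) :
    ∫⁻ x, ENNReal.ofReal (f x) * ψ (T x) ∂μ = ∫⁻ y, ENNReal.ofReal (g y) * ψ y ∂ν := by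
  rw [← lintegral_withDensity_ofReal hg hψ, ← hmap, lintegral_map hψ hT,
    lintegral_withDensity_ofReal hf (ψ := fun x => ψ (T x)) (hψ.comp hT)]

section Knothe

variable {n : ℕ} {R β t : ℝ} {f₀ f₁ g fₜ : (Fin (n + 1) → ℝ) → ℝ}

/-- The relative entropy of the density `g` with respect to the density `f`. -/
noncomputable def cubeEntropy {n : ℕ} (g f : (Fin n → ℝ) → ℝ) : ℝ :=
  ∫ x, g x * (Real.log (g x) - Real.log (f x)) ∂cubeMeasure n

/-- The quadratic cost of the map `T` from the density `f`. -/
noncomputable def cubeCost {n : ℕ} (f : (Fin n → ℝ) → ℝ) (T : (Fin n → ℝ) → Fin n → ℝ) : ℝ :=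
  ∫ x, f x * ∑ i, (T x i - x i) ^ 2 ∂cubeMeasure n

/-- If the first marginals and the corresponding sections are transported to each other, then so are
the densities on the whole cube. -/
theorem map_vecCons_of_sections (h : KnotheData R β t f₀ f₁ g fₜ) (hm₀ : Measurable f₀)
    (hmg : Measurable g) {T : ℝ × (Fin n → ℝ) → Fin n → ℝ} (hT : Measurable T)
    (hmap : ∀ s ∈ Ioo (0 : ℝ) 1,
      ((cubeMeasure n).withDensity fun x =>
        ENNReal.ofReal (f₀ (Matrix.vecCons s x) / firstMarginal f₀ s)).map (fun x => T (s, x)) =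
      (cubeMeasure n).withDensity fun y => ENNReal.ofReal
        (g (Matrix.vecCons (unitTransport (firstMarginal f₀) (firstMarginal g) s) y) /
          firstMarginal g (unitTransport (firstMarginal f₀) (firstMarginal g) s))) :
    ((cubeMeasure (n + 1)).withDensity fun x => ENNReal.ofReal (f₀ x)).map
      (fun x => Matrix.vecCons (unitTransport (firstMarginal f₀) (firstMarginal g) (x 0))
        (T (x 0, Fin.tail x))) =
      (cubeMeasure (n + 1)).withDensity fun y => ENNReal.ofReal (g y) := by
  have hF := isUnitDensity_firstMarginal h.ratio₀ hm₀ h.integral_f₀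
  have hG := isUnitDensity_firstMarginal h.ratio_g hmg h.integral_g
  have hSm := hF.measurable_unitTransport hG
  have hSmap := hF.map_unitTransport hG
  set F := firstMarginal f₀ with hFdef
  set G := firstMarginal g with hGdef
  set S := unitTransport F G with hS
  have htail : Measurable fun x : Fin (n + 1) → ℝ => Fin.tail x :=
    measurable_pi_lambda _ fun i => measurable_pi_apply _
  have hTm : Measurable fun x : Fin (n + 1) → ℝ =>
      Matrix.vecCons (S (x 0)) (T (x 0, Fin.tail x)) :=
    (measurable_vecCons n).comp ((hSm.comp (measurable_pi_apply 0)).prodMk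
      (hT.comp ((measurable_pi_apply 0).prodMk htail)))
  refine Measure.ext_of_lintegral _ fun ψ hψ => ?_
  have hm1 : Measurable fun x : Fin (n + 1) → ℝ => ENNReal.ofReal (f₀ x) *
      ψ (Matrix.vecCons (S (x 0)) (T (x 0, Fin.tail x))) :=
    hm₀.ennreal_ofReal.mul (hψ.comp hTm)
  have hm2 : Measurable fun x : Fin (n + 1) → ℝ => ENNReal.ofReal (g x) * ψ x :=
    hmg.ennreal_ofReal.mul hψ
  rw [lintegral_map hψ hTm, lintegral_withDensity_ofReal hm₀
      (ψ := fun x => ψ (Matrix.vecCons (S (x 0)) (T (x 0, Fin.tail x)))) (hψ.comp hTm),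
    lintegral_withDensity_ofReal hmg hψ, lintegral_cubeMeasure_succ hm1,
    lintegral_cubeMeasure_succ hm2]
  set K : ℝ → ℝ≥0∞ := fun r => ∫⁻ y, ENNReal.ofReal (g (Matrix.vecCons r y) / G r) *
    ψ (Matrix.vecCons r y) ∂cubeMeasure n with hK
  have hKm : Measurable K := by
    refine Measurable.lintegral_prod_right' (f := fun p : ℝ × (Fin n → ℝ) =>
      ENNReal.ofReal (g (Matrix.vecCons p.1 p.2) / G p.1) * ψ (Matrix.vecCons p.1 p.2)) ?_
    exact (((hmg.comp (measurable_vecCons n)).div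
      (hG.measurable.comp measurable_fst)).ennreal_ofReal).mul (hψ.comp (measurable_vecCons n))
  have h1 : ∀ s ∈ Ioo (0 : ℝ) 1, ∫⁻ x, ENNReal.ofReal (f₀ (Matrix.vecCons s x)) *
      ψ (Matrix.vecCons (S s) (T (s, x))) ∂cubeMeasure n = ENNReal.ofReal (F s) * K (S s) := by
    intro s hs
    have hTs : Measurable fun x => T (s, x) := hT.comp measurable_prodMk_left
    have hψs : Measurable fun y => ψ (Matrix.vecCons (S s) y) :=
      hψ.comp ((measurable_vecCons n).comp measurable_prodMk_left)
    have h2 := lintegral_mul_comp_of_map_withDensity ((measurable_section hm₀ s).div_const _)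
      ((measurable_section hmg _).div_const _) hTs (hmap s hs) hψs
    have hms : Measurable fun x => ENNReal.ofReal (f₀ (Matrix.vecCons s x) / F s) *
        ψ (Matrix.vecCons (S s) (T (s, x))) :=
      (((measurable_section hm₀ s).div_const _).ennreal_ofReal).mul (hψs.comp hTs)
    have hKs : K (S s) = _ := h2.symm
    rw [hKs, ← lintegral_const_mul _ hms]
    refine lintegral_congr fun x => ?_
    rw [← mul_assoc, ← ENNReal.ofReal_mul (hF.pos s).le, mul_div_cancel₀ _ (hF.pos s).ne']
  calc _ = ∫⁻ s, ENNReal.ofReal (F s) * K (S s) ∂unitMeasure :=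
        setLIntegral_congr_fun measurableSet_Ioo h1
    _ = ∫⁻ r, ENNReal.ofReal (G r) * K r ∂unitMeasure :=
        lintegral_mul_comp_of_map_withDensity hF.measurable hG.measurable hSm hSmap hKm
    _ = _ := by
        refine lintegral_congr fun r => ?_
        have hms : Measurable fun y => ENNReal.ofReal (g (Matrix.vecCons r y) / G r) *
            ψ (Matrix.vecCons r y) :=
          (((measurable_section hmg r).div_const _).ennreal_ofReal).mul
            (hψ.comp ((measurable_vecCons n).comp measurable_prodMk_left))
        change ENNReal.ofReal (G r) * ∫⁻ y, ENNReal.ofReal (g (Matrix.vecCons r y) / G r) *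
          ψ (Matrix.vecCons r y) ∂cubeMeasure n = _
        rw [← lintegral_const_mul _ hms]
        refine lintegral_congr fun x => ?_
        rw [← mul_assoc, ← ENNReal.ofReal_mul (hG.pos r).le, mul_div_cancel₀ _ (hG.pos r).ne']

theorem measurable_sum_sq_sub {n : ℕ} {T : (Fin n → ℝ) → Fin n → ℝ} (hT : Measurable T) :
    Measurable fun x => ∑ i, (T x i - x i) ^ 2 :=
  Finset.measurable_sum _ fun i _ =>
    (((measurable_pi_apply i).comp hT).sub (measurable_pi_apply i)).pow_const 2

theorem ae_sum_sq_sub_le {n : ℕ} {T : (Fin n → ℝ) → Fin n → ℝ}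
    (hT : ∀ x i, T x i ∈ Icc (0 : ℝ) 1) :
    ∀ᵐ x ∂cubeMeasure n, ‖∑ i, (T x i - x i) ^ 2‖ ≤ n := by
  filter_upwards [ae_mem_openCube n] with x hx
  rw [Real.norm_of_nonneg (Finset.sum_nonneg fun i _ => sq_nonneg _)]
  calc ∑ i, (T x i - x i) ^ 2 ≤ ∑ _i : Fin n, (1 : ℝ) := by
        refine Finset.sum_le_sum fun i _ => ?_
        have h1 := hT x i
        have h2 := hx i (mem_univ i)
        rw [sq_le_one_iff_abs_le_one, abs_le]
        constructor <;> linarith [h1.1, h1.2, h2.1, h2.2]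
    _ = n := by simp

theorem integrable_cubeCost {n : ℕ} {f : (Fin n → ℝ) → ℝ} (hr : HasBoundedRatio β f)
    (hm : Measurable f) {T : (Fin n → ℝ) → Fin n → ℝ} (hTm : Measurable T)
    (hT : ∀ x i, T x i ∈ Icc (0 : ℝ) 1) :
    Integrable (fun x => f x * ∑ i, (T x i - x i) ^ 2) (cubeMeasure n) :=
  (hr.integrable hm).mul_bdd (measurable_sum_sq_sub hTm).aestronglyMeasurable (ae_sum_sq_sub_le hT)

/-- The cost of a map built from the first coordinate and from maps of sections. -/
theorem cubeCost_vecCons (h : KnotheData R β t f₀ f₁ g fₜ) (hm₀ : Measurable f₀)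
    {S : ℝ → ℝ} (hS : Measurable S) (hS01 : ∀ s, S s ∈ Icc (0 : ℝ) 1)
    {T : ℝ × (Fin n → ℝ) → Fin n → ℝ} (hT : Measurable T)
    (hT01 : ∀ p i, T p i ∈ Icc (0 : ℝ) 1) :
    Integrable (fun s => firstMarginal f₀ s * cubeCost
      (fun x => f₀ (Matrix.vecCons s x) / firstMarginal f₀ s) (fun x => T (s, x))) unitMeasure ∧
    cubeCost f₀ (fun x => Matrix.vecCons (S (x 0)) (T (x 0, Fin.tail x))) =
      ∫ s, firstMarginal f₀ s * (S s - s) ^ 2 ∂unitMeasure +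
      ∫ s, firstMarginal f₀ s * cubeCost
        (fun x => f₀ (Matrix.vecCons s x) / firstMarginal f₀ s) (fun x => T (s, x)) ∂unitMeasure := by
  have hF := isUnitDensity_firstMarginal h.ratio₀ hm₀ h.integral_f₀
  have htail : Measurable fun x : Fin (n + 1) → ℝ => Fin.tail x :=
    measurable_pi_lambda _ fun i => measurable_pi_apply _
  have hTm : Measurable fun x : Fin (n + 1) → ℝ =>
      Matrix.vecCons (S (x 0)) (T (x 0, Fin.tail x)) :=
    (measurable_vecCons n).comp ((hS.comp (measurable_pi_apply 0)).prodMk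
      (hT.comp ((measurable_pi_apply 0).prodMk htail)))
  have h01 : ∀ (x : Fin (n + 1) → ℝ) i,
      Matrix.vecCons (S (x 0)) (T (x 0, Fin.tail x)) i ∈ Icc (0 : ℝ) 1 := by
    intro x i
    refine Fin.cases ?_ (fun j => ?_) i
    · exact hS01 _
    · exact hT01 _ _
  have hsec : ∀ s, Integrable (fun x => f₀ (Matrix.vecCons s x)) (cubeMeasure n) := fun s =>
    (h.ratio₀.comp fun x => Matrix.vecCons s x).integrable (measurable_section hm₀ s)
  have hTs : ∀ s, Measurable fun x => T (s, x) := fun s => hT.comp measurable_prodMk_left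
  have e1 : ∀ s, firstMarginal f₀ s * cubeCost
      (fun x => f₀ (Matrix.vecCons s x) / firstMarginal f₀ s) (fun x => T (s, x)) =
      ∫ x, f₀ (Matrix.vecCons s x) * ∑ i, (T (s, x) i - x i) ^ 2 ∂cubeMeasure n := by
    intro s
    rw [cubeCost, ← integral_const_mul]
    congr 1; ext x
    have := (hF.pos s).ne'
    field_simp
  have hA : Integrable (fun s => firstMarginal f₀ s * (S s - s) ^ 2) unitMeasure := by
    refine hF.integrable_mul (C := 1) ((hS.sub measurable_id).pow_const 2) ?_
    filter_upwards [ae_restrict_mem measurableSet_Ioo] with s hs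
    have := hS01 s
    rw [abs_of_nonneg (sq_nonneg _), sq_le_one_iff_abs_le_one, abs_le]
    constructor <;> linarith [this.1, this.2, hs.1, hs.2]
  have hcons : ∀ s, ∫ x, f₀ (Matrix.vecCons s x) *
      ∑ i, (Matrix.vecCons (S ((Matrix.vecCons s x : Fin (n + 1) → ℝ) 0))
        (T ((Matrix.vecCons s x : Fin (n + 1) → ℝ) 0, Fin.tail (Matrix.vecCons s x))) i -
          Matrix.vecCons s x i) ^ 2 ∂cubeMeasure n =
      firstMarginal f₀ s * (S s - s) ^ 2 +
        ∫ x, f₀ (Matrix.vecCons s x) * ∑ i, (T (s, x) i - x i) ^ 2 ∂cubeMeasure n := by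
    intro s
    rw [firstMarginal, ← integral_mul_const, ← integral_add ((hsec s).mul_const _)]
    · congr 1; ext x
      rw [Fin.sum_univ_succ, mul_add]
      rfl
    · exact (hsec s).mul_bdd (measurable_sum_sq_sub (hTs s)).aestronglyMeasurable
        (ae_sum_sq_sub_le fun x i => hT01 _ _)
  have hB : Integrable (fun s => ∫ x, f₀ (Matrix.vecCons s x) *
      ∑ i, (T (s, x) i - x i) ^ 2 ∂cubeMeasure n) unitMeasure := by
    have hmB : Measurable fun p : ℝ × (Fin n → ℝ) =>
        f₀ (Matrix.vecCons p.1 p.2) * ∑ i, (T p i - p.2 i) ^ 2 := by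
      refine (hm₀.comp (measurable_vecCons n)).mul (Finset.measurable_sum _ fun i _ => ?_)
      exact (((measurable_pi_apply i).comp hT).sub
        ((measurable_pi_apply i).comp measurable_snd)).pow_const 2
    refine Integrable.of_bound (C := β * n)
      hmB.stronglyMeasurable.integral_prod_right'.aestronglyMeasurable (.of_forall fun s => ?_)
    have hb : Integrable (fun x => f₀ (Matrix.vecCons s x) * ∑ i, (T (s, x) i - x i) ^ 2)
        (cubeMeasure n) := integrable_cubeCost (h.ratio₀.comp _) (measurable_section hm₀ s)
      (hTs s) fun x i => hT01 _ _
    rw [Real.norm_of_nonneg (integral_nonneg fun x =>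
      mul_nonneg (h.ratio₀.1 _).le (Finset.sum_nonneg fun i _ => sq_nonneg _))]
    calc _ ≤ ∫ x, f₀ (Matrix.vecCons s x) * n ∂cubeMeasure n := by
          refine integral_mono_ae hb ((hsec s).mul_const _) ?_
          filter_upwards [ae_sum_sq_sub_le fun x i => hT01 (s, x) i] with x hx
          exact mul_le_mul_of_nonneg_left ((le_abs_self _).trans hx) (h.ratio₀.1 _).le
      _ = firstMarginal f₀ s * n := integral_mul_const _ _
      _ ≤ β * n := by gcongr; exact hF.le s
  simp only [e1]
  refine ⟨hB, ?_⟩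
  have hm1 : Measurable fun x : Fin (n + 1) → ℝ => f₀ x *
      ∑ i, (Matrix.vecCons (S (x 0)) (T (x 0, Fin.tail x)) i - x i) ^ 2 :=
    hm₀.mul (measurable_sum_sq_sub hTm)
  rw [cubeCost, integral_cubeMeasure_succ hm1
    (integrable_cubeCost h.ratio₀ hm₀ hTm h01), ← integral_add hA hB]
  exact integral_congr_ae (.of_forall hcons)

end Knothe

section Knothe

variable {n : ℕ} {R β t : ℝ} {f₀ f₁ g fₜ : (Fin (n + 1) → ℝ) → ℝ}

/-- The chain rule for the relative entropy, in the form of an integral over the source. -/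
theorem integral_cubeEntropy_section (h : KnotheData R β t f₀ f₁ g fₜ) (hm₀ : Measurable f₀)
    (hm₁ : Measurable f₁) (hmg : Measurable g) :
    let S := unitTransport (firstMarginal f₀) (firstMarginal g)
    Integrable (fun s => firstMarginal f₀ s * cubeEntropy
      (fun x => g (Matrix.vecCons (S s) x) / firstMarginal g (S s))
      (fun x => f₁ (Matrix.vecCons (S s) x))) unitMeasure ∧
    ∫ s, firstMarginal f₀ s * cubeEntropy
      (fun x => g (Matrix.vecCons (S s) x) / firstMarginal g (S s))
      (fun x => f₁ (Matrix.vecCons (S s) x)) ∂unitMeasure =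
    cubeEntropy g f₁ - ∫ s, firstMarginal g s * Real.log (firstMarginal g s) ∂unitMeasure := by
  intro S
  have hF := isUnitDensity_firstMarginal h.ratio₀ hm₀ h.integral_f₀
  have hG := isUnitDensity_firstMarginal h.ratio_g hmg h.integral_g
  have hSm : Measurable S := hF.measurable_unitTransport hG
  have hSmap : _ = _ := hF.map_unitTransport hG
  set F := firstMarginal f₀ with hFdef
  set G := firstMarginal g with hGdef
  obtain ⟨C₁, hC₁⟩ := h.ratio₁.exists_abs_log_le
  obtain ⟨C₂, hC₂⟩ := h.ratio_g.exists_abs_log_le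
  have hlog : ∀ x, |Real.log (g x) - Real.log (f₁ x)| ≤ C₂ + C₁ := fun x =>
    (abs_sub _ _).trans (add_le_add (hC₂ x) (hC₁ x))
  have hent : Integrable (fun x => g x * (Real.log (g x) - Real.log (f₁ x)))
      (cubeMeasure (n + 1)) :=
    (h.ratio_g.integrable hmg).mul_bdd (hmg.log.sub hm₁.log).aestronglyMeasurable
      (.of_forall hlog)
  have hentm : Measurable fun x => g x * (Real.log (g x) - Real.log (f₁ x)) :=
    hmg.mul (hmg.log.sub hm₁.log)
  have hgs : ∀ r, Integrable (fun x => g (Matrix.vecCons r x)) (cubeMeasure n) := fun r =>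
    (h.ratio_g.comp fun x => Matrix.vecCons r x).integrable (measurable_section hmg r)
  have hents : ∀ r, Integrable (fun x => g (Matrix.vecCons r x) *
      (Real.log (g (Matrix.vecCons r x)) - Real.log (f₁ (Matrix.vecCons r x))))
      (cubeMeasure n) := fun r =>
    (hgs r).mul_bdd ((measurable_section hmg r).log.sub
      (measurable_section hm₁ r).log).aestronglyMeasurable (.of_forall fun x => hlog _)
  set E : ℝ → ℝ := firstMarginal fun x => g x * (Real.log (g x) - Real.log (f₁ x)) with hE
  have hEm : Measurable E := measurable_firstMarginal_const hentm
  have hA : ∀ r, cubeEntropy (fun x => g (Matrix.vecCons r x) / G r)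
      (fun x => f₁ (Matrix.vecCons r x)) = E r / G r - Real.log (G r) := by
    intro r
    have hGr := hG.pos r
    have e1 : ∀ x : Fin n → ℝ, g (Matrix.vecCons r x) / G r *
        (Real.log (g (Matrix.vecCons r x) / G r) - Real.log (f₁ (Matrix.vecCons r x))) =
        (G r)⁻¹ * (g (Matrix.vecCons r x) * (Real.log (g (Matrix.vecCons r x)) -
          Real.log (f₁ (Matrix.vecCons r x)))) -
        (G r)⁻¹ * Real.log (G r) * g (Matrix.vecCons r x) := by
      intro x
      rw [Real.log_div (h.ratio_g.1 _).ne' hGr.ne']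
      ring
    rw [cubeEntropy, integral_congr_ae (.of_forall e1),
      integral_sub ((hents r).const_mul _) ((hgs r).const_mul _), integral_const_mul,
      integral_const_mul]
    change (G r)⁻¹ * E r - (G r)⁻¹ * Real.log (G r) * G r = _
    field_simp
  have hEbd : ∀ r, |E r| ≤ β * (C₂ + C₁) := by
    intro r
    calc |E r| ≤ ∫ x, ‖g (Matrix.vecCons r x) * (Real.log (g (Matrix.vecCons r x)) -
          Real.log (f₁ (Matrix.vecCons r x)))‖ ∂cubeMeasure n :=
          norm_integral_le_integral_norm (fun x => g (Matrix.vecCons r x) *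
            (Real.log (g (Matrix.vecCons r x)) - Real.log (f₁ (Matrix.vecCons r x))))
      _ ≤ ∫ x, g (Matrix.vecCons r x) * (C₂ + C₁) ∂cubeMeasure n := by
          refine integral_mono (hents r).norm ((hgs r).mul_const _) fun x => ?_
          simp only [norm_mul, Real.norm_eq_abs, abs_of_pos (h.ratio_g.1 _)]
          exact mul_le_mul_of_nonneg_left (hlog _) (h.ratio_g.1 _).le
      _ = G r * (C₂ + C₁) := integral_mul_const _ _
      _ ≤ β * (C₂ + C₁) := by
          have := (abs_nonneg _).trans (hlog 0)
          gcongr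
          exact hG.le r
  obtain ⟨C₃, hC₃⟩ := hG.ratio.exists_abs_log_le
  have hAm : Measurable fun r => E r / G r - Real.log (G r) :=
    (hEm.div hG.measurable).sub hG.measurable.log
  have hAbd : ∀ r, |E r / G r - Real.log (G r)| ≤ β * (C₂ + C₁) * β + C₃ := by
    intro r
    refine (abs_sub _ _).trans (add_le_add ?_ (hC₃ r))
    rw [abs_div, abs_of_pos (hG.pos r), div_le_iff₀ (hG.pos r)]
    have h1 := hEbd r
    have h2 := hG.one_le_mul r
    have h3 := (abs_nonneg _).trans h1
    nlinarith
  simp only [hA]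
  refine ⟨hF.integrable_mul (hAm.comp hSm) (.of_forall fun s => hAbd _), ?_⟩
  rw [integral_mul_comp_of_map_withDensity hF.measurable hG.measurable (fun s => (hF.pos s).le)
    (fun s => (hG.pos s).le) hSm hSmap hAm]
  have e2 : ∀ r, G r * (E r / G r - Real.log (G r)) = E r - G r * Real.log (G r) := by
    intro r
    have := (hG.pos r).ne'
    field_simp
  rw [integral_congr_ae (.of_forall e2), integral_sub
    (Integrable.of_bound hEm.aestronglyMeasurable (β * (C₂ + C₁)) (.of_forall hEbd))
    (hG.integrable_mul_log hG.measurable hG.ratio)]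
  congr 1
  rw [cubeEntropy, integral_cubeMeasure_succ hentm hent]
  rfl

end Knothe

/-- The transport inequality for bounded densities on the cube, realized by the Knothe map. The
functions depend on a parameter `ω`, and `T` is jointly measurable, because the induction step
applies the statement to sections, which are parametrized by the first coordinate. -/
theorem exists_knothe_map {R β t : ℝ} (hR : 1 ≤ R) (ht0 : 0 < t) (ht : t * β ^ 2 ≤ 1 / 2) :
    ∀ (n : ℕ) {Ω : Type} [MeasurableSpace Ω] (f₀ f₁ g fₜ : Ω → (Fin n → ℝ) → ℝ),
      Measurable (Function.uncurry f₀) → Measurable (Function.uncurry f₁) →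
      Measurable (Function.uncurry g) → Measurable (Function.uncurry fₜ) →
      ∃ T : Ω × (Fin n → ℝ) → Fin n → ℝ, Measurable T ∧ (∀ p i, T p i ∈ Icc (0 : ℝ) 1) ∧
        ∀ ω, KnotheData R β t (f₀ ω) (f₁ ω) (g ω) (fₜ ω) →
          ((cubeMeasure n).withDensity fun x => ENNReal.ofReal (f₀ ω x)).map (fun x => T (ω, x)) =
            (cubeMeasure n).withDensity (fun y => ENNReal.ofReal (g ω y)) ∧
          9 / (40 * R ^ 2) * cubeCost (f₀ ω) (fun x => T (ω, x)) ≤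
            cubeEntropy (g ω) (f₁ ω) + t⁻¹ * Real.log (∫ x, fₜ ω x ∂cubeMeasure n) +
              n * (2 * t * β ^ 4) := by
  intro n
  induction n with
  | zero =>
    intro Ω _ f₀ f₁ g fₜ _ _ _ _
    refine ⟨fun p => p.2, measurable_snd, fun p i => i.elim0, fun ω h => ?_⟩
    have h0 : ∀ φ : (Fin 0 → ℝ) → ℝ, ∫ x, φ x ∂cubeMeasure 0 = φ 0 := by
      intro φ
      have h1 : cubeMeasure 0 = Measure.dirac 0 := Measure.pi_of_empty _ 0
      rw [h1, integral_dirac]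
    have e0 : ∀ x, f₀ ω x = 1 := fun x => by
      rw [Subsingleton.elim x 0, ← h0 (f₀ ω), h.integral_f₀]
    have eg : ∀ x, g ω x = 1 := fun x => by
      rw [Subsingleton.elim x 0, ← h0 (g ω), h.integral_g]
    constructor
    · simp only [e0, eg]
      exact Measure.map_id
    · rw [cubeCost, cubeEntropy, h0, h0, h0, eg, e0]
      have h1 := h.interpolation 0 (fun i => i.elim0) 0 (fun i => i.elim0)
      rw [e0, Real.one_rpow, one_mul, Subsingleton.elim ((1 - t) • 0 + t • 0) (0 : Fin 0 → ℝ)] at h1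
      have h2 := Real.log_le_log (Real.rpow_pos_of_pos (h.ratio₁.1 _) _) h1
      rw [Real.log_rpow (h.ratio₁.1 _)] at h2
      have h3 : Real.log (f₁ ω 0) ≤ t⁻¹ * Real.log (fₜ ω 0) := by
        rw [inv_mul_eq_div, le_div_iff₀ ht0]; linarith
      simp only [Finset.univ_eq_empty, Finset.sum_empty, mul_zero, Real.log_one, zero_sub,
        one_mul, Nat.cast_zero, zero_mul, add_zero]
      linarith
  | succ n ih =>
    intro Ω _ f₀ f₁ g fₜ hm₀ hm₁ hmg hmt
    set F : Ω → ℝ → ℝ := fun ω => firstMarginal (f₀ ω) with hFdef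
    set G : Ω → ℝ → ℝ := fun ω => firstMarginal (g ω) with hGdef
    have hFm : Measurable (Function.uncurry F) := measurable_firstMarginal hm₀
    have hGm : Measurable (Function.uncurry G) := measurable_firstMarginal hmg
    set S : Ω × ℝ → ℝ := fun p => unitTransport (F p.1) (G p.1) p.2 with hSdef
    have hSm : Measurable S := measurable_unitTransport_param hFm hGm
    have hsec : ∀ {f : Ω → (Fin (n + 1) → ℝ) → ℝ}, Measurable (Function.uncurry f) →
        ∀ {k : Ω × ℝ → ℝ}, Measurable k → Measurable fun q : (Ω × ℝ) × (Fin n → ℝ) =>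
          f q.1.1 (Matrix.vecCons (k q.1) q.2) := by
      intro f hf k hk
      exact hf.comp ((measurable_fst.comp measurable_fst).prodMk
        ((measurable_vecCons n).comp ((hk.comp measurable_fst).prodMk measurable_snd)))
    have hGS : Measurable fun p : Ω × ℝ => G p.1 (S p) := hGm.comp (measurable_fst.prodMk hSm)
    have hzm : Measurable fun p : Ω × ℝ => (1 - t) * p.2 + t * S p := by fun_prop
    obtain ⟨T, hTm, hT01, hT⟩ := ih
      (fun p : Ω × ℝ => fun x => f₀ p.1 (Matrix.vecCons p.2 x) / F p.1 p.2)
      (fun p x => f₁ p.1 (Matrix.vecCons (S p) x))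
      (fun p x => g p.1 (Matrix.vecCons (S p) x) / G p.1 (S p))
      (fun p x => fₜ p.1 (Matrix.vecCons ((1 - t) * p.2 + t * S p) x) * F p.1 p.2 ^ (-(1 - t)))
      ((hsec hm₀ measurable_snd).div (hFm.comp measurable_fst))
      (hsec hm₁ hSm)
      ((hsec hmg hSm).div (hGS.comp measurable_fst))
      ((hsec hmt hzm).mul ((hFm.pow_const _).comp measurable_fst))
    have htail : Measurable fun x : Fin (n + 1) → ℝ => Fin.tail x :=
      measurable_pi_lambda _ fun i => measurable_pi_apply _
    refine ⟨fun q => Matrix.vecCons (S (q.1, q.2 0)) (T ((q.1, q.2 0), Fin.tail q.2)), ?_, ?_, ?_⟩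
    · have h1 : Measurable fun q : Ω × (Fin (n + 1) → ℝ) => (q.1, q.2 0) :=
        measurable_fst.prodMk ((measurable_pi_apply 0).comp measurable_snd)
      exact (measurable_vecCons n).comp ((hSm.comp h1).prodMk
        (hTm.comp (h1.prodMk (htail.comp measurable_snd))))
    · intro q i
      refine Fin.cases ?_ (fun j => ?_) i
      · exact unitTransport_mem_Icc _ _ _
      · exact hT01 _ _
    intro ω h
    have hmω : ∀ {f : Ω → (Fin (n + 1) → ℝ) → ℝ}, Measurable (Function.uncurry f) →
        Measurable (f ω) := fun hf => hf.comp measurable_prodMk_left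
    have hF := isUnitDensity_firstMarginal h.ratio₀ (hmω hm₀) h.integral_f₀
    have hG := isUnitDensity_firstMarginal h.ratio_g (hmω hmg) h.integral_g
    have hTωm : Measurable fun p : ℝ × (Fin n → ℝ) => T ((ω, p.1), p.2) :=
      hTm.comp ((measurable_prodMk_left.comp measurable_fst).prodMk measurable_snd)
    have hsecT := fun s (hs : s ∈ Ioo (0 : ℝ) 1) =>
      hT (ω, s) (h.section (hmω hm₀) (hmω hmg) hs (hF.unitTransport_mem_Ioo hG hs))
    constructor
    · exact map_vecCons_of_sections (T := fun p => T ((ω, p.1), p.2)) h (hmω hm₀) (hmω hmg) hTωm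
        fun s hs => (hsecT s hs).1
    have hSωm : Measurable fun s => S (ω, s) := hSm.comp measurable_prodMk_left
    obtain ⟨hci, hcost⟩ := cubeCost_vecCons h (hmω hm₀) hSωm
      (fun s => unitTransport_mem_Icc _ _ _) (T := fun p => T ((ω, p.1), p.2)) hTωm
      (fun p i => hT01 _ _)
    obtain ⟨hei, hent⟩ := integral_cubeEntropy_section h (hmω hm₀) (hmω hm₁) (hmω hmg)
    have h1D := hF.transport_inequality_unit hG (h.approxConvex.firstMarginal h.ratio₀ (hmω hm₀))
      hR (measurable_firstMarginal_const (hmω hmt)) (h.ratio_t.firstMarginal (hmω hmt)) ht0 ht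
    rw [integral_firstMarginal h.ratio_t (hmω hmt)] at h1D
    set c := 9 / (40 * R ^ 2) with hc
    have hΦ := h.ratio_t.firstMarginal (hmω hmt)
    have hΦm := measurable_firstMarginal_const (hmω hmt)
    have hi1 : Integrable (fun s => F ω s *
        Real.log (firstMarginal (fₜ ω) ((1 - t) * s + t * S (ω, s)))) unitMeasure :=
      hF.integrable_mul_log (hΦm.comp (hzm.comp measurable_prodMk_left)) (hΦ.comp _)
    have hi2 : Integrable (fun s => F ω s * Real.log (F ω s)) unitMeasure :=
      hF.integrable_mul_log hF.measurable hF.ratio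
    have hpt : ∀ᵐ s ∂unitMeasure, c * (F ω s * cubeCost
        (fun x => f₀ ω (Matrix.vecCons s x) / F ω s) (fun x => T ((ω, s), x))) ≤
        F ω s * cubeEntropy (fun x => g ω (Matrix.vecCons (S (ω, s)) x) / G ω (S (ω, s)))
          (fun x => f₁ ω (Matrix.vecCons (S (ω, s)) x)) +
        (t⁻¹ * (F ω s * Real.log (firstMarginal (fₜ ω) ((1 - t) * s + t * S (ω, s)))
          - (1 - t) * (F ω s * Real.log (F ω s))) + n * (2 * t * β ^ 4) * F ω s) := by
      filter_upwards [ae_restrict_mem measurableSet_Ioo] with s hs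
      have h1 := (hsecT s hs).2
      have hFs := hF.pos s
      have h2 : Real.log (∫ x, fₜ ω (Matrix.vecCons ((1 - t) * s + t * S (ω, s)) x) *
          F ω s ^ (-(1 - t)) ∂cubeMeasure n) =
          Real.log (firstMarginal (fₜ ω) ((1 - t) * s + t * S (ω, s))) -
            (1 - t) * Real.log (F ω s) := by
        rw [integral_mul_const]
        change Real.log (firstMarginal (fₜ ω) _ * _) = _
        rw [Real.log_mul (hΦ.1 _).ne' (Real.rpow_pos_of_pos hFs _).ne', Real.log_rpow hFs]
        ring
      simp only at h1
      rw [h2] at h1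
      have h3 := mul_le_mul_of_nonneg_left h1 hFs.le
      calc _ = _ := by ring
        _ ≤ _ := h3
        _ = _ := by ring
    have hi3 := (hi1.sub (hi2.const_mul (1 - t))).const_mul t⁻¹
    have hi4 := (hF.ratio.integrable (μ := unitMeasure) hF.measurable).const_mul
      (n * (2 * t * β ^ 4))
    have hmono := integral_mono_ae (hci.const_mul c) (hei.add (hi3.add hi4)) hpt
    rw [integral_const_mul, integral_add' hei (hi3.add hi4), integral_add' hi3 hi4,
      integral_const_mul, integral_const_mul, integral_sub' hi1 (hi2.const_mul (1 - t)),
      integral_const_mul, hF.integral_eq_one, hent, mul_one] at hmono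
    rw [hcost, mul_add]
    -- the one-dimensional inequality for the first marginals, divided by `t`
    have h5 : t⁻¹ * (∫ s, F ω s * Real.log (firstMarginal (fₜ ω)
          ((1 - t) * s + t * S (ω, s))) ∂unitMeasure
        - (1 - t) * ∫ s, F ω s * Real.log (F ω s) ∂unitMeasure) ≤
        ∫ s, G ω s * Real.log (G ω s) ∂unitMeasure +
        t⁻¹ * Real.log (∫ x, fₜ ω x ∂cubeMeasure (n + 1)) -
        c * ∫ s, F ω s * (S (ω, s) - s) ^ 2 ∂unitMeasure + 2 * t * β ^ 4 := by
      rw [inv_mul_le_iff₀ ht0]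
      have e : t * (∫ s, G ω s * Real.log (G ω s) ∂unitMeasure +
        t⁻¹ * Real.log (∫ x, fₜ ω x ∂cubeMeasure (n + 1)) -
        c * ∫ s, F ω s * (S (ω, s) - s) ^ 2 ∂unitMeasure + 2 * t * β ^ 4) =
        t * ∫ s, G ω s * Real.log (G ω s) ∂unitMeasure +
        Real.log (∫ x, fₜ ω x ∂cubeMeasure (n + 1)) -
        t * c * ∫ s, F ω s * (S (ω, s) - s) ^ 2 ∂unitMeasure + 2 * t ^ 2 * β ^ 4 := by
        field_simp
      rw [e]
      linarith
    push_cast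
    linarith

/-! ### Log-concave functions on the open cube -/

/-- `f` is nonnegative and log-concave on the open unit cube. -/
def IsLogConcaveUnit {n : ℕ} (f : (Fin n → ℝ) → ℝ) : Prop :=
  (∀ x ∈ openCube n, 0 ≤ f x) ∧ ∀ x ∈ openCube n, ∀ y ∈ openCube n, ∀ t : ℝ, 0 < t → t < 1 →
    f x ^ t * f y ^ (1 - t) ≤ f (t • x + (1 - t) • y)

theorem isOpen_openCube (n : ℕ) : IsOpen (openCube n) :=
  isOpen_set_pi finite_univ fun _ _ => isOpen_Ioo

theorem measurableSet_openCube (n : ℕ) : MeasurableSet (openCube n) :=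
  (isOpen_openCube n).measurableSet

theorem add_mem_openCube {n : ℕ} {x y : Fin n → ℝ} (hx : x ∈ openCube n) (hy : y ∈ openCube n)
    {t : ℝ} (h0 : 0 < t) (h1 : t < 1) : t • x + (1 - t) • y ∈ openCube n :=
  convex_openCube n hx hy h0.le (by linarith) (by ring)

open scoped Pointwise in
/-- A log-concave function of finite integral is bounded: were `f x` huge, `f` would be large on the
midpoints of `x` and the points of a superlevel set of positive measure. -/
theorem IsLogConcaveUnit.exists_le {n : ℕ} {f : (Fin n → ℝ) → ℝ} (hf : IsLogConcaveUnit f)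
    (hm : AEMeasurable f (cubeMeasure n))
    (h0 : ∫⁻ x, ENNReal.ofReal (f x) ∂cubeMeasure n ≠ 0)
    (htop : ∫⁻ x, ENNReal.ofReal (f x) ∂cubeMeasure n ≠ ∞) :
    ∃ M, ∀ x ∈ openCube n, f x ≤ M := by
  -- a superlevel set of positive measure
  obtain ⟨k, hk⟩ : ∃ k : ℕ, cubeMeasure n {x | 1 / ((k : ℝ) + 1) < f x} ≠ 0 := by
    by_contra! hcon
    apply h0
    rw [lintegral_eq_zero_iff' hm.ennreal_ofReal]
    have h1 : ∀ᵐ x ∂cubeMeasure n, ∀ k : ℕ, ¬ 1 / ((k : ℝ) + 1) < f x := by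
      rw [ae_all_iff]
      intro k
      rw [ae_iff]
      simpa using hcon k
    filter_upwards [h1] with x hx
    simp only [Pi.zero_apply, ENNReal.ofReal_eq_zero]
    by_contra! h
    obtain ⟨k, hk⟩ := exists_nat_one_div_lt h
    exact hx k hk
  set η : ℝ := 1 / ((k : ℝ) + 1) with hη
  have hηpos : 0 < η := by positivity
  set A : Set (Fin n → ℝ) := {x | η < f x} ∩ openCube n with hA
  have hAvol : volume A ≠ 0 := by
    rwa [cubeMeasure_eq_restrict, Measure.restrict_apply' (measurableSet_openCube n)] at hk
  set I := ∫⁻ x, ENNReal.ofReal (f x) ∂cubeMeasure n with hI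
  set v := ENNReal.ofReal ((1 / 2 : ℝ) ^ n) * volume A with hv
  have hv0 : v ≠ 0 := mul_ne_zero (by simp) hAvol
  have key : ∀ x ∈ openCube n, ENNReal.ofReal (f x ^ (1 / 2 : ℝ) * η ^ (1 / 2 : ℝ)) * v ≤ I := by
    intro x hx
    set e := ENNReal.ofReal (f x ^ (1 / 2 : ℝ) * η ^ (1 / 2 : ℝ)) with he
    set B : Set (Fin n → ℝ) := (fun z => (1 / 2 : ℝ) • x + z) '' ((1 / 2 : ℝ) • A) with hB
    have hBvol : volume B = v := by
      rw [hB, image_add_left, measure_preimage_add, Measure.addHaar_smul]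
      simp [hv]
    have hsub : B ⊆ {z | e ≤ ENNReal.ofReal (f z)} ∩ openCube n := by
      rintro _ ⟨_, ⟨y, hy, rfl⟩, rfl⟩
      have h1 := hf.2 x hx y hy.2 (1 / 2) (by norm_num) (by norm_num)
      have h2 := add_mem_openCube hx hy.2 (t := 1 / 2) (by norm_num) (by norm_num)
      have h3 : (1 - 1 / 2 : ℝ) = 1 / 2 := by norm_num
      rw [h3] at h1 h2
      refine ⟨ENNReal.ofReal_le_ofReal (le_trans ?_ h1), h2⟩
      have := Real.rpow_nonneg (hf.1 x hx) (1 / 2)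
      have h4 : η < f y := hy.1
      gcongr
    calc e * v = e * volume B := by rw [hBvol]
      _ ≤ e * cubeMeasure n {z | e ≤ ENNReal.ofReal (f z)} := by
          rw [cubeMeasure_eq_restrict, Measure.restrict_apply' (measurableSet_openCube n)]
          gcongr
      _ ≤ I := mul_meas_ge_le_lintegral₀ hm.ennreal_ofReal e
  have hdiv : I / v ≠ ∞ := ENNReal.div_ne_top htop hv0
  refine ⟨((I / v).toReal / η ^ (1 / 2 : ℝ)) ^ 2, fun x hx => ?_⟩
  have h1 : ENNReal.ofReal (f x ^ (1 / 2 : ℝ) * η ^ (1 / 2 : ℝ)) ≤ I / v := by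
    rw [ENNReal.le_div_iff_mul_le (Or.inl hv0) (Or.inr htop)]
    exact key x hx
  rw [ENNReal.ofReal_le_iff_le_toReal hdiv, ← le_div_iff₀ (Real.rpow_pos_of_pos hηpos _)] at h1
  have h2 := hf.1 x hx
  calc f x = (f x ^ (1 / 2 : ℝ)) ^ 2 := by
        rw [← Real.rpow_natCast, ← Real.rpow_mul h2]; norm_num
    _ ≤ _ := by
        have := Real.rpow_nonneg h2 (1 / 2)
        gcongr

/-- A log-concave function is continuous off the boundary of the convex set where it is positive. -/
theorem IsLogConcaveUnit.ae_continuousAt {n : ℕ} {f : (Fin n → ℝ) → ℝ} (hf : IsLogConcaveUnit f) :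
    ∀ᵐ x ∂cubeMeasure n, ContinuousAt f x := by
  set K : Set (Fin n → ℝ) := {x | x ∈ openCube n ∧ 0 < f x} with hK
  have hpos : ∀ x ∈ K, ∀ y ∈ K, ∀ t : ℝ, 0 < t → t < 1 → 0 < f (t • x + (1 - t) • y) :=
    fun x hx y hy t h0 h1 => lt_of_lt_of_le
      (mul_pos (Real.rpow_pos_of_pos hx.2 _) (Real.rpow_pos_of_pos hy.2 _))
      (hf.2 x hx.1 y hy.1 t h0 h1)
  have hKc : Convex ℝ K := by
    rw [convex_iff_forall_pos]
    intro x hx y hy a b ha hb hab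
    obtain rfl : b = 1 - a := by linarith
    exact ⟨add_mem_openCube hx.1 hy.1 ha (by linarith), hpos x hx y hy a ha (by linarith)⟩
  have hconc : ConcaveOn ℝ (interior K) fun x => Real.log (f x) := by
    refine ⟨hKc.interior, ?_⟩
    intro x hx y hy a b ha hb hab
    rcases ha.eq_or_lt with rfl | ha
    · obtain rfl : b = 1 := by linarith
      simp
    rcases hb.eq_or_lt with rfl | hb
    · obtain rfl : a = 1 := by linarith
      simp
    obtain rfl : b = 1 - a := by linarith
    have hx := interior_subset hx
    have hy := interior_subset hy
    have h1 := hf.2 x hx.1 y hy.1 a ha (by linarith)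
    have h2 := Real.log_le_log
      (mul_pos (Real.rpow_pos_of_pos hx.2 _) (Real.rpow_pos_of_pos hy.2 _)) h1
    rwa [Real.log_mul (Real.rpow_pos_of_pos hx.2 _).ne' (Real.rpow_pos_of_pos hy.2 _).ne',
      Real.log_rpow hx.2, Real.log_rpow hy.2] at h2
  have hcont := hconc.continuousOn isOpen_interior
  have hfr : ∀ᵐ x ∂cubeMeasure n, x ∉ frontier K := by
    rw [cubeMeasure_eq_restrict]
    exact ae_restrict_of_ae (compl_mem_ae_iff.2 (hKc.addHaar_frontier volume))
  filter_upwards [hfr, ae_mem_openCube n] with x hx hxc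
  by_cases hxK : x ∈ closure K
  · have hxi : x ∈ interior K := by
      by_contra h; exact hx ⟨hxK, h⟩
    have h1 := (hcont.continuousAt (isOpen_interior.mem_nhds hxi)).rexp
    refine h1.congr ?_
    filter_upwards [isOpen_interior.mem_nhds hxi] with y hy
    exact Real.exp_log (interior_subset hy).2
  · have h1 : f =ᶠ[nhds x] fun _ => 0 := by
      filter_upwards [isClosed_closure.isOpen_compl.mem_nhds hxK,
        (isOpen_openCube n).mem_nhds hxc] with y hy hyc
      by_contra h
      exact hy (subset_closure ⟨hyc, lt_of_le_of_ne (hf.1 y hyc) (Ne.symm h)⟩)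
    exact continuousAt_const.congr h1.symm

/-! ### Log-Lipschitz regularization -/

/-- The smallest majorant of `f` on the open cube whose logarithm is `N`-Lipschitz for the `ℓ¹`
distance. -/
noncomputable def logLipschitzHull {n : ℕ} (N : ℝ) (f : (Fin n → ℝ) → ℝ) (x : Fin n → ℝ) : ℝ :=
  ⨆ y : openCube n, f y * Real.exp (-N * ∑ i, |x i - (y : Fin n → ℝ) i|)

namespace logLipschitzHull

variable {n : ℕ} {N M R : ℝ} {f : (Fin n → ℝ) → ℝ}

theorem term_le (hN : 0 ≤ N) (h0 : ∀ x ∈ openCube n, 0 ≤ f x) (hM : ∀ x ∈ openCube n, f x ≤ M)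
    (x : Fin n → ℝ) (y : openCube n) :
    f y * Real.exp (-N * ∑ i, |x i - (y : Fin n → ℝ) i|) ≤ M := by
  have h1 : Real.exp (-N * ∑ i, |x i - (y : Fin n → ℝ) i|) ≤ 1 := by
    rw [Real.exp_le_one_iff]
    have : 0 ≤ ∑ i, |x i - (y : Fin n → ℝ) i| := Finset.sum_nonneg fun i _ => abs_nonneg _
    nlinarith
  calc _ ≤ f y * 1 := mul_le_mul_of_nonneg_left h1 (h0 _ y.2)
    _ ≤ M := by rw [mul_one]; exact hM _ y.2

theorem bddAbove (hN : 0 ≤ N) (h0 : ∀ x ∈ openCube n, 0 ≤ f x) (hM : ∀ x ∈ openCube n, f x ≤ M)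
    (x : Fin n → ℝ) :
    BddAbove (range fun y : openCube n =>
      f y * Real.exp (-N * ∑ i, |x i - (y : Fin n → ℝ) i|)) :=
  ⟨M, by rintro _ ⟨y, rfl⟩; exact term_le hN h0 hM x y⟩

theorem le_of_mem (hN : 0 ≤ N) (h0 : ∀ x ∈ openCube n, 0 ≤ f x) (hM : ∀ x ∈ openCube n, f x ≤ M)
    (x : Fin n → ℝ) {y : Fin n → ℝ} (hy : y ∈ openCube n) :
    f y * Real.exp (-N * ∑ i, |x i - y i|) ≤ logLipschitzHull N f x :=
  le_ciSup (bddAbove hN h0 hM x) (⟨y, hy⟩ : openCube n)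

theorem nonempty_openCube (n : ℕ) : (openCube n).Nonempty :=
  ⟨fun _ => 1 / 2, fun _ _ => ⟨by norm_num, by norm_num⟩⟩

theorem le_of_forall {C : ℝ} {x : Fin n → ℝ}
    (h : ∀ y ∈ openCube n, f y * Real.exp (-N * ∑ i, |x i - y i|) ≤ C) :
    logLipschitzHull N f x ≤ C := by
  have : Nonempty (openCube n) := (nonempty_openCube n).to_subtype
  exact ciSup_le fun y => h y y.2

theorem exists_lt {C : ℝ} {x : Fin n → ℝ} (h : C < logLipschitzHull N f x) :
    ∃ y ∈ openCube n, C < f y * Real.exp (-N * ∑ i, |x i - y i|) := by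
  by_contra! hcon
  exact absurd (le_of_forall hcon) (not_le.2 h)

theorem self_le (hN : 0 ≤ N) (h0 : ∀ x ∈ openCube n, 0 ≤ f x) (hM : ∀ x ∈ openCube n, f x ≤ M)
    {x : Fin n → ℝ} (hx : x ∈ openCube n) : f x ≤ logLipschitzHull N f x := by
  simpa using le_of_mem hN h0 hM x hx

theorem le_bound (hN : 0 ≤ N) (h0 : ∀ x ∈ openCube n, 0 ≤ f x) (hM : ∀ x ∈ openCube n, f x ≤ M)
    (x : Fin n → ℝ) : logLipschitzHull N f x ≤ M :=
  le_of_forall fun y hy => term_le hN h0 hM x ⟨y, hy⟩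

theorem pos (hN : 0 ≤ N) (h0 : ∀ x ∈ openCube n, 0 ≤ f x) (hM : ∀ x ∈ openCube n, f x ≤ M)
    {y : Fin n → ℝ} (hy : y ∈ openCube n) (hfy : 0 < f y) (x : Fin n → ℝ) :
    0 < logLipschitzHull N f x :=
  lt_of_lt_of_le (mul_pos hfy (Real.exp_pos _)) (le_of_mem hN h0 hM x hy)

theorem measurable (hN : 0 ≤ N) (h0 : ∀ x ∈ openCube n, 0 ≤ f x)
    (hM : ∀ x ∈ openCube n, f x ≤ M) : Measurable (logLipschitzHull N f) := by
  refine LowerSemicontinuous.measurable (lowerSemicontinuous_ciSup (bddAbove hN h0 hM) fun y => ?_)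
  exact Continuous.lowerSemicontinuous (by fun_prop)

theorem le_exp_mul (hN : 0 ≤ N) (h0 : ∀ x ∈ openCube n, 0 ≤ f x)
    (hM : ∀ x ∈ openCube n, f x ≤ M) {x x' : Fin n → ℝ} (hx : x ∈ openCube n)
    (hx' : x' ∈ openCube n) :
    logLipschitzHull N f x ≤ Real.exp (N * n) * logLipschitzHull N f x' := by
  refine le_of_forall fun y hy => ?_
  have h1 : ∑ i, |x' i - y i| ≤ n + ∑ i, |x i - y i| := by
    calc ∑ i, |x' i - y i| ≤ ∑ i, (1 + |x i - y i|) := by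
          refine Finset.sum_le_sum fun i _ => ?_
          have h2 := hx i (mem_univ i)
          have h3 := hx' i (mem_univ i)
          have h4 : |x' i - x i| ≤ 1 := by
            rw [abs_le]; constructor <;> linarith [h2.1, h2.2, h3.1, h3.2]
          have := abs_sub_le (x' i) (x i) (y i)
          linarith
      _ = _ := by rw [Finset.sum_add_distrib]; simp
  calc f y * Real.exp (-N * ∑ i, |x i - y i|)
      ≤ f y * (Real.exp (N * n) * Real.exp (-N * ∑ i, |x' i - y i|)) := by
        refine mul_le_mul_of_nonneg_left ?_ (h0 y hy)
        rw [← Real.exp_add, Real.exp_le_exp]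
        have := mul_le_mul_of_nonneg_left h1 hN
        linarith
    _ = Real.exp (N * n) * (f y * Real.exp (-N * ∑ i, |x' i - y i|)) := by ring
    _ ≤ _ := mul_le_mul_of_nonneg_left (le_of_mem hN h0 hM x' hy) (Real.exp_pos _).le

theorem isLogConcaveUnit (hN : 0 ≤ N) (hf : IsLogConcaveUnit f)
    (hM : ∀ x ∈ openCube n, f x ≤ M) {y₀ : Fin n → ℝ} (hy₀ : y₀ ∈ openCube n)
    (hfy₀ : 0 < f y₀) : IsLogConcaveUnit (logLipschitzHull N f) := by
  have hpos := pos hN hf.1 hM hy₀ hfy₀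
  refine ⟨fun x _ => (hpos x).le, fun x _ x' _ t ht0 ht1 => ?_⟩
  -- the suprema need not be attained, so the claim is proved up to a factor `θ < 1`
  suffices h : ∀ θ : ℝ, 0 < θ → θ < 1 →
      θ * (logLipschitzHull N f x ^ t * logLipschitzHull N f x' ^ (1 - t)) ≤
        logLipschitzHull N f (t • x + (1 - t) • x') by
    have hC := hpos (t • x + (1 - t) • x')
    set C := logLipschitzHull N f (t • x + (1 - t) • x')
    set P := logLipschitzHull N f x ^ t * logLipschitzHull N f x' ^ (1 - t)
    by_contra! hlt
    have hP : 0 < P := hC.trans hlt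
    have h1 := h ((C / P + 1) / 2) (by positivity) (by
      have := (div_lt_one hP).2 hlt
      linarith)
    have h2 : (C / P + 1) / 2 * P = (C + P) / 2 := by field_simp
    linarith
  intro θ hθ0 hθ1
  obtain ⟨y, hy, hy'⟩ := exists_lt (C := θ * logLipschitzHull N f x) (x := x) (N := N) (f := f)
    (by nlinarith [hpos x])
  obtain ⟨z, hz, hz'⟩ := exists_lt (C := θ * logLipschitzHull N f x') (x := x') (N := N) (f := f)
    (by nlinarith [hpos x'])
  have ht1' : 0 < 1 - t := by linarith
  have hfy := hf.1 y hy
  have hfz := hf.1 z hz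
  have hsum : ∑ i, |(t • x + (1 - t) • x') i - (t • y + (1 - t) • z) i| ≤
      t * ∑ i, |x i - y i| + (1 - t) * ∑ i, |x' i - z i| := by
    rw [Finset.mul_sum, Finset.mul_sum, ← Finset.sum_add_distrib]
    refine Finset.sum_le_sum fun i _ => ?_
    simp only [Pi.add_apply, Pi.smul_apply, smul_eq_mul]
    calc |t * x i + (1 - t) * x' i - (t * y i + (1 - t) * z i)|
        = |t * (x i - y i) + (1 - t) * (x' i - z i)| := by congr 1; ring
      _ ≤ |t * (x i - y i)| + |(1 - t) * (x' i - z i)| := abs_add_le _ _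
      _ = _ := by rw [abs_mul, abs_mul, abs_of_pos ht0, abs_of_pos ht1']
  calc θ * (logLipschitzHull N f x ^ t * logLipschitzHull N f x' ^ (1 - t))
      = (θ * logLipschitzHull N f x) ^ t * (θ * logLipschitzHull N f x') ^ (1 - t) := by
        rw [Real.mul_rpow hθ0.le (hpos x).le, Real.mul_rpow hθ0.le (hpos x').le]
        have : θ = θ ^ t * θ ^ (1 - t) := by
          rw [← Real.rpow_add hθ0, add_sub_cancel, Real.rpow_one]
        conv_lhs => rw [this]
        ring
    _ ≤ (f y * Real.exp (-N * ∑ i, |x i - y i|)) ^ t *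
        (f z * Real.exp (-N * ∑ i, |x' i - z i|)) ^ (1 - t) := by
        have h1 := (hpos x).le
        have h2 := (hpos x').le
        gcongr
    _ = f y ^ t * f z ^ (1 - t) * Real.exp (-N * (t * ∑ i, |x i - y i| +
          (1 - t) * ∑ i, |x' i - z i|)) := by
        rw [Real.mul_rpow hfy (Real.exp_pos _).le, Real.mul_rpow hfz (Real.exp_pos _).le,
          ← Real.exp_mul, ← Real.exp_mul]
        rw [show -N * (t * ∑ i, |x i - y i| + (1 - t) * ∑ i, |x' i - z i|) =
          -N * (∑ i, |x i - y i|) * t + -N * (∑ i, |x' i - z i|) * (1 - t) by ring, Real.exp_add]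
        ring
    _ ≤ f (t • y + (1 - t) • z) * Real.exp (-N *
          ∑ i, |(t • x + (1 - t) • x') i - (t • y + (1 - t) • z) i|) := by
        refine mul_le_mul (hf.2 y hy z hz t ht0 ht1) ?_ (Real.exp_pos _).le
          (hf.1 _ (add_mem_openCube hy hz ht0 ht1))
        rw [Real.exp_le_exp]
        have := mul_le_mul_of_nonneg_left hsum hN
        linarith
    _ ≤ _ := le_of_mem hN hf.1 hM _ (add_mem_openCube hy hz ht0 ht1)

/-- Points `y` far from `x` do not contribute to the hull in the limit, because `f` is bounded. -/
theorem tendsto (h0 : ∀ x ∈ openCube n, 0 ≤ f x)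
    (hM : ∀ x ∈ openCube n, f x ≤ M) {x : Fin n → ℝ} (hx : x ∈ openCube n)
    (hc : ContinuousAt f x) :
    Tendsto (fun N : ℕ => logLipschitzHull N f x) atTop (𝓝 (f x)) := by
  have hM0 : 0 ≤ M := (h0 x hx).trans (hM x hx)
  refine tendsto_order.2 ⟨fun a ha => ?_, fun a ha => ?_⟩
  · exact .of_forall fun N => ha.trans_le (self_le N.cast_nonneg h0 hM hx)
  obtain ⟨b, hb1, hb2⟩ := exists_between ha
  have hb0 : 0 < b := (h0 x hx).trans_lt hb1
  obtain ⟨δ, hδ, hδ'⟩ := Metric.eventually_nhds_iff.1 (hc.eventually (gt_mem_nhds hb1))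
  have hlim : Tendsto (fun N : ℕ => M * Real.exp (-((N : ℝ) * δ))) atTop (𝓝 (M * 0)) := by
    refine Tendsto.const_mul _ (Real.tendsto_exp_neg_atTop_nhds_zero.comp ?_)
    exact tendsto_natCast_atTop_atTop.atTop_mul_const hδ
  rw [mul_zero] at hlim
  filter_upwards [hlim.eventually (gt_mem_nhds hb0)] with N hN
  refine lt_of_le_of_lt (le_of_forall fun y hy => ?_) hb2
  by_cases hd : dist y x < δ
  · have h1 : f y < b := hδ' hd
    have h2 : Real.exp (-(N : ℝ) * ∑ i, |x i - y i|) ≤ 1 := by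
      rw [Real.exp_le_one_iff]
      have : 0 ≤ ∑ i, |x i - y i| := Finset.sum_nonneg fun i _ => abs_nonneg _
      have := mul_nonneg (N.cast_nonneg (α := ℝ)) this
      linarith
    calc _ ≤ f y * 1 := mul_le_mul_of_nonneg_left h2 (h0 _ hy)
      _ ≤ b := by linarith
  · have h1 : δ ≤ ∑ i, |x i - y i| := by
      refine (not_lt.1 hd).trans ?_
      rw [dist_comm, dist_pi_le_iff (Finset.sum_nonneg fun i _ => abs_nonneg _)]
      intro i
      rw [Real.dist_eq]
      exact Finset.single_le_sum (f := fun i => |x i - y i|) (fun j _ => abs_nonneg _)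
        (Finset.mem_univ i)
    calc _ ≤ M * Real.exp (-((N : ℝ) * δ)) := by
          refine mul_le_mul (hM y hy) ?_ (Real.exp_pos _).le hM0
          rw [Real.exp_le_exp, neg_mul, neg_le_neg_iff]
          gcongr
      _ ≤ b := hN.le

theorem exp_neg_abs_le {p q r μ : ℝ} (h0 : 0 ≤ μ) (h1 : μ ≤ 1)
    (h : |μ * p + (1 - μ) * q - r| = μ * |p - r| + (1 - μ) * |q - r|) :
    Real.exp (-N * |μ * p + (1 - μ) * q - r|) ≤
      μ * Real.exp (-N * |p - r|) + (1 - μ) * Real.exp (-N * |q - r|) := by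
  have h2 := convexOn_exp.2 (mem_univ (-N * |p - r|)) (mem_univ (-N * |q - r|)) h0
    (sub_nonneg.2 h1) (by ring)
  simp only [smul_eq_mul] at h2
  rw [h, show -N * (μ * |p - r| + (1 - μ) * |q - r|) =
    μ * (-N * |p - r|) + (1 - μ) * (-N * |q - r|) by ring]
  exact h2

/-- The hull is approximately convex with the same factor: if the point `r` that realizes the hull
at `z` lies between the endpoints `a` and `b`, approximate convexity is applied at `r`, and beyond
`r` the exponential is convex; otherwise the exponential is convex on the whole segment. -/
theorem isCoordApproxConvexUnit (hN : 0 ≤ N) (h0 : ∀ x ∈ openCube n, 0 ≤ f x)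
    (hM : ∀ x ∈ openCube n, f x ≤ M) (hR : 1 ≤ R) (hc : IsCoordApproxConvexUnit R f) :
    IsCoordApproxConvexUnit R (logLipschitzHull N f) := by
  intro i a ha b hb hab t ht0 ht1
  set A := logLipschitzHull N f a with hA
  set B := logLipschitzHull N f b with hB
  refine le_of_forall fun y hy => ?_
  set z := t • a + (1 - t) • b with hz
  set r := y i with hr
  set σ := ∑ j ∈ Finset.univ.erase i, |z j - y j| with hσ
  have hzj : ∀ j, j ≠ i → z j = a j ∧ z j = b j := by
    intro j hj
    have := hab j hj
    simp only [hz, Pi.add_apply, Pi.smul_apply, smul_eq_mul, this]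
    constructor <;> ring
  have hzi : z i = t * a i + (1 - t) * b i := rfl
  have split : ∀ w v : Fin n → ℝ, (∀ j, j ≠ i → w j = z j) → (∀ j, j ≠ i → v j = y j) →
      ∑ j, |w j - v j| = |w i - v i| + σ := by
    intro w v hw hv
    rw [← Finset.add_sum_erase _ _ (Finset.mem_univ i)]
    congr 1
    refine Finset.sum_congr rfl fun j hj => ?_
    rw [hw j (Finset.ne_of_mem_erase hj), hv j (Finset.ne_of_mem_erase hj)]
  set φ := f y * Real.exp (-N * σ) with hφ
  have hφ0 : 0 ≤ φ := mul_nonneg (h0 y hy) (Real.exp_pos _).le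
  have hA0 : 0 ≤ A := (mul_nonneg (h0 y hy) (Real.exp_pos _).le).trans (le_of_mem hN h0 hM a hy)
  have hB0 : 0 ≤ B := (mul_nonneg (h0 y hy) (Real.exp_pos _).le).trans (le_of_mem hN h0 hM b hy)
  have ht1' : 0 < 1 - t := by linarith
  have term : ∀ w : Fin n → ℝ, (∀ j, j ≠ i → w j = z j) →
      f y * Real.exp (-N * ∑ j, |w j - y j|) = φ * Real.exp (-N * |w i - r|) := by
    intro w hw
    rw [split w y hw fun _ _ => rfl, hφ, mul_add, Real.exp_add]
    ring
  have hEa : φ * Real.exp (-N * |a i - r|) ≤ A := by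
    rw [← term a fun j hj => (hzj j hj).1.symm]; exact le_of_mem hN h0 hM a hy
  have hEb : φ * Real.exp (-N * |b i - r|) ≤ B := by
    rw [← term b fun j hj => (hzj j hj).2.symm]; exact le_of_mem hN h0 hM b hy
  rw [term z fun _ _ => rfl, hzi]
  rcases le_or_gt 0 ((a i - r) * (b i - r)) with hside | hside
  · have h1 : |t * a i + (1 - t) * b i - r| = t * |a i - r| + (1 - t) * |b i - r| := by
      rw [show t * a i + (1 - t) * b i - r = t * (a i - r) + (1 - t) * (b i - r) by ring]
      rcases mul_nonneg_iff.1 hside with ⟨h1, h2⟩ | ⟨h1, h2⟩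
      · rw [abs_of_nonneg h1, abs_of_nonneg h2, abs_of_nonneg (by positivity)]
      · rw [abs_of_nonpos h1, abs_of_nonpos h2, abs_of_nonpos (by nlinarith)]
        ring
    calc _ ≤ φ * (t * Real.exp (-N * |a i - r|) + (1 - t) * Real.exp (-N * |b i - r|)) :=
          mul_le_mul_of_nonneg_left (exp_neg_abs_le ht0.le ht1.le h1) hφ0
      _ = t * (φ * Real.exp (-N * |a i - r|)) + (1 - t) * (φ * Real.exp (-N * |b i - r|)) := by
          ring
      _ ≤ t * A + (1 - t) * B := by gcongr
      _ ≤ R * (t * A + (1 - t) * B) := le_mul_of_one_le_left (by positivity) hR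
  -- the parameter of `r` on the segment from `b i` to `a i`
  have hne : b i - a i ≠ 0 := by
    intro h
    have : a i = b i := by linarith
    rw [this] at hside
    nlinarith [sq_nonneg (b i - r)]
  obtain ⟨s, hs0, hs1, hs⟩ : ∃ s, 0 < s ∧ s < 1 ∧ r = s * a i + (1 - s) * b i := by
    refine ⟨(b i - r) / (b i - a i), ?_, ?_, ?_⟩
    · rcases mul_neg_iff.1 hside with ⟨h1, h2⟩ | ⟨h1, h2⟩
      · exact div_pos_of_neg_of_neg h2 (by linarith)
      · exact div_pos h2 (by linarith)
    · rcases mul_neg_iff.1 hside with ⟨h1, h2⟩ | ⟨h1, h2⟩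
      · rw [div_lt_one_of_neg (by linarith)]; linarith
      · rw [div_lt_one (by linarith)]; linarith
    · field_simp
      ring
  have hupd : ∀ w ∈ openCube n, Function.update y i (w i) ∈ openCube n := by
    intro w hw j _
    by_cases hj : j = i
    · subst hj; simpa using hw j (mem_univ _)
    · simpa [hj] using hy j (mem_univ _)
  have hterm : ∀ w ∈ openCube n, (∀ j, j ≠ i → w j = z j) →
      f (Function.update y i (w i)) * Real.exp (-N * σ) ≤ logLipschitzHull N f w := by
    intro w hw hwz
    have h1 := le_of_mem hN h0 hM w (hupd w hw)
    rw [split w _ hwz fun j hj => by simp [hj]] at h1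
    simpa using h1
  have hφle : φ ≤ R * (s * A + (1 - s) * B) := by
    have h1 := hc i _ (hupd a ha) _ (hupd b hb) (fun j hj => by simp [hj]) s hs0 hs1
    have h2 : s • Function.update y i (a i) + (1 - s) • Function.update y i (b i) = y := by
      ext j
      by_cases hj : j = i
      · subst hj; simp [← hs, hr]
      · simp [hj]; ring
    rw [h2] at h1
    have h3 := hterm a ha fun j hj => (hzj j hj).1.symm
    have h4 := hterm b hb fun j hj => (hzj j hj).2.symm
    have hs1' : 0 < 1 - s := by linarith
    calc φ ≤ R * (s * f (Function.update y i (a i)) + (1 - s) * f (Function.update y i (b i))) *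
          Real.exp (-N * σ) := mul_le_mul_of_nonneg_right h1 (Real.exp_pos _).le
      _ = R * (s * (f (Function.update y i (a i)) * Real.exp (-N * σ)) +
          (1 - s) * (f (Function.update y i (b i)) * Real.exp (-N * σ))) := by ring
      _ ≤ _ := by gcongr
  -- the remaining part of the segment, from `r` to an endpoint `c` where the hull is at least `C`
  have final : ∀ c C μ : ℝ, 0 ≤ C → 0 ≤ μ → μ ≤ 1 →
      t * a i + (1 - t) * b i = μ * r + (1 - μ) * c → φ * Real.exp (-N * |c - r|) ≤ C →
      φ * Real.exp (-N * |t * a i + (1 - t) * b i - r|) ≤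
        R * (μ * (s * A + (1 - s) * B) + (1 - μ) * C) := by
    intro c C μ hC hμ0 hμ1 hzc hE
    have h1 : |μ * r + (1 - μ) * c - r| = μ * |r - r| + (1 - μ) * |c - r| := by
      rw [show μ * r + (1 - μ) * c - r = (1 - μ) * (c - r) by ring, abs_mul,
        abs_of_nonneg (sub_nonneg.2 hμ1)]
      simp
    have h2 := exp_neg_abs_le (N := N) hμ0 hμ1 h1
    rw [sub_self, abs_zero, mul_zero, Real.exp_zero, mul_one] at h2
    have hμ1' := sub_nonneg.2 hμ1
    rw [hzc]
    calc _ ≤ φ * (μ + (1 - μ) * Real.exp (-N * |c - r|)) := mul_le_mul_of_nonneg_left h2 hφ0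
      _ = μ * φ + (1 - μ) * (φ * Real.exp (-N * |c - r|)) := by ring
      _ ≤ μ * (R * (s * A + (1 - s) * B)) + (1 - μ) * (R * C) :=
          add_le_add (mul_le_mul_of_nonneg_left hφle hμ0)
            (mul_le_mul_of_nonneg_left (hE.trans (le_mul_of_one_le_left hC hR)) hμ1')
      _ = _ := by ring
  rcases le_total t s with hts | hts
  · refine (final (b i) B (t / s) hB0 (by positivity) ((div_le_one hs0).2 hts) ?_ hEb).trans_eq ?_
    · rw [hs]; field_simp; ring
    · field_simp; ring
  · have hs1' : 0 < 1 - s := by linarith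
    refine (final (a i) A ((1 - t) / (1 - s)) hA0 (by positivity)
      ((div_le_one hs1').2 (by linarith)) ?_ hEa).trans_eq ?_
    · rw [hs]; field_simp; ring
    · field_simp; ring

end logLipschitzHull

/-! ### Couplings -/

/-- The transport inequality for bounded densities, up to an arbitrarily small error: the
interpolation parameter of the Knothe map argument tends to `0`. -/
theorem exists_map_cubeCost_le {n : ℕ} {R β : ℝ} (hR : 1 ≤ R) {p g : (Fin n → ℝ) → ℝ}
    (hpm : Measurable p) (hgm : Measurable g) (hp : HasBoundedRatio β p)
    (hg : HasBoundedRatio β g) (hp1 : ∫ x, p x ∂cubeMeasure n = 1)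
    (hg1 : ∫ x, g x ∂cubeMeasure n = 1) (hlog : IsLogConcaveUnit p)
    (hconv : IsCoordApproxConvexUnit R p) {ε : ℝ} (hε : 0 < ε) :
    ∃ T : (Fin n → ℝ) → Fin n → ℝ, Measurable T ∧ (∀ x i, T x i ∈ Icc (0 : ℝ) 1) ∧
      ((cubeMeasure n).withDensity fun x => ENNReal.ofReal (p x)).map T =
        (cubeMeasure n).withDensity (fun y => ENNReal.ofReal (g y)) ∧
      cubeCost p T ≤ 40 / 9 * R ^ 2 * (cubeEntropy g p + ε) := by
  have hβ := hp.one_le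
  obtain ⟨t, ht0, ht1, ht2⟩ : ∃ t : ℝ, 0 < t ∧ t * β ^ 2 ≤ 1 / 2 ∧ n * (2 * t * β ^ 4) ≤ ε := by
    refine ⟨min (1 / (2 * β ^ 2)) (ε / ((n + 1) * 2 * β ^ 4)), by positivity, ?_, ?_⟩
    · calc _ ≤ 1 / (2 * β ^ 2) * β ^ 2 := by gcongr; exact min_le_left _ _
        _ = 1 / 2 := by field_simp
    · calc _ ≤ (n : ℝ) * (2 * (ε / ((n + 1) * 2 * β ^ 4)) * β ^ 4) := by
            gcongr; exact min_le_right _ _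
        _ = n / (n + 1) * ε := by field_simp
        _ ≤ 1 * ε := by
            gcongr
            rw [div_le_one (by positivity)]; linarith
        _ = ε := one_mul ε
  have ht3 : t < 1 := by nlinarith
  obtain ⟨T, hTm, hT01, hT⟩ := exists_knothe_map hR ht0 ht1 n (Ω := Unit) (fun _ => p)
    (fun _ => p) (fun _ => g) (fun _ => p) (hpm.comp measurable_snd) (hpm.comp measurable_snd)
    (hgm.comp measurable_snd) (hpm.comp measurable_snd)
  have hdata : KnotheData R β t p p g p :=
    { ratio₀ := hp
      ratio₁ := hp
      ratio_g := hg
      ratio_t := hp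
      integral_f₀ := hp1
      integral_g := hg1
      approxConvex := hconv
      interpolation := fun x hx y hy => by
        have := hlog.2 x hx y hy (1 - t) (by linarith) (by linarith)
        rwa [sub_sub_cancel] at this }
  obtain ⟨h1, h2⟩ := hT () hdata
  refine ⟨fun x => T ((), x), hTm.comp measurable_prodMk_left, fun x i => hT01 _ _, h1, ?_⟩
  rw [hp1, Real.log_one, mul_zero, add_zero] at h2
  have h3 : 9 / (40 * R ^ 2) * cubeCost p (fun x => T ((), x)) ≤ cubeEntropy g p + ε := by
    linarith
  have hR2 : 0 < R ^ 2 := by positivity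
  rw [div_mul_eq_mul_div, div_le_iff₀ (by positivity)] at h3
  linarith

section Coupling

variable {X : Type*} [MeasurableSpace X]

/-- A measure on the product whose marginals are dominated by `μ` and `ν` extends to a coupling, by
a product of the defects. -/
theorem exists_coupling_of_map_le {μ ν : Measure X} [IsProbabilityMeasure μ]
    [IsProbabilityMeasure ν] {γ : Measure (X × X)} [IsFiniteMeasure γ]
    (h₁ : γ.map Prod.fst ≤ μ) (h₂ : γ.map Prod.snd ≤ ν) {A : Set X}
    (hμ : ∀ᵐ x ∂μ, x ∈ A) (hν : ∀ᵐ x ∂ν, x ∈ A) {c : X × X → ℝ≥0∞} {C : ℝ≥0∞}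
    (hc : ∀ x ∈ A, ∀ y ∈ A, c (x, y) ≤ C) :
    ∃ γ' : Measure (X × X), γ'.map Prod.fst = μ ∧ γ'.map Prod.snd = ν ∧
      ∫⁻ p, c p ∂γ' ≤ ∫⁻ p, c p ∂γ + C * (1 - γ univ) := by
  have hu₁ : γ.map Prod.fst univ = γ univ := Measure.map_apply measurable_fst .univ
  have hu₂ : γ.map Prod.snd univ = γ univ := Measure.map_apply measurable_snd .univ
  have hle : γ univ ≤ 1 := by
    rw [← hu₁, ← measure_univ (μ := μ)]; exact h₁ univ
  set m := 1 - γ univ with hm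
  have hmtop : m ≠ ∞ := ne_top_of_le_ne_top ENNReal.one_ne_top tsub_le_self
  by_cases hm0 : m = 0
  · have hγ1 : γ univ = 1 := le_antisymm hle (tsub_eq_zero_iff_le.1 hm0)
    refine ⟨γ, ?_, ?_, by simp [hm0]⟩
    · exact Measure.eq_of_le_of_measure_univ_eq h₁ (by rw [hu₁, hγ1, measure_univ])
    · exact Measure.eq_of_le_of_measure_univ_eq h₂ (by rw [hu₂, hγ1, measure_univ])
  set μ₁ := μ - γ.map Prod.fst with hμ₁
  set ν₁ := ν - γ.map Prod.snd with hν₁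
  have hμ₁u : μ₁ univ = m := by
    rw [hμ₁, Measure.sub_apply .univ h₁, hu₁, measure_univ]
  have hν₁u : ν₁ univ = m := by
    rw [hν₁, Measure.sub_apply .univ h₂, hu₂, measure_univ]
  have : IsFiniteMeasure μ₁ := ⟨by rw [hμ₁u]; exact hmtop.lt_top⟩
  have : IsFiniteMeasure ν₁ := ⟨by rw [hν₁u]; exact hmtop.lt_top⟩
  have hmm : m⁻¹ * m = 1 := ENNReal.inv_mul_cancel hm0 hmtop
  refine ⟨γ + m⁻¹ • μ₁.prod ν₁, ?_, ?_, ?_⟩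
  · rw [Measure.map_add _ _ measurable_fst, Measure.map_smul, Measure.map_fst_prod, hν₁u,
      smul_smul, hmm, one_smul, add_comm]
    exact Measure.sub_add_cancel_of_le h₁
  · rw [Measure.map_add _ _ measurable_snd, Measure.map_smul, Measure.map_snd_prod, hμ₁u,
      smul_smul, hmm, one_smul, add_comm]
    exact Measure.sub_add_cancel_of_le h₂
  · rw [lintegral_add_measure, lintegral_smul_measure]
    gcongr
    have hae : ∀ᵐ p ∂μ₁.prod ν₁, c p ≤ C := by
      have h3 : ∀ᵐ x ∂μ₁, x ∈ A := Measure.sub_le.absolutelyContinuous.ae_le hμ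
      have h4 : ∀ᵐ x ∂ν₁, x ∈ A := Measure.sub_le.absolutelyContinuous.ae_le hν
      filter_upwards [Measure.quasiMeasurePreserving_fst.ae h3,
        Measure.quasiMeasurePreserving_snd.ae h4] with p hp1 hp2
      exact hc _ hp1 _ hp2
    calc m⁻¹ • ∫⁻ p, c p ∂μ₁.prod ν₁ ≤ m⁻¹ * ∫⁻ _p, C ∂μ₁.prod ν₁ := by
          rw [smul_eq_mul]
          gcongr m⁻¹ * ?_
          exact lintegral_mono_ae hae
      _ = m⁻¹ * m * (C * m) := by
          rw [lintegral_const, ← univ_prod_univ, Measure.prod_prod, hμ₁u, hν₁u]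
          ring
      _ = C * m := by rw [hmm, one_mul]

/-- A coupling of `P' λ` and `Q' λ` yields a coupling of `μ` and `ν` that costs little more, when
`P'` and `Q'` share most of their mass with `μ` and `ν`. The shared mass is bounded below by `P₀ λ`
and `Q₀ λ`. -/
theorem exists_coupling_of_common_mass {μ ν lam : Measure X} [IsProbabilityMeasure μ]
    [IsProbabilityMeasure ν] {γ : Measure (X × X)} [IsProbabilityMeasure γ]
    {P₀ Q₀ P' Q' : X → ℝ≥0∞} (hP₀ : Measurable P₀) (hQ₀ : Measurable Q₀) (hP' : Measurable P')
    (hQ' : Measurable Q') (hP'0 : ∀ x, P' x ≠ 0) (hP't : ∀ x, P' x ≠ ∞) (hQ'0 : ∀ x, Q' x ≠ 0)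
    (hQ't : ∀ x, Q' x ≠ ∞) (hP : ∀ x, P₀ x ≤ P' x) (hQ : ∀ x, Q₀ x ≤ Q' x)
    (h₁ : γ.map Prod.fst = lam.withDensity P') (h₂ : γ.map Prod.snd = lam.withDensity Q')
    (hμP : lam.withDensity P₀ ≤ μ) (hνQ : lam.withDensity Q₀ ≤ ν) {A : Set X}
    (hμ : ∀ᵐ x ∂μ, x ∈ A) (hν : ∀ᵐ x ∂ν, x ∈ A) {c : X × X → ℝ≥0∞} {C : ℝ≥0∞}
    (hc : ∀ x ∈ A, ∀ y ∈ A, c (x, y) ≤ C) :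
    ∃ γ' : Measure (X × X), γ'.map Prod.fst = μ ∧ γ'.map Prod.snd = ν ∧
      ∫⁻ p, c p ∂γ' ≤ ∫⁻ p, c p ∂γ + C * ((1 - ∫⁻ x, P₀ x ∂lam) + (1 - ∫⁻ x, Q₀ x ∂lam)) := by
  -- reweighting `γ` by `w` and `v` makes its marginals at most `P₀ λ` and `Q₀ λ`
  set w : X → ℝ≥0∞ := fun x => P₀ x / P' x with hw
  set v : X → ℝ≥0∞ := fun x => Q₀ x / Q' x with hv
  have hwm : Measurable w := hP₀.div hP'
  have hvm : Measurable v := hQ₀.div hQ'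
  have hw1 : ∀ x, w x ≤ 1 := fun x => ENNReal.div_le_of_le_mul (by rw [one_mul]; exact hP x)
  have hv1 : ∀ x, v x ≤ 1 := fun x => ENNReal.div_le_of_le_mul (by rw [one_mul]; exact hQ x)
  have hwP : lam.withDensity P₀ = (lam.withDensity P').withDensity w := by
    rw [← withDensity_mul _ hP' hwm]
    congr 1; ext x
    exact (ENNReal.mul_div_cancel (hP'0 x) (hP't x)).symm
  have hvQ : lam.withDensity Q₀ = (lam.withDensity Q').withDensity v := by
    rw [← withDensity_mul _ hQ' hvm]
    congr 1; ext x
    exact (ENNReal.mul_div_cancel (hQ'0 x) (hQ't x)).symm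
  set k : X × X → ℝ≥0∞ := fun p => w p.1 * v p.2 with hk
  have hkm : Measurable k := (hwm.comp measurable_fst).mul (hvm.comp measurable_snd)
  have hk1 : ∀ p, k p ≤ 1 := fun p => mul_le_one' (hw1 _) (hv1 _)
  set γ₀ := γ.withDensity k with hγ₀
  have hγ₀le : γ₀ ≤ γ := by
    calc γ₀ ≤ γ.withDensity 1 := withDensity_mono (.of_forall hk1)
      _ = γ := withDensity_one
  have : IsFiniteMeasure γ₀ := isFiniteMeasure_of_le γ hγ₀le
  have hm₁ : γ₀.map Prod.fst ≤ μ := by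
    refine le_trans (Measure.le_iff.2 fun s hs => ?_) (hwP ▸ hμP)
    rw [Measure.map_apply measurable_fst hs, withDensity_apply _ (measurable_fst hs),
      withDensity_apply _ hs, ← h₁, setLIntegral_map hs hwm measurable_fst]
    exact lintegral_mono fun p => mul_le_of_le_one_right' (hv1 _)
  have hm₂ : γ₀.map Prod.snd ≤ ν := by
    refine le_trans (Measure.le_iff.2 fun s hs => ?_) (hvQ ▸ hνQ)
    rw [Measure.map_apply measurable_snd hs, withDensity_apply _ (measurable_snd hs),
      withDensity_apply _ hs, ← h₂, setLIntegral_map hs hvm measurable_snd]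
    exact lintegral_mono fun p => mul_le_of_le_one_left' (hw1 _)
  obtain ⟨γ', h3, h4, h5⟩ := exists_coupling_of_map_le hm₁ hm₂ hμ hν hc
  refine ⟨γ', h3, h4, h5.trans ?_⟩
  gcongr
  · -- `w + v ≤ 1 + w v` on `[0, 1]`
    have e1 : ∫⁻ x, P₀ x ∂lam = ∫⁻ p, w p.1 ∂γ := by
      rw [← lintegral_map hwm measurable_fst, h₁, ← setLIntegral_univ, ← withDensity_apply _ .univ,
        hwP, withDensity_apply _ .univ, setLIntegral_univ]
    have e2 : ∫⁻ x, Q₀ x ∂lam = ∫⁻ p, v p.2 ∂γ := by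
      rw [← lintegral_map hvm measurable_snd, h₂, ← setLIntegral_univ, ← withDensity_apply _ .univ,
        hvQ, withDensity_apply _ .univ, setLIntegral_univ]
    have e3 : γ₀ univ = ∫⁻ p, k p ∂γ := by
      rw [hγ₀, withDensity_apply _ .univ, setLIntegral_univ]
    have e4 : ∫⁻ x, P₀ x ∂lam + ∫⁻ x, Q₀ x ∂lam ≤ 1 + γ₀ univ := by
      rw [e1, e2, e3, ← lintegral_add_left (f := fun p : X × X => w p.1)
        (hwm.comp measurable_fst)]
      calc ∫⁻ p, (w p.1 + v p.2) ∂γ ≤ ∫⁻ p, (1 + k p) ∂γ := by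
            refine lintegral_mono fun p => ?_
            have hx := hw1 p.1
            have hy := hv1 p.2
            simp only [hk]
            generalize w p.1 = x at *
            generalize v p.2 = y at *
            lift x to NNReal using ne_top_of_le_ne_top ENNReal.one_ne_top hx
            lift y to NNReal using ne_top_of_le_ne_top ENNReal.one_ne_top hy
            norm_cast at *
            rw [← NNReal.coe_le_coe] at *
            push_cast at *
            nlinarith
        _ = _ := by rw [lintegral_add_left measurable_const]; simp
    have e5 : ∫⁻ x, P₀ x ∂lam ≤ 1 := by
      rw [e1]
      calc _ ≤ ∫⁻ _p, 1 ∂γ := lintegral_mono fun p => hw1 _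
        _ = 1 := by simp
    have e6 : ∫⁻ x, Q₀ x ∂lam ≤ 1 := by
      rw [e2]
      calc _ ≤ ∫⁻ _p, 1 ∂γ := lintegral_mono fun p => hv1 _
        _ = 1 := by simp
    have e7 : γ₀ univ ≤ 1 := (hγ₀le univ).trans_eq measure_univ
    generalize ∫⁻ x, P₀ x ∂lam = x at *
    generalize ∫⁻ x, Q₀ x ∂lam = y at *
    generalize γ₀ univ = z at *
    lift x to NNReal using ne_top_of_le_ne_top ENNReal.one_ne_top e5
    lift y to NNReal using ne_top_of_le_ne_top ENNReal.one_ne_top e6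
    lift z to NNReal using ne_top_of_le_ne_top ENNReal.one_ne_top e7
    norm_cast at *
    rw [← NNReal.coe_le_coe] at *
    rw [NNReal.coe_add, NNReal.coe_sub e7, NNReal.coe_sub e5, NNReal.coe_sub e6]
    push_cast at *
    linarith

end Coupling

/-! ### Truncation of the target density -/

/-- The domination of `r log r` by a function of `ρ`, when `r` is a truncation of `ρ`. -/
theorem abs_mul_log_le {r ρ : ℝ} (hr : 0 < r) (hρ : 0 ≤ ρ) (h : r ≤ ρ + 1) :
    |r * Real.log r| ≤ 2 + 2 * ρ + 2 * |ρ * Real.log ρ| := by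
  have h0 := abs_nonneg (ρ * Real.log ρ)
  rcases le_or_gt r 1 with h1 | h1
  · have := Real.abs_log_mul_self_lt r hr h1
    rw [mul_comm] at this
    linarith
  have hlog := Real.log_pos h1
  rw [abs_of_pos (mul_pos hr hlog)]
  have h2 : r * Real.log r ≤ (ρ + 1) * Real.log (ρ + 1) := by gcongr
  refine h2.trans ?_
  have hl2 : Real.log 2 ≤ 1 := by linarith [Real.log_two_lt_d9]
  rcases le_or_gt ρ 1 with h3 | h3
  · have h4 : Real.log (ρ + 1) ≤ Real.log 2 := Real.log_le_log (by linarith) (by linarith)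
    have h5 : 0 ≤ Real.log (ρ + 1) := Real.log_nonneg (by linarith)
    nlinarith
  · have h4 : Real.log (ρ + 1) ≤ Real.log 2 + Real.log ρ := by
      rw [← Real.log_mul (by norm_num) (by linarith)]
      exact Real.log_le_log (by linarith) (by linarith)
    have h5 := Real.log_pos h3
    have h6 := le_abs_self (ρ * Real.log ρ)
    calc (ρ + 1) * Real.log (ρ + 1) ≤ (2 * ρ) * (1 + Real.log ρ) := by
          gcongr
          · exact Real.log_nonneg (by linarith)
          · linarith
          · linarith
      _ ≤ _ := by nlinarith

section Truncation

variable {X : Type*} {ρ q : X → ℝ}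

/-- The density `ρ` cut off from above and shifted away from `0`, not normalized. -/
noncomputable def truncation (ρ : X → ℝ) (k : ℕ) (x : X) : ℝ :=
  min (ρ x) (k + 1) + 1 / ((k : ℝ) + 1)

theorem truncation_pos (h0 : ∀ x, 0 ≤ ρ x) (k : ℕ) (x : X) : 0 < truncation ρ k x :=
  add_pos_of_nonneg_of_pos (le_min (h0 x) (by positivity)) (by positivity)

theorem truncation_le (k : ℕ) (x : X) : truncation ρ k x ≤ ρ x + 1 := by
  refine add_le_add (min_le_left _ _) ?_
  rw [div_le_one (by positivity)]
  linarith [k.cast_nonneg (α := ℝ)]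

theorem hasBoundedRatio_truncation (h0 : ∀ x, 0 ≤ ρ x) (k : ℕ) :
    HasBoundedRatio (((k : ℝ) + 2) * (k + 1)) (truncation ρ k) := by
  refine ⟨truncation_pos h0 k, fun x y => ?_⟩
  have h1 : truncation ρ k x ≤ k + 2 := by
    have : (1 : ℝ) / (k + 1) ≤ 1 := by
      rw [div_le_one (by positivity)]
      linarith [k.cast_nonneg (α := ℝ)]
    have := min_le_right (ρ x) ((k : ℝ) + 1)
    unfold truncation
    linarith
  have h2 : 1 / ((k : ℝ) + 1) ≤ truncation ρ k y :=
    le_add_of_nonneg_left (le_min (h0 y) (by positivity))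
  rw [div_le_iff₀ (by positivity)] at h2
  calc _ ≤ ((k : ℝ) + 2) * 1 := by linarith
    _ ≤ ((k : ℝ) + 2) * (truncation ρ k y * (k + 1)) := by gcongr
    _ = _ := by ring

theorem tendsto_truncation (ρ : X → ℝ) (x : X) :
    Tendsto (fun k => truncation ρ k x) atTop (𝓝 (ρ x)) := by
  have h1 : Tendsto (fun k : ℕ => min (ρ x) ((k : ℝ) + 1)) atTop (𝓝 (ρ x)) := by
    refine tendsto_const_nhds.congr' ?_
    filter_upwards [eventually_ge_atTop ⌈ρ x⌉₊] with k hk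
    rw [min_eq_left]
    have := (Nat.le_ceil (ρ x)).trans (Nat.cast_le.2 hk)
    linarith
  have h := h1.add tendsto_one_div_add_atTop_nhds_zero_nat
  rwa [add_zero] at h

variable [MeasurableSpace X] {lam : Measure X}

theorem measurable_truncation (hm : Measurable ρ) (k : ℕ) : Measurable (truncation ρ k) :=
  (hm.min measurable_const).add measurable_const

theorem tendsto_integral_min (hm : AEStronglyMeasurable ρ lam) (h0 : ∀ᵐ x ∂lam, 0 ≤ ρ x)
    (hi : Integrable ρ lam) {r : ℕ → X → ℝ} (hr : ∀ k, AEStronglyMeasurable (r k) lam)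
    (hr0 : ∀ k, ∀ᵐ x ∂lam, 0 ≤ r k x)
    (hlim : ∀ᵐ x ∂lam, Tendsto (fun k => r k x) atTop (𝓝 (ρ x))) :
    Tendsto (fun k => ∫ x, min (ρ x) (r k x) ∂lam) atTop (𝓝 (∫ x, ρ x ∂lam)) := by
  refine tendsto_integral_of_dominated_convergence ρ (fun k => ?_) hi (fun k => ?_) ?_
  · exact hm.inf (hr k)
  · filter_upwards [h0, hr0 k] with x hx hx'
    rw [Real.norm_of_nonneg (le_min hx hx')]
    exact min_le_left _ _
  · filter_upwards [hlim] with x hx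
    simpa using (tendsto_const_nhds (x := ρ x)).min hx

variable [IsProbabilityMeasure lam]

theorem integrable_truncation (hm : Measurable ρ) (h0 : ∀ x, 0 ≤ ρ x) (k : ℕ) :
    Integrable (truncation ρ k) lam := by
  have : Nonempty X := nonempty_of_isProbabilityMeasure lam
  exact (hasBoundedRatio_truncation h0 k).integrable (measurable_truncation hm k)

theorem tendsto_integral_truncation (hm : Measurable ρ) (h0 : ∀ x, 0 ≤ ρ x)
    (hi : Integrable ρ lam) :
    Tendsto (fun k => ∫ x, truncation ρ k x ∂lam) atTop (𝓝 (∫ x, ρ x ∂lam)) := by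
  refine tendsto_integral_of_dominated_convergence (fun x => ρ x + 1)
    (fun k => (measurable_truncation hm k).aestronglyMeasurable) (hi.add (integrable_const 1))
    (fun k => .of_forall fun x => ?_) (.of_forall fun x => tendsto_truncation ρ x)
  rw [Real.norm_of_nonneg (truncation_pos h0 k x).le]
  exact truncation_le k x

theorem tendsto_integral_truncation_mul_log (hm : Measurable ρ) (h0 : ∀ x, 0 ≤ ρ x)
    (hi : Integrable ρ lam) (hlog : Integrable (fun x => ρ x * Real.log (ρ x)) lam)
    (hq : Measurable q) {C : ℝ} (hC : ∀ x, |Real.log (q x)| ≤ C) :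
    Tendsto (fun k => ∫ x, truncation ρ k x * (Real.log (truncation ρ k x) - Real.log (q x)) ∂lam)
      atTop (𝓝 (∫ x, ρ x * (Real.log (ρ x) - Real.log (q x)) ∂lam)) := by
  refine tendsto_integral_of_dominated_convergence
    (fun x => (2 + 2 * ρ x + 2 * |ρ x * Real.log (ρ x)|) + (ρ x + 1) * C)
    (fun k => ?_) ?_ (fun k => .of_forall fun x => ?_) (.of_forall fun x => ?_)
  · exact ((measurable_truncation hm k).mul ((measurable_truncation hm k).log.sub
      hq.log)).aestronglyMeasurable
  · exact (((integrable_const 2).add (hi.const_mul 2)).add (hlog.abs.const_mul 2)).add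
      ((hi.add (integrable_const 1)).mul_const C)
  · have h1 := abs_mul_log_le (truncation_pos h0 k x) (h0 x) (truncation_le k x)
    have h2 : |truncation ρ k x * Real.log (q x)| ≤ (ρ x + 1) * C := by
      rw [abs_mul, abs_of_pos (truncation_pos h0 k x)]
      exact mul_le_mul (truncation_le k x) (hC x) (abs_nonneg _) (by linarith [h0 x])
    rw [mul_sub]
    exact (abs_sub _ _).trans (add_le_add h1 h2)
  · simp only [mul_sub]
    have h1 := tendsto_truncation ρ x
    exact ((Real.continuous_mul_log.tendsto (ρ x)).comp h1).sub (h1.mul_const _)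

/-- Every density with finite entropy is a limit, in total variation and in relative entropy, of
densities of bounded ratio. -/
theorem exists_hasBoundedRatio_approx (hm : Measurable ρ) (h0 : ∀ x, 0 ≤ ρ x)
    (hi : Integrable ρ lam) (h1 : ∫ x, ρ x ∂lam = 1)
    (hlog : Integrable (fun x => ρ x * Real.log (ρ x)) lam)
    (hq : Measurable q) {C : ℝ} (hC : ∀ x, |Real.log (q x)| ≤ C) {ε : ℝ} (hε : 0 < ε) :
    ∃ (g : X → ℝ) (β : ℝ), Measurable g ∧ HasBoundedRatio β g ∧ ∫ x, g x ∂lam = 1 ∧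
      1 - ε < ∫ x, min (ρ x) (g x) ∂lam ∧
      ∫ x, g x * (Real.log (g x) - Real.log (q x)) ∂lam <
        ∫ x, ρ x * (Real.log (ρ x) - Real.log (q x)) ∂lam + ε := by
  have : Nonempty X := nonempty_of_isProbabilityMeasure lam
  set Z : ℕ → ℝ := fun k => ∫ x, truncation ρ k x ∂lam with hZ
  have hZpos : ∀ k, 0 < Z k := fun k =>
    (hasBoundedRatio_truncation h0 k).integral_pos (measurable_truncation hm k)
  have hZlim : Tendsto Z atTop (𝓝 1) := h1 ▸ tendsto_integral_truncation hm h0 hi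
  set g : ℕ → X → ℝ := fun k x => truncation ρ k x / Z k with hg
  have hgr : ∀ k : ℕ, HasBoundedRatio (((k : ℝ) + 2) * (k + 1)) (g k) := fun k =>
    (hasBoundedRatio_truncation h0 k).div_const (hZpos k)
  have hgm : ∀ k, Measurable (g k) := fun k => (measurable_truncation hm k).div_const _
  have hglim : ∀ x, Tendsto (fun k => g k x) atTop (𝓝 (ρ x)) := fun x => by
    have h := (tendsto_truncation ρ x).div hZlim one_ne_zero
    rwa [div_one] at h
  have hmin := tendsto_integral_min hm.aestronglyMeasurable (.of_forall h0) hi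
    (fun k => (hgm k).aestronglyMeasurable) (fun k => .of_forall fun x => ((hgr k).1 x).le)
    (.of_forall hglim)
  have hent : ∀ k, ∫ x, g k x * (Real.log (g k x) - Real.log (q x)) ∂lam =
      (Z k)⁻¹ * ∫ x, truncation ρ k x * (Real.log (truncation ρ k x) - Real.log (q x)) ∂lam
        - Real.log (Z k) := by
    intro k
    have hti := integrable_truncation (lam := lam) hm h0 k
    obtain ⟨C', hC'⟩ := (hasBoundedRatio_truncation h0 k).exists_abs_log_le
    have hi' : Integrable (fun x => truncation ρ k x *
        (Real.log (truncation ρ k x) - Real.log (q x))) lam := by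
      refine hti.mul_bdd (c := C' + C)
        ((measurable_truncation hm k).log.sub hq.log).aestronglyMeasurable (.of_forall fun x => ?_)
      exact (abs_sub _ _).trans (add_le_add (hC' x) (hC x))
    have e1 : ∀ x, g k x * (Real.log (g k x) - Real.log (q x)) =
        (Z k)⁻¹ * (truncation ρ k x * (Real.log (truncation ρ k x) - Real.log (q x))) -
          (Z k)⁻¹ * Real.log (Z k) * truncation ρ k x := by
      intro x
      simp only [hg]
      rw [Real.log_div (truncation_pos h0 k x).ne' (hZpos k).ne']
      ring
    rw [integral_congr_ae (.of_forall e1), integral_sub (hi'.const_mul _) (hti.const_mul _),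
      integral_const_mul, integral_const_mul]
    congr 1
    change (Z k)⁻¹ * Real.log (Z k) * Z k = _
    have := (hZpos k).ne'
    field_simp
  have hentlim : Tendsto (fun k => ∫ x, g k x * (Real.log (g k x) - Real.log (q x)) ∂lam) atTop
      (𝓝 (∫ x, ρ x * (Real.log (ρ x) - Real.log (q x)) ∂lam)) := by
    simp only [hent]
    have := ((hZlim.inv₀ one_ne_zero).mul
      (tendsto_integral_truncation_mul_log hm h0 hi hlog hq hC)).sub
      (hZlim.log one_ne_zero)
    simpa using this
  have ev1 := hmin.eventually (lt_mem_nhds (show 1 - ε < ∫ x, ρ x ∂lam by rw [h1]; linarith))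
  have ev2 := hentlim.eventually (gt_mem_nhds (lt_add_of_pos_right _ hε))
  obtain ⟨k, hk1, hk2⟩ := (ev1.and ev2).exists
  refine ⟨g k, _, hgm k, hgr k, ?_, hk1, hk2⟩
  rw [integral_div]
  exact div_self (hZpos k).ne'

end Truncation

/-! ### The transport inequality on the open unit cube -/

theorem HasBoundedRatio.mono {α : Type*} {β β' : ℝ} {f : α → ℝ} (h : HasBoundedRatio β f)
    (hβ : β ≤ β') : HasBoundedRatio β' f :=
  ⟨h.1, fun x y => (h.2 x y).trans (mul_le_mul_of_nonneg_right hβ (h.1 y).le)⟩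

theorem IsLogConcaveUnit.div_const {n : ℕ} {f : (Fin n → ℝ) → ℝ} (hf : IsLogConcaveUnit f) {c : ℝ}
    (hc : 0 < c) : IsLogConcaveUnit fun x => f x / c := by
  refine ⟨fun x hx => div_nonneg (hf.1 x hx) hc.le, fun x hx y hy t h0 h1 => ?_⟩
  rw [Real.div_rpow (hf.1 x hx) hc.le, Real.div_rpow (hf.1 y hy) hc.le, div_mul_div_comm,
    ← Real.rpow_add hc, add_sub_cancel, Real.rpow_one]
  exact div_le_div_of_nonneg_right (hf.2 x hx y hy t h0 h1) hc.le

theorem IsCoordApproxConvexUnit.div_const {n : ℕ} {R : ℝ} {f : (Fin n → ℝ) → ℝ}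
    (hf : IsCoordApproxConvexUnit R f) {c : ℝ} (hc : 0 < c) :
    IsCoordApproxConvexUnit R fun x => f x / c := by
  intro i x hx y hy hxy t h0 h1
  calc f (t • x + (1 - t) • y) / c ≤ R * (t * f x + (1 - t) * f y) / c :=
        div_le_div_of_nonneg_right (hf i x hx y hy hxy t h0 h1) hc.le
    _ = R * (t * (f x / c) + (1 - t) * (f y / c)) := by ring

theorem IsLogConcaveUnit.congr {n : ℕ} {f g : (Fin n → ℝ) → ℝ} (hf : IsLogConcaveUnit f)
    (h : EqOn g f (openCube n)) : IsLogConcaveUnit g := by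
  refine ⟨fun x hx => (h hx).symm ▸ hf.1 x hx, fun x hx y hy t h0 h1 => ?_⟩
  rw [h hx, h hy, h (add_mem_openCube hx hy h0 h1)]
  exact hf.2 x hx y hy t h0 h1

theorem IsCoordApproxConvexUnit.congr {n : ℕ} {R : ℝ} {f g : (Fin n → ℝ) → ℝ}
    (hf : IsCoordApproxConvexUnit R f) (h : EqOn g f (openCube n)) :
    IsCoordApproxConvexUnit R g := by
  intro i x hx y hy hxy t h0 h1
  rw [h hx, h hy, h (add_mem_openCube hx hy h0 h1)]
  exact hf i x hx y hy hxy t h0 h1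

section

variable {n : ℕ} {R : ℝ} {f : (Fin n → ℝ) → ℝ}

theorem ae_nonneg_of_isLogConcaveUnit (hf : IsLogConcaveUnit f) : 0 ≤ᵐ[cubeMeasure n] f := by
  filter_upwards [ae_mem_openCube n] with x hx using hf.1 x hx

theorem integrable_of_lintegral_eq_one (hf : IsLogConcaveUnit f)
    (hm : AEMeasurable f (cubeMeasure n))
    (h1 : ∫⁻ x, ENNReal.ofReal (f x) ∂cubeMeasure n = 1) : Integrable f (cubeMeasure n) := by
  refine ⟨hm.aestronglyMeasurable, ?_⟩
  rw [hasFiniteIntegral_iff_ofReal (ae_nonneg_of_isLogConcaveUnit hf), h1]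
  exact ENNReal.one_lt_top

theorem integral_eq_one_of_lintegral_eq_one (hf : IsLogConcaveUnit f)
    (hm : AEMeasurable f (cubeMeasure n))
    (h1 : ∫⁻ x, ENNReal.ofReal (f x) ∂cubeMeasure n = 1) : ∫ x, f x ∂cubeMeasure n = 1 := by
  rw [integral_eq_lintegral_of_nonneg_ae (ae_nonneg_of_isLogConcaveUnit hf)
    hm.aestronglyMeasurable, h1, ENNReal.toReal_one]

/-- The normalized log-Lipschitz hulls approximate `f` in total variation, and they are not much
smaller than `f`, so that passing to them increases relative entropies by little. -/
theorem IsLogConcaveUnit.exists_hasBoundedRatio_approx (hf : IsLogConcaveUnit f)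
    (hm : AEMeasurable f (cubeMeasure n)) (hR : 1 ≤ R) (hc : IsCoordApproxConvexUnit R f)
    (h1 : ∫⁻ x, ENNReal.ofReal (f x) ∂cubeMeasure n = 1) {ε : ℝ} (hε : 0 < ε) :
    ∃ (p : (Fin n → ℝ) → ℝ) (β : ℝ), Measurable p ∧ HasBoundedRatio β p ∧
      ∫ x, p x ∂cubeMeasure n = 1 ∧ IsLogConcaveUnit p ∧ IsCoordApproxConvexUnit R p ∧
      1 - ε < ∫ x, min (f x) (p x) ∂cubeMeasure n ∧
      ∀ x ∈ openCube n, 0 < f x → Real.log (f x) - Real.log (p x) ≤ ε := by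
  classical
  obtain ⟨M, hM⟩ := hf.exists_le hm (by simp [h1]) (by simp [h1])
  have hfi := integrable_of_lintegral_eq_one hf hm h1
  have hf1 := integral_eq_one_of_lintegral_eq_one hf hm h1
  obtain ⟨y₀, hy₀, hfy₀⟩ : ∃ y ∈ openCube n, 0 < f y := by
    by_contra! hcon
    have : ∫ x, f x ∂cubeMeasure n ≤ 0 := by
      refine integral_nonpos_of_ae ?_
      filter_upwards [ae_mem_openCube n] with x hx using hcon x hx
    linarith
  have hN : ∀ N : ℕ, (0 : ℝ) ≤ N := fun N => N.cast_nonneg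
  -- the hull is redefined off the cube, where its ratio is not under control
  set h : ℕ → (Fin n → ℝ) → ℝ := fun N x =>
    if x ∈ openCube n then logLipschitzHull N f x else logLipschitzHull N f y₀ with hh
  have hin : ∀ N, EqOn (h N) (logLipschitzHull N f) (openCube n) := fun N x hx => if_pos hx
  have hmeas : ∀ N, Measurable (h N) := fun N =>
    Measurable.ite (measurableSet_openCube n) (logLipschitzHull.measurable (hN N) hf.1 hM)
      measurable_const
  have hratio : ∀ N : ℕ, HasBoundedRatio (Real.exp (N * n)) (h N) := by
    intro N
    have key : ∀ x, ∃ x' ∈ openCube n, h N x = logLipschitzHull N f x' := by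
      intro x
      by_cases hx : x ∈ openCube n
      · exact ⟨x, hx, if_pos hx⟩
      · exact ⟨y₀, hy₀, if_neg hx⟩
    refine ⟨fun x => ?_, fun x y => ?_⟩
    · obtain ⟨x', -, e⟩ := key x
      rw [e]
      exact logLipschitzHull.pos (hN N) hf.1 hM hy₀ hfy₀ x'
    · obtain ⟨x', hx', e⟩ := key x
      obtain ⟨y', hy', e'⟩ := key y
      rw [e, e']
      exact logLipschitzHull.le_exp_mul (hN N) hf.1 hM hx' hy'
  have hlim : ∀ᵐ x ∂cubeMeasure n, Tendsto (fun N => h N x) atTop (𝓝 (f x)) := by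
    filter_upwards [ae_mem_openCube n, hf.ae_continuousAt] with x hx hcx
    simp only [hin _ hx]
    exact logLipschitzHull.tendsto hf.1 hM hx hcx
  set Z : ℕ → ℝ := fun N => ∫ x, h N x ∂cubeMeasure n with hZ
  have hZpos : ∀ N, 0 < Z N := fun N => (hratio N).integral_pos (hmeas N)
  have hZlim : Tendsto Z atTop (𝓝 1) := by
    rw [← hf1]
    refine tendsto_integral_of_dominated_convergence (fun _ => M)
      (fun N => (hmeas N).aestronglyMeasurable) (integrable_const M) (fun N => ?_) hlim
    filter_upwards [ae_mem_openCube n] with x hx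
    rw [Real.norm_of_nonneg ((hratio N).1 x).le, hin N hx]
    exact logLipschitzHull.le_bound (hN N) hf.1 hM x
  have hplim : ∀ᵐ x ∂cubeMeasure n, Tendsto (fun N => h N x / Z N) atTop (𝓝 (f x)) := by
    filter_upwards [hlim] with x hx
    have h := hx.div hZlim one_ne_zero
    rwa [div_one] at h
  have hmin := tendsto_integral_min hm.aestronglyMeasurable (ae_nonneg_of_isLogConcaveUnit hf) hfi
    (fun N => ((hmeas N).div_const (Z N)).aestronglyMeasurable)
    (fun N => .of_forall fun x => (div_pos ((hratio N).1 x) (hZpos N)).le) hplim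
  have hlogZ : Tendsto (fun N => Real.log (Z N)) atTop (𝓝 0) := by
    simpa using hZlim.log one_ne_zero
  have ev1 := hmin.eventually (lt_mem_nhds (show 1 - ε < ∫ x, f x ∂cubeMeasure n by
    rw [hf1]; linarith))
  obtain ⟨N, hN1, hN2⟩ := (ev1.and (hlogZ.eventually (gt_mem_nhds hε))).exists
  refine ⟨fun x => h N x / Z N, _, (hmeas N).div_const _, (hratio N).div_const (hZpos N), ?_,
    ((logLipschitzHull.isLogConcaveUnit (hN N) hf hM hy₀ hfy₀).congr (hin N)).div_const (hZpos N),
    ((logLipschitzHull.isCoordApproxConvexUnit (hN N) hf.1 hM hR hc).congr (hin N)).div_const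
      (hZpos N), hN1, fun x hx hfx => ?_⟩
  · rw [integral_div]
    exact div_self (hZpos N).ne'
  · rw [Real.log_div ((hratio N).1 x).ne' (hZpos N).ne', hin N hx]
    have := Real.log_le_log hfx (logLipschitzHull.self_le (hN N) hf.1 hM hx)
    linarith

theorem one_sub_lintegral_min_le {X : Type*} [MeasurableSpace X] {lam : Measure X} {u v : X → ℝ}
    (hu : Integrable u lam) (hv : Integrable v lam) (hu0 : 0 ≤ᵐ[lam] u) (hv0 : 0 ≤ᵐ[lam] v) {ε : ℝ}
    (h : 1 - ε < ∫ x, min (u x) (v x) ∂lam) :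
    1 - ∫⁻ x, ENNReal.ofReal (min (u x) (v x)) ∂lam ≤ ENNReal.ofReal ε := by
  rw [← ofReal_integral_eq_lintegral_ofReal (f := fun x => min (u x) (v x)) (hu.inf hv)
    (by filter_upwards [hu0, hv0] with x h1 h2 using le_min h1 h2), tsub_le_iff_right]
  calc (1 : ℝ≥0∞) = ENNReal.ofReal 1 := ENNReal.ofReal_one.symm
    _ ≤ ENNReal.ofReal (ε + ∫ x, min (u x) (v x) ∂lam) := by
        apply ENNReal.ofReal_le_ofReal; linarith
    _ ≤ _ := ENNReal.ofReal_add_le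

/-- The transport inequality on the open unit cube for a target of finite entropy, up to an
arbitrarily small error. -/
theorem exists_coupling_cube_le (hR : 1 ≤ R) (hf : IsLogConcaveUnit f)
    (hm : AEMeasurable f (cubeMeasure n)) (hc : IsCoordApproxConvexUnit R f)
    (h1 : ∫⁻ x, ENNReal.ofReal (f x) ∂cubeMeasure n = 1) {ρ : (Fin n → ℝ) → ℝ}
    (hρm : Measurable ρ) (hρ0 : ∀ x, 0 ≤ ρ x)
    (hρ1 : ∫⁻ x, ENNReal.ofReal (ρ x) ∂cubeMeasure n = 1)
    (hac : ∀ᵐ x ∂cubeMeasure n, 0 < ρ x → 0 < f x)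
    (hlog : Integrable (fun x => ρ x * (Real.log (ρ x) - Real.log (f x))) (cubeMeasure n))
    {ε : ℝ} (hε : 0 < ε) :
    ∃ γ : Measure ((Fin n → ℝ) × (Fin n → ℝ)),
      γ.map Prod.fst = (cubeMeasure n).withDensity (fun x => ENNReal.ofReal (f x)) ∧
      γ.map Prod.snd = (cubeMeasure n).withDensity (fun x => ENNReal.ofReal (ρ x)) ∧
      ∫⁻ p, ENNReal.ofReal (∑ i, (p.1 i - p.2 i) ^ 2) ∂γ ≤
        ENNReal.ofReal (40 / 9 * R ^ 2 * (cubeEntropy ρ f + 3 * ε)) +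
          n * (ENNReal.ofReal ε + ENNReal.ofReal ε) := by
  have hfi := integrable_of_lintegral_eq_one hf hm h1
  have hρi : Integrable ρ (cubeMeasure n) := by
    refine ⟨hρm.aestronglyMeasurable, ?_⟩
    rw [hasFiniteIntegral_iff_ofReal (.of_forall hρ0), hρ1]
    exact ENNReal.one_lt_top
  have hρ1' : ∫ x, ρ x ∂cubeMeasure n = 1 := by
    rw [integral_eq_lintegral_of_nonneg_ae (.of_forall hρ0) hρm.aestronglyMeasurable, hρ1,
      ENNReal.toReal_one]
  -- `ρ log ρ` is integrable, since `f` is bounded above and `ρ log ρ` is bounded below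
  have hρlog : Integrable (fun x => ρ x * Real.log (ρ x)) (cubeMeasure n) := by
    obtain ⟨M, hM⟩ := hf.exists_le hm (by simp [h1]) (by simp [h1])
    refine Integrable.mono' (((integrable_const 1).add hlog.abs).add
      (hρi.mul_const (|Real.log (max M 1)|))) (hρm.mul hρm.log).aestronglyMeasurable ?_
    filter_upwards [hac, ae_mem_openCube n] with x hx hxc
    change |ρ x * Real.log (ρ x)| ≤
      1 + |ρ x * (Real.log (ρ x) - Real.log (f x))| + ρ x * |Real.log (max M 1)|
    have e0 : 0 ≤ ρ x * |Real.log (max M 1)| := mul_nonneg (hρ0 x) (abs_nonneg _)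
    have e1 := abs_nonneg (ρ x * (Real.log (ρ x) - Real.log (f x)))
    rcases le_or_gt (ρ x) 1 with hle | hgt
    · rcases (hρ0 x).eq_or_lt with hz | hz
      · rw [← hz]; simp
      · have := Real.abs_log_mul_self_lt _ hz hle
        rw [mul_comm] at this
        linarith
    · have hfx := hx (by linarith)
      have hl : Real.log (f x) ≤ |Real.log (max M 1)| :=
        (Real.log_le_log hfx ((hM x hxc).trans (le_max_left _ _))).trans (le_abs_self _)
      rw [abs_of_nonneg (mul_nonneg (hρ0 x) (Real.log_pos hgt).le)]
      have e2 := le_abs_self (ρ x * (Real.log (ρ x) - Real.log (f x)))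
      have e3 := mul_le_mul_of_nonneg_left hl (hρ0 x)
      linarith
  obtain ⟨p, βp, hpm, hpr, hp1, hplog, hpc, hpmin, hpf⟩ :=
    hf.exists_hasBoundedRatio_approx hm hR hc h1 hε
  obtain ⟨C, hC⟩ := hpr.exists_abs_log_le
  obtain ⟨g, βg, hgm, hgr, hg1, hgmin, hgent⟩ :=
    exists_hasBoundedRatio_approx hρm hρ0 hρi hρ1' hρlog hpm hC hε
  have hent : ∫ x, ρ x * (Real.log (ρ x) - Real.log (p x)) ∂cubeMeasure n ≤
      cubeEntropy ρ f + ε := by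
    have hint : Integrable (fun x => ρ x * (Real.log (ρ x) - Real.log (p x))) (cubeMeasure n) := by
      simp only [mul_sub]
      exact hρlog.sub (hρi.mul_bdd hpm.log.aestronglyMeasurable (.of_forall hC))
    calc _ ≤ ∫ x, (ρ x * (Real.log (ρ x) - Real.log (f x)) + ρ x * ε) ∂cubeMeasure n := by
          refine integral_mono_ae hint (hlog.add (hρi.mul_const ε)) ?_
          filter_upwards [hac, ae_mem_openCube n] with x hx hxc
          rcases (hρ0 x).eq_or_lt with hz | hz
          · simp [← hz]
          · have := mul_le_mul_of_nonneg_left (hpf x hxc (hx hz)) hz.le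
            linarith
      _ = _ := by
          rw [integral_add hlog (hρi.mul_const ε), integral_mul_const, hρ1', one_mul, cubeEntropy]
  obtain ⟨T, hTm, hT01, hTmap, hTcost⟩ := exists_map_cubeCost_le (β := max βp βg) hR hpm hgm
    (hpr.mono (le_max_left _ _)) (hgr.mono (le_max_right _ _)) hp1 hg1 hplog hpc hε
  have hpd : IsProbabilityMeasure
      ((cubeMeasure n).withDensity fun x => ENNReal.ofReal (p x)) := by
    refine ⟨?_⟩
    rw [withDensity_apply _ .univ, setLIntegral_univ, ← ofReal_integral_eq_lintegral_ofReal (hpr.integrable hpm)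
      (.of_forall fun x => (hpr.1 x).le), hp1, ENNReal.ofReal_one]
  have hμ : IsProbabilityMeasure
      ((cubeMeasure n).withDensity fun x => ENNReal.ofReal (f x)) :=
    ⟨by rw [withDensity_apply _ .univ, setLIntegral_univ, h1]⟩
  have hν : IsProbabilityMeasure
      ((cubeMeasure n).withDensity fun x => ENNReal.ofReal (ρ x)) :=
    ⟨by rw [withDensity_apply _ .univ, setLIntegral_univ, hρ1]⟩
  have hidT : Measurable fun x => (x, T x) := measurable_id.prodMk hTm
  have hγ : IsProbabilityMeasure
      (((cubeMeasure n).withDensity fun x => ENNReal.ofReal (p x)).map fun x => (x, T x)) :=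
    Measure.isProbabilityMeasure_map hidT.aemeasurable
  have hcm : Measurable fun q : (Fin n → ℝ) × (Fin n → ℝ) =>
      ENNReal.ofReal (∑ i, (q.1 i - q.2 i) ^ 2) := by fun_prop
  have hcost : ∫⁻ q, ENNReal.ofReal (∑ i, (q.1 i - q.2 i) ^ 2)
      ∂((cubeMeasure n).withDensity fun x => ENNReal.ofReal (p x)).map (fun x => (x, T x)) ≤
        ENNReal.ofReal (40 / 9 * R ^ 2 * (cubeEntropy ρ f + 3 * ε)) := by
    rw [lintegral_map hcm hidT, lintegral_withDensity_ofReal hpm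
      (ψ := fun x => ENNReal.ofReal (∑ i, (x i - T x i) ^ 2)) (hcm.comp hidT)]
    simp only [← ENNReal.ofReal_mul (hpr.1 _).le]
    rw [← ofReal_integral_eq_lintegral_ofReal]
    · apply ENNReal.ofReal_le_ofReal
      have e : ∫ x, p x * ∑ i, (x i - T x i) ^ 2 ∂cubeMeasure n = cubeCost p T := by
        simp only [cubeCost, sub_sq_comm]
      rw [e]
      refine hTcost.trans ?_
      have : cubeEntropy g p < _ := hgent
      exact mul_le_mul_of_nonneg_left (by linarith) (by positivity)
    · simpa only [sub_sq_comm] using integrable_cubeCost hpr hpm hTm hT01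
    · exact .of_forall fun x => mul_nonneg (hpr.1 x).le (Finset.sum_nonneg fun i _ => sq_nonneg _)
  have hmk := hm.ae_eq_mk
  have hP₀ : ∫⁻ x, ENNReal.ofReal (min (hm.mk f x) (p x)) ∂cubeMeasure n =
      ∫⁻ x, ENNReal.ofReal (min (f x) (p x)) ∂cubeMeasure n := by
    refine lintegral_congr_ae ?_
    filter_upwards [hmk] with x hx
    rw [hx]
  obtain ⟨γ, hγ1, hγ2, hγ3⟩ := exists_coupling_of_common_mass (lam := cubeMeasure n)
    (μ := (cubeMeasure n).withDensity fun x => ENNReal.ofReal (f x))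
    (ν := (cubeMeasure n).withDensity fun x => ENNReal.ofReal (ρ x))
    (γ := ((cubeMeasure n).withDensity fun x => ENNReal.ofReal (p x)).map fun x => (x, T x))
    (P₀ := fun x => ENNReal.ofReal (min (hm.mk f x) (p x)))
    (Q₀ := fun x => ENNReal.ofReal (min (ρ x) (g x)))
    (P' := fun x => ENNReal.ofReal (p x)) (Q' := fun x => ENNReal.ofReal (g x))
    (A := openCube n) (C := n)
    (c := fun q => ENNReal.ofReal (∑ i, (q.1 i - q.2 i) ^ 2))
    (hm.measurable_mk.min hpm).ennreal_ofReal (hρm.min hgm).ennreal_ofReal hpm.ennreal_ofReal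
    hgm.ennreal_ofReal (fun x => (ENNReal.ofReal_pos.2 (hpr.1 x)).ne')
    (fun _ => ENNReal.ofReal_ne_top) (fun x => (ENNReal.ofReal_pos.2 (hgr.1 x)).ne')
    (fun _ => ENNReal.ofReal_ne_top)
    (fun _ => ENNReal.ofReal_le_ofReal (min_le_right _ _))
    (fun _ => ENNReal.ofReal_le_ofReal (min_le_right _ _))
    (by
      rw [Measure.map_map measurable_fst hidT]
      exact Measure.map_id)
    (by
      rw [Measure.map_map measurable_snd hidT]
      exact hTmap)
    (withDensity_mono (by
      filter_upwards [hmk] with x hx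
      rw [hx]
      exact ENNReal.ofReal_le_ofReal (min_le_left _ _)))
    (withDensity_mono (.of_forall fun x => ENNReal.ofReal_le_ofReal (min_le_left _ _)))
    ((withDensity_absolutelyContinuous _ _).ae_le (ae_mem_openCube n))
    ((withDensity_absolutelyContinuous _ _).ae_le (ae_mem_openCube n))
    (fun x hx y hy => by
      rw [← ENNReal.ofReal_natCast]
      apply ENNReal.ofReal_le_ofReal
      calc ∑ i, (x i - y i) ^ 2 ≤ ∑ _i : Fin n, (1 : ℝ) := by
            refine Finset.sum_le_sum fun i _ => ?_
            have h1 := hx i (mem_univ i)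
            have h2 := hy i (mem_univ i)
            rw [sq_le_one_iff_abs_le_one, abs_le]
            constructor <;> linarith [h1.1, h1.2, h2.1, h2.2]
        _ = n := by simp)
  refine ⟨γ, hγ1, hγ2, hγ3.trans ?_⟩
  gcongr
  · rw [hP₀]
    exact one_sub_lintegral_min_le hfi (hpr.integrable hpm) (ae_nonneg_of_isLogConcaveUnit hf)
      (.of_forall fun x => (hpr.1 x).le) hpmin
  · exact one_sub_lintegral_min_le hρi (hgr.integrable hgm) (.of_forall hρ0)
      (.of_forall fun x => (hgr.1 x).le) hgmin

end

/-! ### Reduction to the open unit cube -/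

theorem MeasureTheory.MeasurePreserving.map_withDensity_comp {α β : Type*} [MeasurableSpace α]
    [MeasurableSpace β] {μ : Measure α} {ν : Measure β} {e : α → β} (h : MeasurePreserving e μ ν)
    (he : MeasurableEmbedding e) (F : β → ℝ≥0∞) :
    (μ.withDensity fun x => F (e x)).map e = ν.withDensity F := by
  ext s hs
  rw [Measure.map_apply he.measurable hs, withDensity_apply _ (he.measurable hs),
    withDensity_apply _ hs, h.setLIntegral_comp_preimage_emb he]

/-- A unit cube and the translate of the open unit cube differ by a null set, so the faces of `Q` do
not matter. -/
theorem measurePreserving_cube {n : ℕ} {Q : Set (EuclideanSpace ℝ (Fin n))} {a : Fin n → ℝ}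
    {I : Fin n → Set ℝ} (hI : ∀ i, Ioo (a i) (a i + 1) ⊆ I i ∧ I i ⊆ Icc (a i) (a i + 1))
    (hQ : Q = {x | ∀ i, x i ∈ I i}) :
    MeasurePreserving (fun x : Fin n → ℝ => WithLp.toLp 2 (a + x)) (cubeMeasure n)
        (volume.restrict Q) ∧
      MeasurableEmbedding (fun x : Fin n → ℝ => WithLp.toLp 2 (a + x)) := by
  have he : MeasurableEmbedding (fun x : Fin n → ℝ => WithLp.toLp 2 (a + x)) :=
    (MeasurableEquiv.toLp 2 (Fin n → ℝ)).measurableEmbedding.comp (measurableEmbedding_addLeft a)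
  have hmp : MeasurePreserving (fun x : Fin n → ℝ => WithLp.toLp 2 (a + x)) volume volume :=
    (PiLp.volume_preserving_toLp (Fin n)).comp (measurePreserving_add_left volume a)
  refine ⟨?_, he⟩
  have h := hmp.restrict_preimage_emb he Q
  rwa [Measure.restrict_congr_set, ← cubeMeasure_eq_restrict] at h
  have hsub₁ : openCube n ⊆ (fun x : Fin n → ℝ => WithLp.toLp 2 (a + x)) ⁻¹' Q := by
    intro x hx
    rw [hQ]
    refine fun i => (hI i).1 ⟨?_, ?_⟩ <;> have := hx i (mem_univ i) <;>
      simp [this.1, this.2]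
  have hsub₂ : (fun x : Fin n → ℝ => WithLp.toLp 2 (a + x)) ⁻¹' Q ⊆ Icc 0 1 := by
    intro x hx
    rw [hQ] at hx
    have h3 : ∀ i, a i ≤ a i + x i ∧ a i + x i ≤ a i + 1 := fun i => (hI i).2 (hx i)
    exact ⟨fun i => by simpa using (h3 i).1, fun i => by simpa using (h3 i).2⟩
  have h4 : openCube n =ᵐ[volume] Icc 0 1 := Measure.univ_pi_Ioo_ae_eq_Icc
  exact (hsub₂.eventuallyLE.trans h4.symm.le).antisymm hsub₁.eventuallyLE

theorem mainTheorem3 (n : ℕ) (R : ℝ) (hR : 1 ≤ R)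
    (Q : Set (EuclideanSpace ℝ (Fin n))) (hQ : IsAxisUnitCube Q)
    (f : EuclideanSpace ℝ (Fin n) → ℝ)
    (hf_meas : AEMeasurable f (volume.restrict Q))
    (hf_log : IsLogConcaveOn Q f)
    (hf_conv : IsCoordApproxConvexOn R Q f)
    (μ : Measure (EuclideanSpace ℝ (Fin n))) [IsProbabilityMeasure μ]
    (hμ : μ = (volume.restrict Q).withDensity (fun x => ENNReal.ofReal (f x)))
    (ν : Measure (EuclideanSpace ℝ (Fin n))) [IsProbabilityMeasure ν]
    (hν : ν ≪ μ) :
    transportCostSq μ ν ≤ ENNReal.ofReal (40 / 9 * R ^ 2) * InformationTheory.klDiv ν μ := by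
  -- unless the log-likelihood ratio is integrable, the relative entropy is infinite
  by_cases hint : Integrable (llr ν μ) ν
  swap
  · rw [InformationTheory.klDiv_of_not_integrable hint, ENNReal.mul_top]
    · exact le_top
    · exact (ENNReal.ofReal_pos.2 (by positivity)).ne'
  obtain ⟨a, I, hI, hQI⟩ := hQ
  set e : (Fin n → ℝ) → EuclideanSpace ℝ (Fin n) := fun x => WithLp.toLp 2 (a + x) with he
  obtain ⟨hmp, hemb⟩ : MeasurePreserving e (cubeMeasure n) (volume.restrict Q) ∧
      MeasurableEmbedding e := measurePreserving_cube hI hQI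
  set m := (volume : Measure (EuclideanSpace ℝ (Fin n))).restrict Q with hm
  have heQ : ∀ x ∈ openCube n, e x ∈ Q := by
    intro x hx
    rw [hQI]
    refine fun i => (hI i).1 ⟨?_, ?_⟩ <;> have := hx i (mem_univ i) <;>
      simp [he, this.1, this.2]
  have hecomb : ∀ (x y : Fin n → ℝ) (t : ℝ),
      e (t • x + (1 - t) • y) = t • e x + (1 - t) • e y := by
    intro x y t
    ext i
    simp [he]
    ring
  have hF : AEMeasurable (fun x => f (e x)) (cubeMeasure n) :=
    hf_meas.comp_quasiMeasurePreserving hmp.quasiMeasurePreserving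
  have hlc : IsLogConcaveUnit fun x => f (e x) := by
    refine ⟨fun x hx => hf_log.1 _ (heQ x hx), fun x hx y hy t h0 h1 => ?_⟩
    simp only [hecomb]
    exact hf_log.2 _ (heQ x hx) _ (heQ y hy) t h0 h1
  have hcc : IsCoordApproxConvexUnit R fun x => f (e x) := by
    intro i x hx y hy hxy t h0 h1
    simp only [hecomb]
    refine hf_conv _ (heQ x hx) _ (heQ y hy) ?_ t h0 h1
    have key : ∀ j, (e x - e y) j ≠ 0 → j = i := by
      intro j hj
      by_contra hji
      exact hj (by simp [he, hxy j hji])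
    exact fun j hj k hk => (key j hj).trans (key k hk).symm
  have hF1 : ∫⁻ x, ENNReal.ofReal (f (e x)) ∂cubeMeasure n = 1 := by
    rw [hmp.lintegral_comp_emb hemb (fun y => ENNReal.ofReal (f y)), ← setLIntegral_univ,
      ← withDensity_apply _ .univ, ← hμ, measure_univ]
  -- the density of `ν` and its relation to the log-likelihood ratio
  have hμm : μ ≪ m := hμ ▸ withDensity_absolutelyContinuous _ _
  have hνm : ν ≪ m := hν.trans hμm
  set r : EuclideanSpace ℝ (Fin n) → ℝ := fun y => (ν.rnDeriv m y).toReal with hr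
  have hrm : Measurable r := (Measure.measurable_rnDeriv ν m).ennreal_toReal
  have hrν : m.withDensity (fun y => ENNReal.ofReal (r y)) = ν := by
    conv_rhs => rw [← Measure.withDensity_rnDeriv_eq ν m hνm]
    refine withDensity_congr_ae ?_
    filter_upwards [Measure.rnDeriv_lt_top ν m] with y hy
    exact ENNReal.ofReal_toReal hy.ne
  have hchain : ∀ᵐ y ∂m, r y = (ν.rnDeriv μ y).toReal * (ENNReal.ofReal (f y)).toReal := by
    have h1 : μ.rnDeriv m =ᵐ[m] fun y => ENNReal.ofReal (f y) := by
      rw [hμ]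
      exact Measure.rnDeriv_withDensity₀ m hf_meas.ennreal_ofReal
    filter_upwards [h1, Measure.rnDeriv_mul_rnDeriv (κ := m) hν] with y hy1 hy2
    simp only [hr]
    rw [← hy2, ← hy1]
    exact ENNReal.toReal_mul
  -- `ν ≪ μ` says that the density of `ν` vanishes where `f` does
  have hpos : ∀ᵐ y ∂m, 0 < r y → 0 < f y := by
    filter_upwards [hchain] with y hy h0
    by_contra! hcon
    rw [hy, ENNReal.ofReal_of_nonpos hcon] at h0
    simp at h0
  have hllr : ∀ᵐ y ∂m, r y • llr ν μ y = r y * (Real.log (r y) - Real.log (f y)) := by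
    filter_upwards [hchain, hpos] with y hy hp
    have hr0 : 0 ≤ r y := ENNReal.toReal_nonneg
    rcases hr0.eq_or_lt with h0 | h0
    · simp [← h0]
    · have hfy := hp h0
      rw [ENNReal.toReal_ofReal hfy.le] at hy
      have hk : (ν.rnDeriv μ y).toReal ≠ 0 := by
        rintro hk
        rw [hk, zero_mul] at hy
        exact h0.ne' hy
      have : Real.log (r y) = llr ν μ y + Real.log (f y) := by
        rw [hy, Real.log_mul hk hfy.ne', llr]
      rw [this, smul_eq_mul]
      ring
  have hlog : Integrable (fun x => r (e x) * (Real.log (r (e x)) - Real.log (f (e x))))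
      (cubeMeasure n) := by
    refine (hmp.integrable_comp_emb hemb
      (g := fun y => r y * (Real.log (r y) - Real.log (f y)))).2 ?_
    exact ((integrable_rnDeriv_smul_iff hνm).2 hint).congr hllr
  have hD : cubeEntropy (fun x => r (e x)) (fun x => f (e x)) = ∫ y, llr ν μ y ∂ν := by
    rw [← integral_rnDeriv_smul hνm, integral_congr_ae hllr]
    exact hmp.integral_comp hemb fun y => r y * (Real.log (r y) - Real.log (f y))
  have hkl : InformationTheory.klDiv ν μ =
      ENNReal.ofReal (cubeEntropy (fun x => r (e x)) fun x => f (e x)) := by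
    rw [InformationTheory.klDiv_of_ac_of_integrable hν hint, hD]
    simp
  have hρ1 : ∫⁻ x, ENNReal.ofReal (r (e x)) ∂cubeMeasure n = 1 := by
    rw [hmp.lintegral_comp_emb hemb (fun y => ENNReal.ofReal (r y)), ← setLIntegral_univ,
      ← withDensity_apply _ .univ, hrν, measure_univ]
  have key : ∀ ε : ℝ, 0 < ε → transportCostSq μ ν ≤
      ENNReal.ofReal (40 / 9 * R ^ 2 *
        (cubeEntropy (fun x => r (e x)) (fun x => f (e x)) + 3 * ε)) +
        n * (ENNReal.ofReal ε + ENNReal.ofReal ε) := by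
    intro ε hε
    obtain ⟨γ, h1, h2, h3⟩ := exists_coupling_cube_le hR hlc hF hcc hF1
      (hrm.comp hemb.measurable) (fun x => ENNReal.toReal_nonneg) hρ1
      (hmp.quasiMeasurePreserving.ae hpos) hlog hε
    have hee : Measurable (Prod.map e e) := hemb.measurable.prodMap hemb.measurable
    have h1' : (γ.map (Prod.map e e)).map Prod.fst = μ := by
      rw [Measure.map_map measurable_fst hee, hμ,
        ← hmp.map_withDensity_comp hemb (fun y => ENNReal.ofReal (f y)), ← h1,
        Measure.map_map hemb.measurable measurable_fst]
      rfl
    have h2' : (γ.map (Prod.map e e)).map Prod.snd = ν := by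
      rw [Measure.map_map measurable_snd hee]
      conv_rhs => rw [← hrν, ← hmp.map_withDensity_comp hemb (fun y => ENNReal.ofReal (r y))]
      erw [← h2]
      rw [Measure.map_map hemb.measurable measurable_snd]
      rfl
    have hprob : IsProbabilityMeasure (γ.map (Prod.map e e)) := by
      refine ⟨?_⟩
      rw [← measure_univ (μ := μ), ← h1', Measure.map_apply measurable_fst .univ, preimage_univ]
    refine (iInf_le _ ⟨γ.map (Prod.map e e), hprob, h1', h2'⟩).trans (le_of_eq_of_le ?_ h3)
    rw [lintegral_map (by fun_prop) hee]
    refine lintegral_congr fun p => ?_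
    rw [EuclideanSpace.real_norm_sq_eq]
    simp [he]
  have hlim : Tendsto (fun ε : ℝ => ENNReal.ofReal (40 / 9 * R ^ 2 *
        (cubeEntropy (fun x => r (e x)) (fun x => f (e x)) + 3 * ε)) +
        n * (ENNReal.ofReal ε + ENNReal.ofReal ε)) (𝓝[>] 0)
      (𝓝 (ENNReal.ofReal (40 / 9 * R ^ 2 *
        (cubeEntropy (fun x => r (e x)) (fun x => f (e x)) + 3 * 0)) +
        n * (ENNReal.ofReal 0 + ENNReal.ofReal 0))) := by
    refine Tendsto.mono_left (Continuous.tendsto ?_ 0) nhdsWithin_le_nhds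
    refine (ENNReal.continuous_ofReal.comp (by fun_prop)).add
      ((ENNReal.continuous_const_mul (ENNReal.natCast_ne_top n)).comp
        (ENNReal.continuous_ofReal.add ENNReal.continuous_ofReal))
  have hle := ge_of_tendsto hlim (eventually_mem_nhdsWithin.mono fun ε hε => key ε hε)
  rw [mul_zero, add_zero, ENNReal.ofReal_zero, add_zero, mul_zero, add_zero,
    ENNReal.ofReal_mul (by positivity)] at hle
  rwa [hkl]
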